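/- A generalised triangulation $\mathfrak{T}$ of a closed 3-manifold consists of $n$ abstract tetrahedra whose $4n$ triangular faces are glued in pairs so that the quotient space is a closed 3-manifold; its edges $E$ and triangles $F$ are the classes of edges and faces of the tetrahedra under the gluings. $\mathrm{Adm}(\mathfrak{T},4)$ is the set of colourings $\hat\theta\colon E\to\{0,\frac12,1\}$ such that the colours $i,j,k$ of the edges of every triangle satisfy $i+j+k\in\mathbb{Z}$, the triangle inequalities, and $i+j+k\le 2$. For $q\in\{1,3\}$ let $$\mathrm{TV}_{4,q}(\mathfrak{T})=\sum_{\hat\theta\in\mathrm{Adm}(\mathfrak{T},4)}\ \prod_{e}|e|_{\hat\theta}\prod_{f}|f|_{\hat\theta}\prod_{t}|t|_{\hat\theta}$$ be the Turaev–Viro state sum, the products being over edges, triangles and tetrahedra and the constant vertex weight $\frac14$ being omitted. Here $\zeta=e^{i\pi q/4}$, $[0]=1$, $[k]=(\zeta^k-\zeta^{-k})/(\zeta-\zeta^{-1})$ for $k\ge 1$, $[k]!=[k][k-1]\cdots[0]$; an edge of colour $i$ has weight $(-1)^{2i}[2i+1]$; a triangle with colours $i,j,k$ has weight $(-1)^{i+j+k}\,[i+j-k]!\,[i+k-j]!\,[j+k-i]!\,/\,[i+j+k+1]!$;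 a tetrahedron has weight $$\sum_{y}\frac{(-1)^y[y+1]!}{\prod_{s}[y-s]!\ \prod_{p}[p-y]!},$$ where $s$ runs through the sums of the three colours around each of its four triangles, $p$ through the sums of the four colours on each of its three quadrilaterals (the six edges minus a pair of opposite edges), and $y$ through the integers with $\max s\le y\le\min p$. For $\hat\theta\in\mathrm{Adm}(\mathfrak{T},4)$ let $\alpha(\hat\theta)$ be the number of octagons, i.e. of tetrahedra in which two opposite edges have colour $1$ and the other four have colour $\frac12$. Let $\theta=\hat\theta-\lfloor\hat\theta\rfloor$ be the reduction of $\hat\theta$ and $S_\theta$ its surface, which has one vertex on each edge of $\theta$-colour $\frac12$, one arc in each triangle and one disc in each tetrahedron having such edges; $\chi(S_\theta)$ is its Euler characteristic. For $m\in\mathbb{Z}$ let $b^+_m$ (resp. $b^-_m$) be the number of $\hat\theta\in\mathrm{Adm}(\mathfrak{T},4)$ with $\alpha(\hat\theta)$ even (resp. odd) and $\chi(S_\theta)=m$, and let $$P_{\mathfrak{T}}(z)=\sum_{\hat\theta\in\mathrm{Adm}(\mathfrak{T},4)}(-1)^{\alpha(\hat\theta)}z^{\chi(S_\theta)}=\sum_{m\in\mathbb{Z}}a_mz^m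 .$$ **Theorem.** 1. For every generalised triangulation $\mathfrak{T}$ of a closed 3-manifold, $\mathrm{TV}_{4,1}(\mathfrak{T})=P_{\mathfrak{T}}(-\sqrt2)$ and $\mathrm{TV}_{4,3}(\mathfrak{T})=P_{\mathfrak{T}}(\sqrt2)$; moreover $a_m=b^+_m-b^-_m$ for all $m\in\mathbb{Z}$. 2. There is a constant $C$ such that, for every $\mathfrak{T}$ with $n$ tetrahedra, $a_m\ne0$ implies $|m|\le Cn$. 3. The two counting problems "given a closed 3-manifold triangulation $\mathfrak{T}$ and an integer $m$ in binary, output $b^+_m$" and "given $\mathfrak{T}$ and $m$, output $b^-_m$" belong to #P, in the sense that each is the restriction, to the encodings of its instances, of a function in #P. 4. There is an algorithm with oracles for these two problems which, given a closed 3-manifold triangulation $\mathfrak{T}$ with $n$ tetrahedra, outputs $P_{\mathfrak{T}}$, as a list of exponents and integer coefficients, in time polynomial in $n$ and with polynomially many (in $n$) oracle calls. For each $q\in\{1,3\}$ there is such an algorithm that outputs $\mathrm{TV}_{4,q}(\mathfrak{T})$ exactly, in the form $(a+b\sqrt2)/2^k$ with $a,b\in\mathbb{Z}$, $k\in\mathbb{N}$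 written in binary. -/

import Mathlib

/-! ### Generalised triangulations -/

/-- `n` abstract tetrahedra, each with vertices `0, 1, 2, 3`, whose `4n` triangular faces are
identified in pairs. The face `(t, i)` is the face of the tetrahedron `t` opposite its vertex `i`.
It is glued to the face `(adj t i, perm t i i)`, each vertex `j ≠ i` of the face being sent to the
vertex `perm t i j` of the tetrahedron `adj t i`. -/
structure Gluing where
  n : ℕ
  adj : Fin n → Fin 4 → Fin n
  perm : Fin n → Fin 4 → Equiv.Perm (Fin 4)
  adj_adj : ∀ t i, adj (adj t i) (perm t i i) = t
  perm_perm : ∀ t i, perm (adj t i) (perm t i i) = (perm t i)⁻¹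
  no_fixed_face : ∀ t i, ¬ (adj t i = t ∧ perm t i i = i)

namespace Gluing

/-- The identification of points induced by the gluing maps: `x` lies on the face of `t` opposite
`i` (its `i`-th barycentric coordinate vanishes), and `y` is the point with the transported
barycentric coordinates. -/
def PointRel (G : Gluing) (p p' : Fin G.n × stdSimplex ℝ (Fin 4)) : Prop :=
  ∃ i : Fin 4, p.2.1 i = 0 ∧ p'.1 = G.adj p.1 i ∧ ∀ j, p'.2.1 (G.perm p.1 i j) = p.2.1 j

/-- The underlying topological space, with the quotient topology. -/
def Space (G : Gluing) : Type := Quot G.PointRel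

instance (G : Gluing) : TopologicalSpace G.Space :=
  inferInstanceAs (TopologicalSpace (Quot G.PointRel))

/-- The underlying space is a closed 3-manifold: compact, Hausdorff and locally Euclidean of
dimension three, without boundary (second countability follows). -/
def IsClosedThreeManifold (G : Gluing) : Prop :=
  CompactSpace G.Space ∧ T2Space G.Space ∧
    Nonempty (ChartedSpace (EuclideanSpace ℝ (Fin 3)) G.Space)

/-- An edge of one of the abstract tetrahedra: an unordered pair of distinct vertices. -/
abbrev LocalEdge (G : Gluing) : Type := Fin G.n × {s : Sym2 (Fin 4) // ¬ s.IsDiag}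

/-- The edges of the triangulation: edges of the tetrahedra up to the equivalence relation
generated by the gluing maps. -/
def Edge (G : Gluing) : Type :=
  Quot fun x y : G.LocalEdge =>
    ∃ i : Fin 4, i ∉ x.2.1 ∧ y.1 = G.adj x.1 i ∧ y.2.1 = x.2.1.map (G.perm x.1 i)

/-- The triangles of the triangulation: faces `(t, i)` of the tetrahedra up to the equivalence
relation generated by the gluing maps. -/
def Triangle (G : Gluing) : Type :=
  Quot fun x y : Fin G.n × Fin 4 => y = (G.adj x.1 x.2, G.perm x.1 x.2 x.2)

noncomputable instance (G : Gluing) : Fintype G.Edge :=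
  haveI : Finite G.Edge := inferInstanceAs (Finite (Quot _))
  Fintype.ofFinite _

noncomputable instance (G : Gluing) : Fintype G.Triangle :=
  haveI : Finite G.Triangle := inferInstanceAs (Finite (Quot _))
  Fintype.ofFinite _

/-- The edge of the triangulation that joins the vertices `a` and `b` of the tetrahedron `t`. -/
def edge (G : Gluing) (t : Fin G.n) (a b : Fin 4) (h : a ≠ b) : G.Edge :=
  Quot.mk _ (t, ⟨s(a, b), by simpa using h⟩)

/-- The three edges of the face of `t` opposite `i`; its vertices are `i.succAbove 0`,
`i.succAbove 1` and `i.succAbove 2`. -/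
def triangleEdge (G : Gluing) (x : Fin G.n × Fin 4) : Fin 3 → G.Edge :=
  ![G.edge x.1 (x.2.succAbove 0) (x.2.succAbove 1)
      (Fin.succAbove_right_injective.ne (by decide)),
    G.edge x.1 (x.2.succAbove 0) (x.2.succAbove 2)
      (Fin.succAbove_right_injective.ne (by decide)),
    G.edge x.1 (x.2.succAbove 1) (x.2.succAbove 2)
      (Fin.succAbove_right_injective.ne (by decide))]

/-- The six edges of `t`. The four triangles have edges `(0, 1, 3)`, `(0, 2, 4)`, `(1, 2, 5)`,
`(3, 4, 5)`, and the pairs of opposite edges are `(0, 5)`, `(1, 4)`, `(2, 3)`. -/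
def tetEdge (G : Gluing) (t : Fin G.n) : Fin 6 → G.Edge :=
  ![G.edge t 0 1 (by decide), G.edge t 0 2 (by decide), G.edge t 0 3 (by decide),
    G.edge t 1 2 (by decide), G.edge t 1 3 (by decide), G.edge t 2 3 (by decide)]

/-! ### Admissible colourings

Colours are stored doubled: the colour `i ∈ {0, 1/2, …, (r-2)/2}` is the number `2i < r - 1`. -/

/-- Three (doubled) colours that may occur around a triangle. -/
def AdmissibleTriple (r a b c : ℕ) : Prop :=
  Even (a + b + c) ∧ a ≤ b + c ∧ b ≤ a + c ∧ c ≤ a + b ∧ a + b + c ≤ 2 * (r - 2)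

def IsAdmissible (G : Gluing) (r : ℕ) (θ : G.Edge → Fin (r - 1)) : Prop :=
  ∀ x : Fin G.n × Fin 4,
    AdmissibleTriple r (θ (G.triangleEdge x 0)) (θ (G.triangleEdge x 1)) (θ (G.triangleEdge x 2))

/-- The admissible colourings `Adm(𝔗, r)`. -/
def Adm (G : Gluing) (r : ℕ) : Type := {θ : G.Edge → Fin (r - 1) // G.IsAdmissible r θ}

noncomputable instance (G : Gluing) (r : ℕ) : Fintype (G.Adm r) :=
  haveI : Finite (G.Adm r) := inferInstanceAs (Finite {θ // G.IsAdmissible r θ})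
  Fintype.ofFinite _

end Gluing

/-! ### Turaev–Viro weights -/

noncomputable def zeta (r q : ℕ) : ℂ := Complex.exp (Complex.I * Real.pi * q / r)

/-- The quantum integer `[i]`, with the convention `[0] = 1`. -/
noncomputable def qInt (r q i : ℕ) : ℂ :=
  if i = 0 then 1 else
    (zeta r q ^ i - (zeta r q)⁻¹ ^ i) / (zeta r q - (zeta r q)⁻¹)

/-- The bracket factorial `[i]! = [i] [i-1] ⋯ [0]`. -/
noncomputable def qFact (r q i : ℕ) : ℂ := ∏ j ∈ Finset.range (i + 1), qInt r q j

/-- The weight of an edge of (doubled) colour `a`. -/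
noncomputable def edgeWeight (r q a : ℕ) : ℂ := (-1) ^ a * qInt r q (a + 1)

/-- The weight of a triangle whose edges have (doubled) colours `a, b, c`. -/
noncomputable def triangleWeight (r q a b c : ℕ) : ℂ :=
  (-1) ^ ((a + b + c) / 2) *
    (qFact r q ((a + b - c) / 2) * qFact r q ((a + c - b) / 2) * qFact r q ((b + c - a) / 2)) /
      qFact r q ((a + b + c) / 2 + 1)

/-- The weight of a tetrahedron whose edges have (doubled) colours `c 0, …, c 5`. -/
noncomputable def tetWeight (r q : ℕ) (c : Fin 6 → ℕ) : ℂ :=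
  let s₁ := (c 0 + c 1 + c 3) / 2
  let s₂ := (c 0 + c 2 + c 4) / 2
  let s₃ := (c 1 + c 2 + c 5) / 2
  let s₄ := (c 3 + c 4 + c 5) / 2
  let q₁ := (c 0 + c 1 + c 4 + c 5) / 2
  let q₂ := (c 0 + c 2 + c 3 + c 5) / 2
  let q₃ := (c 1 + c 2 + c 3 + c 4) / 2
  ∑ z ∈ Finset.Icc (max (max s₁ s₂) (max s₃ s₄)) (min q₁ (min q₂ q₃)),
    (-1) ^ z * qFact r q (z + 1) /
      ((qFact r q (z - s₁) * qFact r q (z - s₂) * qFact r q (z - s₃) * qFact r q (z - s₄)) *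
        (qFact r q (q₁ - z) * qFact r q (q₂ - z) * qFact r q (q₃ - z)))

namespace Gluing

/-- The weight of a colouring, the constant vertex weight being omitted. The weight of a triangle
is symmetric in its three colours, so the choice of a representative `f.out` is immaterial. -/
noncomputable def weight (G : Gluing) (r q : ℕ) (θ : G.Edge → Fin (r - 1)) : ℂ :=
  (∏ e : G.Edge, edgeWeight r q (θ e)) *
  (∏ f : G.Triangle, triangleWeight r q (θ (G.triangleEdge f.out 0))
    (θ (G.triangleEdge f.out 1)) (θ (G.triangleEdge f.out 2))) *
  ∏ t : Fin G.n, tetWeight r q fun k => θ (G.tetEdge t k)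

/-- The Turaev–Viro state sum `TV_{r,q}`, the constant vertex weight being omitted. -/
noncomputable def TV (G : Gluing) (r q : ℕ) : ℂ := ∑ θ : G.Adm r, G.weight r q θ.1

/-! ### Octagons, reductions, and the Euler characteristic of the reduced surface -/

/-- The reduction `θ(e) - ⌊θ(e)⌋`: on doubled colours, the remainder modulo two. The result takes
the colours `0` and `1/2` only. -/
def reduction (G : Gluing) (θ : G.Edge → Fin (4 - 1)) : G.Edge → Fin (3 - 1) :=
  fun e => ⟨(θ e : ℕ) % 2, Nat.mod_lt _ (by decide)⟩

/-- The Euler characteristic `#vertices - #arcs + #discs` of the surface `S_θ` of a colouring with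
colours `0` and `1/2`, with its cell structure as a normal surface. The surface meets each edge
coloured `1/2` in one point, each triangle with edges coloured `1/2` (it has exactly two such edges)
in one arc, and each tetrahedron with edges coloured `1/2` in one disc, namely a triangle or a
quadrilateral. -/
noncomputable def eulerChar (G : Gluing) (θ : G.Edge → Fin (3 - 1)) : ℤ :=
  (Nat.card {e : G.Edge // (θ e : ℕ) = 1} : ℤ)
  - Nat.card {f : G.Triangle // ∃ x, Quot.mk _ x = f ∧ ∃ k, (θ (G.triangleEdge x k) : ℕ) = 1}
  + Nat.card {t : Fin G.n // ∃ k, (θ (G.tetEdge t k) : ℕ) = 1}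

/-- The tetrahedron `t` is coloured `(1, 1/2, 1/2, 1, 1/2, 1/2)` up to symmetry: two opposite edges
have colour `1`, the other four have colour `1/2`. The surface meets it in an octagon. -/
def IsOctagon (G : Gluing) (θ : G.Edge → Fin (4 - 1)) (t : Fin G.n) : Prop :=
  ∃ σ : Equiv.Perm (Fin 4),
    (θ (G.edge t (σ 0) (σ 1) (σ.injective.ne (by decide))) : ℕ) = 2 ∧
    (θ (G.edge t (σ 2) (σ 3) (σ.injective.ne (by decide))) : ℕ) = 2 ∧
    (θ (G.edge t (σ 0) (σ 2) (σ.injective.ne (by decide))) : ℕ) = 1 ∧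
    (θ (G.edge t (σ 0) (σ 3) (σ.injective.ne (by decide))) : ℕ) = 1 ∧
    (θ (G.edge t (σ 1) (σ 2) (σ.injective.ne (by decide))) : ℕ) = 1 ∧
    (θ (G.edge t (σ 1) (σ 3) (σ.injective.ne (by decide))) : ℕ) = 1

/-- The number `α` of octagons. -/
noncomputable def octagons (G : Gluing) (θ : G.Edge → Fin (4 - 1)) : ℕ :=
  Nat.card {t : Fin G.n // G.IsOctagon θ t}

/-- The Laurent polynomial `P_𝔗(z) = ∑ (-1)^α z^χ(S_θ)`, the sum being over `Adm(𝔗, 4)`. -/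
noncomputable def laurentP (G : Gluing) : LaurentPolynomial ℤ :=
  ∑ θ : G.Adm 4, LaurentPolynomial.C ((-1) ^ G.octagons θ.1) *
    LaurentPolynomial.T (G.eulerChar (G.reduction θ.1))

/-- `b⁺_m`: the number of colourings with an even number of octagons and `χ(S_θ) = m`. -/
noncomputable def evenCount (G : Gluing) (m : ℤ) : ℕ :=
  Nat.card {θ : G.Adm 4 // Even (G.octagons θ.1) ∧ G.eulerChar (G.reduction θ.1) = m}

/-- `b⁻_m`: the number of colourings with an odd number of octagons and `χ(S_θ) = m`. -/
noncomputable def oddCount (G : Gluing) (m : ℤ) : ℕ :=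
  Nat.card {θ : G.Adm 4 // Odd (G.octagons θ.1) ∧ G.eulerChar (G.reduction θ.1) = m}

end Gluing

/-- A generalised triangulation of a closed 3-manifold. -/
structure Triangulation extends Gluing where
  manifold : toGluing.IsClosedThreeManifold

/-- The value of a Laurent polynomial at a non-zero complex number. -/
noncomputable def laurentEval (p : LaurentPolynomial ℤ) (z : ℂ) : ℂ :=
  ∑ m ∈ p.coeff.support, (p.coeff m : ℂ) * z ^ m

/-! ### A machine model with step counts

Data are binary trees (equivalently, balanced bit strings). Programs are built from the elementary
operations on pairs by composition, pairing, branching and unbounded while loops, and may call two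
oracles. An elementary operation costs one plus the size of its operand, an oracle call costs one
plus the sizes of query and answer. Hence no value is larger than the time spent, and time is
polynomially related to the time of a multitape (oracle) Turing machine. -/

inductive Val where
  | nil : Val
  | pair : Val → Val → Val

namespace Val

def size : Val → ℕ
  | nil => 1
  | pair a b => 1 + a.size + b.size

def fst : Val → Val
  | nil => nil
  | pair a _ => a

def snd : Val → Val
  | nil => nil
  | pair _ b => b

end Val

inductive Prog where
  | id : Prog
  | nil : Prog
  | fst : Prog
  | snd : Prog
  | pair (f g : Prog) : Prog
  | comp (g f : Prog) : Prog
  | ite (c f g : Prog) : Prog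
  | loop (c f : Prog) : Prog
  | call (b : Bool) : Prog

/-- Two oracles: `O b x y` means that oracle `b` answers the query `x` by `y`. A program that makes
a query without an answer does not terminate. -/
abbrev Oracles : Type := Bool → Val → Val → Prop

/-- `Eval O p x y t k`: the program `p`, started on `x` with oracles `O`, terminates with result `y`
in time `t`, having made `k` oracle calls. The value `nil` counts as false. -/
inductive Eval (O : Oracles) : Prog → Val → Val → ℕ → ℕ → Prop where
  | id (x) : Eval O .id x x (1 + x.size) 0
  | nil (x) : Eval O .nil x .nil (1 + x.size) 0
  | fst (x) : Eval O .fst x x.fst (1 + x.size) 0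
  | snd (x) : Eval O .snd x x.snd (1 + x.size) 0
  | pair {f g x y z t t' k k'} : Eval O f x y t k → Eval O g x z t' k' →
      Eval O (.pair f g) x (.pair y z) (t + t' + 1) (k + k')
  | comp {f g x y z t t' k k'} : Eval O f x y t k → Eval O g y z t' k' →
      Eval O (.comp g f) x z (t + t' + 1) (k + k')
  | ite_true {c f g x v y t t' k k'} : Eval O c x v t k → v ≠ .nil → Eval O f x y t' k' →
      Eval O (.ite c f g) x y (t + t' + 1) (k + k')
  | ite_false {c f g x y t t' k k'} : Eval O c x .nil t k → Eval O g x y t' k' →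
      Eval O (.ite c f g) x y (t + t' + 1) (k + k')
  | loop_stop {c f x t k} : Eval O c x .nil t k → Eval O (.loop c f) x x (t + 1) k
  | loop_step {c f x v y z t t' t'' k k' k''} : Eval O c x v t k → v ≠ .nil →
      Eval O f x y t' k' → Eval O (.loop c f) y z t'' k'' →
      Eval O (.loop c f) x z (t + t' + t'' + 1) (k + k' + k'')
  | call {b x y} : O b x y → Eval O (.call b) x y (1 + x.size + y.size) 1

def noOracles : Oracles := fun _ _ _ => False

/-- `f` is computed by an oracle-free program in time polynomial in the size of the input. -/
def PolyTime (f : Val → Val) : Prop :=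
  ∃ (p : Prog) (P : Polynomial ℕ), ∀ x, ∃ t, t ≤ P.eval x.size ∧ Eval noOracles p x (f x) t 0

/-! ### Encodings

All encodings below are injective, so that programs with counting oracles are deterministic. -/

namespace Val

def ofList : List Val → Val
  | [] => nil
  | a :: l => pair a (ofList l)

def ofBool : Bool → Val
  | false => nil
  | true => pair nil nil

def ofBits (l : List Bool) : Val := ofList (l.map ofBool)

/-- Binary encoding, least significant bit first. -/
def ofNat (n : ℕ) : Val := ofBits n.bits

/-- Sign (true for negative numbers) and absolute value in binary. -/
def ofInt (m : ℤ) : Val := pair (ofBool (decide (m < 0))) (ofNat m.natAbs)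

/-- The gluing table: for each tetrahedron and each of its four faces, the adjacent tetrahedron and
the images of the four vertices under the gluing permutation. -/
def ofGluing (G : Gluing) : Val :=
  ofList (List.ofFn fun t : Fin G.n => ofList (List.ofFn fun i : Fin 4 =>
    pair (ofNat (G.adj t i)) (ofList (List.ofFn fun j : Fin 4 => ofNat (G.perm t i j)))))

/-- An instance of a counting problem: a triangulation and an integer. -/
def ofInstance (a : Triangulation × ℤ) : Val := pair (ofGluing a.1.toGluing) (ofInt a.2)

end Val

/-! ### Counting problems and reductions -/

/-- The class #P: `g x` is the number of bit strings `w` of length at most polynomial in the size of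
`x` that are accepted, together with `x`, by a polynomial time verifier. -/
def SharpP (g : Val → ℕ) : Prop :=
  ∃ (F : Val → Val) (P : Polynomial ℕ), PolyTime F ∧
    ∀ x, g x = Set.ncard {w : List Bool |
      w.length ≤ P.eval x.size ∧ F (.pair x (Val.ofBits w)) ≠ .nil}

/-- A counting problem belongs to #P if it is, on the encodings of its instances, the restriction of
a function of the class #P. -/
def InSharpP (f : Triangulation × ℤ → ℕ) : Prop :=
  ∃ g : Val → ℕ, SharpP g ∧ ∀ a, g (Val.ofInstance a) = f a

/-- Counting even octagons colourings. -/
noncomputable def countEven (a : Triangulation × ℤ) : ℕ := a.1.evenCount a.2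

/-- Counting odd octagons colourings. -/
noncomputable def countOdd (a : Triangulation × ℤ) : ℕ := a.1.oddCount a.2

/-- The oracles for two counting problems; they answer queries that encode an instance. -/
def countingOracles (f g : Triangulation × ℤ → ℕ) : Oracles := fun b x y =>
  ∃ a, x = Val.ofInstance a ∧ y = Val.ofNat (if b then f a else g a)

/-- The task of finding, given a triangulation `𝔗`, a solution `b` of `R 𝔗 b` is solved by one
program which has oracles for the counting problems `f` and `g`, and whose running time and number
of oracle calls are bounded by a polynomial in the number of tetrahedra. -/
def ReducesToCounting (f g : Triangulation × ℤ → ℕ) {β : Type} (enc : β → Val)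
    (R : Triangulation → β → Prop) : Prop :=
  ∃ (p : Prog) (time calls : Polynomial ℕ), ∀ 𝔗 : Triangulation, ∃ (b : β) (t k : ℕ),
    Eval (countingOracles f g) p (Val.ofGluing 𝔗.toGluing) (enc b) t k ∧ R 𝔗 b ∧
      t ≤ time.eval 𝔗.n ∧ k ≤ calls.eval 𝔗.n

/-- A number `(a + b √2) / 2^k`, written exactly by the integers `a`, `b` and `k ≥ 0`. -/
structure SqrtTwoNumber where
  a : ℤ
  b : ℤ
  k : ℕ

noncomputable def SqrtTwoNumber.value (x : SqrtTwoNumber) : ℂ :=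
  ((x.a : ℂ) + x.b * (Real.sqrt 2 : ℝ)) / 2 ^ x.k

def SqrtTwoNumber.enc (x : SqrtTwoNumber) : Val :=
  .pair (Val.ofInt x.a) (.pair (Val.ofInt x.b) (Val.ofNat x.k))

/-- A Laurent polynomial written as a list of pairs (exponent, coefficient). -/
def encTerms (l : List (ℤ × ℤ)) : Val :=
  Val.ofList (l.map fun x => .pair (Val.ofInt x.1) (Val.ofInt x.2))

noncomputable def ofTerms (l : List (ℤ × ℤ)) : LaurentPolynomial ℤ :=
  (l.map fun x => LaurentPolynomial.C x.2 * LaurentPolynomial.T x.1).sum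

/-!
The proof has two independent halves.

*The state sum.* For `r = 4` and `q = 1, 3` the quantum integers are `[1] = [3] = 1` and `[2] =
±√2` (`QuantumTwo`). Hence, up to sign, the weight of an edge, triangle or tetrahedron is `z`,
`z⁻¹` or `z` with `z = -[2]` if it meets the surface, and `1` otherwise, and the weight of a
colouring is `z` to the power of the Euler characteristic. The signs are local as well: every
triangle is the class of exactly two faces (`Gluing.sum_faces`), so the signs of the triangles can
be distributed among the tetrahedra, and a check of all colourings of one tetrahedron
(`tetIdentity`) shows that only the signs of the octagons are left (`Gluing.weight_eq`). As there
are at most `6 n` edges, `4 n` triangles and `n` tetrahedra, each contributing at most `1`, the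
Euler characteristic is at most `8 n` in absolute value.

*The complexity.* `Feasible O f` says that `f` is computed, on encodings, by a program that runs
in polynomial time with the oracles `O`. The class of these functions is closed under composition,
pairing, branching and those folds over lists whose intermediate results stay polynomially large
(`Feasible.foldl`), and it contains equality (`Feasible.eq`) and binary arithmetic. Thus each
algorithm is given as an ordinary function, and the tactic `fun_prop` assembles the program.

A witness for the counting problems consists of two bits for each edge. The verifier computes the
edges from the gluing table by merging classes of oriented edges of tetrahedra
(`Verifier.exists_edgeClasses`), reads off the colours, and tests admissibility, the parity of the
number of octagons and the Euler characteristic; the accepted witnesses are in bijection with the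
colourings to be counted (`Verifier.card_accepted`). With the two counting oracles, the Laurent
polynomial is the list of its coefficients of degrees `-8 n, …, 8 n`, and its values at `±√2` are
obtained by Horner's scheme in `ℤ[√2]`.
-/

/-! ### Running times -/

theorem Val.one_le_size (x : Val) : 1 ≤ x.size := by
  cases x <;> simp only [Val.size] <;> omega

theorem Polynomial.eval_mono_nat (P : Polynomial ℕ) {a b : ℕ} (h : a ≤ b) :
    P.eval a ≤ P.eval b := by
  rw [Polynomial.eval_eq_sum, Polynomial.eval_eq_sum]
  exact Finset.sum_le_sum fun i _ => Nat.mul_le_mul_left _ (Nat.pow_le_pow_left h i)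

namespace Eval

variable {O : Oracles}

theorem lt_time {p : Prog} {x y : Val} {t k : ℕ} (h : Eval O p x y t k) : x.size < t := by
  induction h <;> omega

/-- No value is larger than the time spent on computing it. -/
theorem size_le_time {p : Prog} {x y : Val} {t k : ℕ} (h : Eval O p x y t k) : y.size ≤ t := by
  induction h with
  | id x => omega
  | nil x => simp [Val.size]
  | fst x => cases x <;> simp only [Val.fst, Val.size] <;> omega
  | snd x => cases x <;> simp only [Val.snd, Val.size] <;> omega
  | pair _ _ h₁ h₂ => simp only [Val.size]; omega
  | loop_stop h _ => have := h.lt_time; omega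
  | _ => omega

theorem calls_le_time {p : Prog} {x y : Val} {t k : ℕ} (h : Eval O p x y t k) : k ≤ t := by
  induction h <;> omega

theorem no_calls {p : Prog} {x y : Val} {t k : ℕ} (h : Eval noOracles p x y t k) : k = 0 := by
  induction h with
  | call h => exact h.elim
  | _ => omega

/-- A loop that passes through the values `s 0, …, s N`, each test and each step taking time at
most `τ`. -/
theorem loop_of_states {c f : Prog} {τ : ℕ} (N : ℕ) (s : ℕ → Val)
    (hc : ∀ j < N, ∃ v t k, v ≠ Val.nil ∧ t ≤ τ ∧ Eval O c (s j) v t k)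
    (hN : ∃ t k, t ≤ τ ∧ Eval O c (s N) .nil t k)
    (hf : ∀ j < N, ∃ t k, t ≤ τ ∧ Eval O f (s j) (s (j + 1)) t k) :
    ∃ t k, t ≤ (N + 1) * (2 * τ + 1) ∧ Eval O (.loop c f) (s 0) (s N) t k := by
  induction N generalizing s with
  | zero =>
    obtain ⟨t, k, ht, h⟩ := hN
    exact ⟨_, _, by omega, loop_stop h⟩
  | succ N ih =>
    obtain ⟨v, t, k, hv, ht, h⟩ := hc 0 (by omega)
    obtain ⟨t', k', ht', h'⟩ := hf 0 (by omega)
    obtain ⟨t'', k'', ht'', h''⟩ := ih (fun j => s (j + 1)) (fun j hj => hc (j + 1) (by omega)) hN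
      (fun j hj => hf (j + 1) (by omega))
    refine ⟨_, _, ?_, .loop_step h hv h' h''⟩
    rw [Nat.succ_mul]
    omega

end Eval

/-! ### Polynomial-time functions between encoded types -/

/-- A type whose elements are encoded by values. The encoding need not be injective. -/
class Enc (α : Type) where
  enc : α → Val

open Enc (enc)

/-- Types whose encoding is injective, so that equality can be decided on encodings. -/
class EncInj (α : Type) [Enc α] : Prop where
  inj : Function.Injective (enc : α → Val)

/-- The size of the encoding. -/
def sz {α : Type} [Enc α] (a : α) : ℕ := (enc a).size

instance : Enc Val := ⟨id⟩
instance : Enc Bool := ⟨Val.ofBool⟩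
instance : Enc ℕ := ⟨Val.ofNat⟩
instance : Enc ℤ := ⟨Val.ofInt⟩
instance {α : Type} [Enc α] : Enc (List α) := ⟨fun l => Val.ofList (l.map enc)⟩
instance {α β : Type} [Enc α] [Enc β] : Enc (α × β) := ⟨fun x => .pair (enc x.1) (enc x.2)⟩
instance {k : ℕ} : Enc (Fin k) := ⟨fun i => Val.ofNat i⟩
instance {α : Type} [Enc α] {k : ℕ} : Enc (Fin k → α) := ⟨fun f => enc (List.ofFn f)⟩

/-- `f` is computed, on encodings, by a program that runs in time polynomial in the size of the
encoded argument and may call the oracles `O`. -/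
@[fun_prop]
def Feasible {α β : Type} [Enc α] [Enc β] (O : Oracles) (f : α → β) : Prop :=
  ∃ (p : Prog) (P : Polynomial ℕ), ∀ a, ∃ t k, t ≤ P.eval (sz a) ∧ Eval O p (enc a) (enc (f a)) t k

section Basic

variable {O : Oracles} {α β γ δ : Type} [Enc α] [Enc β] [Enc γ] [Enc δ]

theorem one_le_sz (a : α) : 1 ≤ sz a := Val.one_le_size _

theorem sz_pair (a : α) (b : β) : sz (a, b) = 1 + sz a + sz b := rfl

theorem sz_nil : sz ([] : List α) = 1 := rfl

theorem sz_cons (a : α) (l : List α) : sz (a :: l) = 1 + sz a + sz l := rfl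

theorem sz_list (l : List α) : sz l = 1 + (l.map fun a => 1 + sz a).sum := by
  induction l with
  | nil => rfl
  | cons a l ih => rw [sz_cons, ih, List.map_cons, List.sum_cons]; omega

theorem sz_append (l l' : List α) : sz (l ++ l') + 1 = sz l + sz l' := by
  simp only [sz_list, List.map_append, List.sum_append]; omega

theorem length_lt_sz (l : List α) : l.length < sz l := by
  induction l with
  | nil => simp [sz_nil]
  | cons a l ih => rw [sz_cons, List.length_cons]; omega

theorem sz_le_of_mem {a : α} {l : List α} (h : a ∈ l) : sz a < sz l := by
  induction l with
  | nil => simp at h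
  | cons b l ih =>
    rw [sz_cons]
    rcases List.mem_cons.1 h with rfl | h
    · have := one_le_sz l; omega
    · have := ih h; omega

theorem sz_le_of_sublist {l l' : List α} (h : l.Sublist l') : sz l ≤ sz l' := by
  induction h with
  | slnil => rfl
  | cons a _ ih => rw [sz_cons]; omega
  | cons_cons a _ ih => rw [sz_cons, sz_cons]; omega

/-- A list of at most `N` elements of size at most `B`. -/
theorem sz_list_le {l : List α} {N B : ℕ} (hN : l.length ≤ N) (hB : ∀ a ∈ l, sz a ≤ B) :
    sz l ≤ 1 + N * (1 + B) := by
  rw [sz_list]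
  have := List.sum_le_card_nsmul (l.map fun a => 1 + sz a) (1 + B) (by
    simp only [List.mem_map]
    rintro _ ⟨a, ha, rfl⟩
    have := hB a ha
    omega)
  rw [List.length_map, smul_eq_mul] at this
  have := Nat.mul_le_mul_right (1 + B) hN
  omega

namespace Feasible

theorem size_bound {f : α → β} (hf : Feasible O f) :
    ∃ P : Polynomial ℕ, ∀ a, sz (f a) ≤ P.eval (sz a) := by
  obtain ⟨p, P, h⟩ := hf
  refine ⟨P, fun a => ?_⟩
  obtain ⟨t, k, ht, h⟩ := h a
  exact h.size_le_time.trans ht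

/-- A function with the same effect on encodings as a polynomial-time function. -/
theorem of_enc_eq {α' β' : Type} [Enc α'] [Enc β'] {f : α → β} {g : α' → β'} (φ : α' → α)
    (hg : Feasible O f) (h₁ : ∀ a, enc a = enc (φ a)) (h₂ : ∀ a, enc (g a) = enc (f (φ a))) :
    Feasible O g := by
  obtain ⟨p, P, h⟩ := hg
  refine ⟨p, P, fun a => ?_⟩
  rw [sz, h₁, h₂]
  exact h (φ a)

@[fun_prop]
theorem id : Feasible O (fun a : α => a) :=
  ⟨.id, 1 + Polynomial.X, fun a => ⟨_, _, by simp [sz], .id _⟩⟩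

@[fun_prop]
theorem comp {g : β → γ} {f : α → β} (hg : Feasible O g) (hf : Feasible O f) :
    Feasible O (fun a => g (f a)) := by
  obtain ⟨p, P, h⟩ := hf
  obtain ⟨q, Q, h'⟩ := hg
  refine ⟨.comp q p, P + Q.comp P + 1, fun a => ?_⟩
  obtain ⟨t, k, ht, e⟩ := h a
  obtain ⟨t', k', ht', e'⟩ := h' (f a)
  refine ⟨_, _, ?_, .comp e e'⟩
  have h₁ : sz (f a) ≤ P.eval (sz a) := e.size_le_time.trans ht
  have := Q.eval_mono_nat h₁
  simp only [Polynomial.eval_add, Polynomial.eval_comp, Polynomial.eval_one]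
  omega

@[fun_prop]
theorem prodMk {f : α → β} {g : α → γ} (hf : Feasible O f) (hg : Feasible O g) :
    Feasible O (fun a => (f a, g a)) := by
  obtain ⟨p, P, h⟩ := hf
  obtain ⟨q, Q, h'⟩ := hg
  refine ⟨.pair p q, P + Q + 1, fun a => ?_⟩
  obtain ⟨t, k, ht, e⟩ := h a
  obtain ⟨t', k', ht', e'⟩ := h' a
  refine ⟨_, _, ?_, .pair e e'⟩
  simp only [Polynomial.eval_add, Polynomial.eval_one]
  omega

theorem fst' : Feasible O (Prod.fst : α × β → α) :=
  ⟨.fst, 1 + Polynomial.X, fun a => ⟨_, _, by simp [sz], .fst _⟩⟩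

theorem snd' : Feasible O (Prod.snd : α × β → β) :=
  ⟨.snd, 1 + Polynomial.X, fun a => ⟨_, _, by simp [sz], .snd _⟩⟩

@[fun_prop]
theorem fst {f : α → β × γ} (hf : Feasible O f) : Feasible O (fun a => (f a).1) := fst'.comp hf

@[fun_prop]
theorem snd {f : α → β × γ} (hf : Feasible O f) : Feasible O (fun a => (f a).2) := snd'.comp hf

theorem constVal (v : Val) : Feasible O (fun _ : α => v) := by
  induction v with
  | nil => exact ⟨.nil, 1 + Polynomial.X, fun a => ⟨_, _, by simp [sz], .nil _⟩⟩
  | pair v w hv hw =>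
    obtain ⟨p, P, h⟩ := hv
    obtain ⟨q, Q, h'⟩ := hw
    refine ⟨.pair p q, P + Q + 1, fun a => ?_⟩
    obtain ⟨t, k, ht, e⟩ := h a
    obtain ⟨t', k', ht', e'⟩ := h' a
    refine ⟨_, _, ?_, .pair e e'⟩
    simp only [Polynomial.eval_add, Polynomial.eval_one]
    omega

@[fun_prop]
theorem const (b : β) : Feasible O (fun _ : α => b) :=
  of_enc_eq (f := fun _ : α => enc b) _root_.id (constVal _) (fun _ => rfl) (fun _ => rfl)

/-- Branching on a test whose outcome is read off from a value: `nil` counts as false. -/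
theorem ite_val {c : α → Val} {f g : α → β} (hc : Feasible O c) (hf : Feasible O f)
    (hg : Feasible O g) :
    Feasible O (fun a => open Classical in if c a ≠ .nil then f a else g a) := by
  obtain ⟨p, P, h⟩ := hc
  obtain ⟨q, Q, h'⟩ := hf
  obtain ⟨r, R, h''⟩ := hg
  refine ⟨.ite p q r, P + Q + R + 1, fun a => ?_⟩
  obtain ⟨t, k, ht, e⟩ := h a
  obtain ⟨t', k', ht', e'⟩ := h' a
  obtain ⟨t'', k'', ht'', e''⟩ := h'' a
  simp only [Polynomial.eval_add, Polynomial.eval_one]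
  by_cases hn : c a = .nil
  · rw [if_neg (by simpa using hn)]
    rw [show (enc (c a) : Val) = .nil from hn] at e
    exact ⟨_, _, by omega, .ite_false e e''⟩
  · rw [if_pos hn]
    exact ⟨_, _, by omega, .ite_true e hn e'⟩

@[fun_prop]
theorem cond {c : α → Bool} {f g : α → β} (hc : Feasible O c) (hf : Feasible O f)
    (hg : Feasible O g) : Feasible O (fun a => bif c a then f a else g a) := by
  have h := ite_val (c := fun a => enc (c a))
    (of_enc_eq (f := c) _root_.id hc (fun _ => rfl) (fun _ => rfl)) hf hg
  refine of_enc_eq _root_.id h (fun _ => rfl) fun a => ?_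
  cases hca : c a <;> simp [hca, enc, Val.ofBool]

end Feasible

end Basic

/-! ### Iteration over lists -/

section Lists

variable {O : Oracles} {α β γ σ : Type} [Enc α] [Enc β] [Enc γ] [Enc σ]

namespace Feasible

/-- A fold over a list is feasible if its intermediate results have polynomial size. The program is
a loop whose state consists of the parameter, the intermediate result and the rest of the list. -/
theorem foldl {l : α → List β} {s : α → σ} {step : α → σ → β → σ} (hl : Feasible O l)
    (hs : Feasible O s) (hstep : Feasible O fun x : α × σ × β => step x.1 x.2.1 x.2.2)
    (Q : Polynomial ℕ) (hQ : ∀ a k, sz (((l a).take k).foldl (step a) (s a)) ≤ Q.eval (sz a)) :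
    Feasible O fun a => (l a).foldl (step a) (s a) := by
  obtain ⟨Pl, hPl⟩ := hl.size_bound
  have hinit : Feasible O fun a => (a, s a, l a) := by fun_prop
  have hcond : Feasible O fun x : α × σ × List β => x.2.2 := by fun_prop
  have hbody : Feasible O fun x : α × σ × (β × List β) =>
      (x.1, step x.1 x.2.1 x.2.2.1, x.2.2.2) :=
    prodMk (by fun_prop) (prodMk (hstep.comp (f := fun x : α × σ × (β × List β) =>
      (x.1, x.2.1, x.2.2.1)) (by fun_prop)) (by fun_prop))
  suffices h : ∃ (p : Prog) (P : Polynomial ℕ), ∀ a, ∃ t k, t ≤ P.eval (sz a) ∧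
      Eval O p (enc (a, s a, l a)) (enc (a, (l a).foldl (step a) (s a), ([] : List β))) t k by
    obtain ⟨p, P, h⟩ := h
    obtain ⟨pi, Pi, hi⟩ := hinit
    have : Feasible O fun a => (a, (l a).foldl (step a) (s a), ([] : List β)) := by
      refine ⟨.comp p pi, P + Pi + 1, fun a => ?_⟩
      obtain ⟨t, k, ht, e⟩ := hi a
      obtain ⟨t', k', ht', e'⟩ := h a
      refine ⟨_, _, ?_, .comp e e'⟩
      simp only [Polynomial.eval_add, Polynomial.eval_one]
      omega
    exact fst' |>.comp (snd'.comp this)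
  obtain ⟨pc, Pc, hc⟩ := hcond
  obtain ⟨pb, Pb, hb⟩ := hbody
  -- A bound for the size of the loop state.
  let B : Polynomial ℕ := 2 + Polynomial.X + Q + Pl
  refine ⟨.loop pc pb, (Pl + 1) * (2 * (Pc.comp B + Pb.comp B) + 1), fun a => ?_⟩
  set S : ℕ → α × σ × List β :=
    fun j => (a, ((l a).take j).foldl (step a) (s a), (l a).drop j) with hS
  have hB : ∀ j, sz (S j) ≤ B.eval (sz a) := by
    intro j
    have h₁ := hQ a j
    have h₂ := hPl a
    have h₃ := sz_le_of_sublist (List.drop_sublist j (l a))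
    simp only [hS, sz_pair, B, Polynomial.eval_add, Polynomial.eval_X, Polynomial.eval_ofNat]
    omega
  have key := Eval.loop_of_states (O := O) (c := pc) (f := pb)
    (τ := Pc.eval (B.eval (sz a)) + Pb.eval (B.eval (sz a))) (l a).length (fun j => enc (S j))
    (fun j hj => ?_) ?_ (fun j hj => ?_)
  · obtain ⟨t, k, ht, e⟩ := key
    refine ⟨t, k, ht.trans ?_, ?_⟩
    · simp only [Polynomial.eval_mul, Polynomial.eval_add, Polynomial.eval_one,
        Polynomial.eval_comp, Polynomial.eval_ofNat]
      have h₁ := length_lt_sz (l a)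
      have h₂ := hPl a
      exact Nat.mul_le_mul_right _ (by omega)
    · simpa [hS] using e
  · obtain ⟨t, k, ht, e⟩ := hc (S j)
    refine ⟨_, t, k, ?_, (ht.trans (Pc.eval_mono_nat (hB j))).trans (by omega), e⟩
    simp only [hS]
    rw [List.drop_eq_getElem_cons hj]
    exact fun h => nomatch h
  · obtain ⟨t, k, ht, e⟩ := hc (S (l a).length)
    refine ⟨t, k, (ht.trans (Pc.eval_mono_nat (hB _))).trans (by omega), ?_⟩
    simpa [hS, enc, Val.ofList] using e
  · have hd : (l a).drop j = (l a)[j] :: (l a).drop (j + 1) := List.drop_eq_getElem_cons hj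
    obtain ⟨t, k, ht, e⟩ := hb
      (a, ((l a).take j).foldl (step a) (s a), (l a)[j], (l a).drop (j + 1))
    refine ⟨t, k, (ht.trans (Pb.eval_mono_nat (b := B.eval (sz a)) ?_)).trans (by omega), ?_⟩
    · refine le_trans (le_of_eq ?_) (hB j)
      simp only [hS, hd]
      rfl
    · have h₁ : enc (S j) = enc (a, ((l a).take j).foldl (step a) (s a),
          ((l a)[j], (l a).drop (j + 1))) := by
        simp only [hS, hd]
        rfl
      have h₂ : S (j + 1) = (a, step a (((l a).take j).foldl (step a) (s a)) (l a)[j],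
          (l a).drop (j + 1)) := by
        simp only [hS, List.take_succ_eq_append_getElem hj, List.foldl_append, List.foldl_cons,
          List.foldl_nil]
      simp only [h₁, h₂]
      exact e

/-- A fold is feasible if the size of its state is controlled by a potential that grows, in each
step, by an amount polynomial in the sizes of the parameter and of the list element. -/
theorem foldl_of_potential {l : α → List β} {s : α → σ} {step : α → σ → β → σ}
    (hl : Feasible O l) (hs : Feasible O s)
    (hstep : Feasible O fun x : α × σ × β => step x.1 x.2.1 x.2.2) (μ : σ → ℕ)
    (R S Q : Polynomial ℕ) (hR : ∀ s, sz s ≤ R.eval (μ s)) (hS : ∀ a, μ (s a) ≤ S.eval (sz (s a)))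
    (hQ : ∀ a s b, μ (step a s b) ≤ μ s + Q.eval (sz a + sz b)) :
    Feasible O fun a => (l a).foldl (step a) (s a) := by
  obtain ⟨Pl, hPl⟩ := hl.size_bound
  obtain ⟨Ps, hPs⟩ := hs.size_bound
  refine foldl hl hs hstep
    (R.comp (S.comp Ps + Pl * Q.comp (Polynomial.X + Pl))) fun a k => ?_
  have h₁ : ∀ (l : List β) (s : σ) (B : ℕ), (∀ b ∈ l, sz b ≤ B) →
      μ (l.foldl (step a) s) ≤ μ s + l.length * Q.eval (sz a + B) := by
    intro l
    induction l with
    | nil => simp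
    | cons b l ih =>
      intro s B hB
      have h₂ := ih (step a s b) B fun b hb => hB b (List.mem_cons_of_mem _ hb)
      have h₃ := hQ a s b
      have h₄ := Q.eval_mono_nat (Nat.add_le_add_left (hB b List.mem_cons_self) (sz a))
      rw [List.foldl_cons, List.length_cons, Nat.succ_mul]
      omega
  refine (hR _).trans ?_
  simp only [Polynomial.eval_comp, Polynomial.eval_add, Polynomial.eval_mul, Polynomial.eval_X]
  refine R.eval_mono_nat ((h₁ _ _ (Pl.eval (sz a)) fun b hb => ?_).trans (Nat.add_le_add ?_ ?_))
  · exact ((sz_le_of_mem (List.mem_of_mem_take hb)).le).trans (hPl a)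
  · exact (hS a).trans (S.eval_mono_nat (hPs a))
  · have h₂ := length_lt_sz (l a)
    have h₃ := hPl a
    have h₄ := List.length_take_le' k (l a)
    exact Nat.mul_le_mul_right _ (by omega)

/-- The case in which the potential is the size itself. -/
theorem foldl_of_growth {l : α → List β} {s : α → σ} {step : α → σ → β → σ}
    (hl : Feasible O l) (hs : Feasible O s)
    (hstep : Feasible O fun x : α × σ × β => step x.1 x.2.1 x.2.2) (Q : Polynomial ℕ)
    (hQ : ∀ a s b, sz (step a s b) ≤ sz s + Q.eval (sz a + sz b)) :
    Feasible O fun a => (l a).foldl (step a) (s a) :=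
  foldl_of_potential hl hs hstep sz .X .X Q (by simp) (by simp) hQ

@[fun_prop]
theorem cons {f : α → β} {l : α → List β} (hf : Feasible O f) (hl : Feasible O l) :
    Feasible O fun a => f a :: l a :=
  of_enc_eq (f := fun a => (f a, l a)) _root_.id (by fun_prop) (fun _ => rfl) (fun _ => rfl)

@[fun_prop]
theorem tail {l : α → List β} (hl : Feasible O l) : Feasible O fun a => (l a).tail := by
  have : Feasible O (List.tail : List β → List β) := by
    obtain ⟨p, P, h⟩ : Feasible O (fun v : Val => v.snd) :=
      ⟨.snd, 1 + Polynomial.X, fun a => ⟨_, _, by simp [sz], .snd _⟩⟩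
    refine ⟨p, P, fun l => ?_⟩
    have := h (enc l)
    cases l <;> exact this
  exact this.comp hl

@[fun_prop]
theorem reverse {l : α → List β} (hl : Feasible O l) : Feasible O fun a => (l a).reverse := by
  have := foldl_of_growth (step := fun (_ : α) (s : List β) b => b :: s) hl (const [])
    (by fun_prop) (1 + .X) fun a s b => by
      simp only [sz_cons, Polynomial.eval_add, Polynomial.eval_one, Polynomial.eval_X]; omega
  simpa using this

@[fun_prop]
theorem append {l l' : α → List β} (hl : Feasible O l) (hl' : Feasible O l') :
    Feasible O fun a => l a ++ l' a := by
  have := foldl_of_growth (step := fun (_ : α) (s : List β) b => b :: s) (reverse hl) hl'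
    (by fun_prop) (1 + .X) fun a s b => by
      simp only [sz_cons, Polynomial.eval_add, Polynomial.eval_one, Polynomial.eval_X]; omega
  simpa using this

theorem map {l : α → List β} {f : α → β → γ} (hl : Feasible O l)
    (hf : Feasible O fun x : α × β => f x.1 x.2) : Feasible O fun a => (l a).map (f a) := by
  obtain ⟨P, hP⟩ := hf.size_bound
  have := foldl_of_growth (step := fun (a : α) (s : List γ) b => f a b :: s) hl (const [])
    (cons (hf.comp (f := fun x : α × List γ × β => (x.1, x.2.2)) (by fun_prop)) (by fun_prop))
    (1 + P.comp (1 + .X)) fun a s b => by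
      have : sz (f a b) ≤ P.eval (1 + (sz a + sz b)) := add_assoc 1 (sz a) (sz b) ▸ hP (a, b)
      simp only [sz_cons, Polynomial.eval_add, Polynomial.eval_one, Polynomial.eval_X,
        Polynomial.eval_comp]
      omega
  simpa using this.reverse

theorem flatMap {l : α → List β} {f : α → β → List γ} (hl : Feasible O l)
    (hf : Feasible O fun x : α × β => f x.1 x.2) : Feasible O fun a => (l a).flatMap (f a) := by
  obtain ⟨P, hP⟩ := hf.size_bound
  have := foldl_of_growth (step := fun (a : α) (s : List γ) b => f a b ++ s) (hl.reverse)
    (const []) (append (hf.comp (f := fun x : α × List γ × β => (x.1, x.2.2)) (by fun_prop))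
      (by fun_prop)) (P.comp (1 + .X)) fun a s b => by
      have h₁ : sz (f a b) ≤ P.eval (1 + (sz a + sz b)) := add_assoc 1 (sz a) (sz b) ▸ hP (a, b)
      have h₂ := sz_append (f a b) s
      simp only [Polynomial.eval_add, Polynomial.eval_one, Polynomial.eval_X, Polynomial.eval_comp]
      omega
  refine (congrArg (Feasible O) (funext fun a => ?_)).mp this
  rw [List.foldl_reverse]
  induction l a with
  | nil => rfl
  | cons b l ih => rw [List.foldr_cons, ih, List.flatMap_cons]

@[fun_prop]
theorem flatten {l : α → List (List β)} (hl : Feasible O l) :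
    Feasible O fun a => (l a).flatten := by
  have := flatMap (f := fun (_ : α) (x : List β) => x) hl (by fun_prop)
  simpa [List.flatMap_id'] using this

theorem filter {l : α → List β} {f : α → β → Bool} (hl : Feasible O l)
    (hf : Feasible O fun x : α × β => f x.1 x.2) : Feasible O fun a => (l a).filter (f a) := by
  have := flatMap (f := fun a b => bif f a b then [b] else []) hl (by fun_prop)
  refine (congrArg (Feasible O) (funext fun a => ?_)).mp this
  induction l a with
  | nil => rfl
  | cons b l ih => cases h : f a b <;> simp [h, ih]

theorem foldl_bool {l : α → List β} {s : α → Bool} {step : α → Bool → β → Bool}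
    (hl : Feasible O l) (hs : Feasible O s)
    (hstep : Feasible O fun x : α × Bool × β => step x.1 x.2.1 x.2.2) :
    Feasible O fun a => (l a).foldl (step a) (s a) :=
  foldl_of_growth hl hs hstep 3 fun a s b => by
    have : sz (step a s b) ≤ 3 := by
      cases step a s b <;> simp [sz, enc, Val.ofBool, Val.size]
    simp only [Polynomial.eval_ofNat]
    omega

@[fun_prop]
theorem not {f : α → Bool} (hf : Feasible O f) : Feasible O fun a => !f a := by
  have : Feasible O fun a => bif f a then false else true := by fun_prop
  simpa using this

@[fun_prop]
theorem and {f g : α → Bool} (hf : Feasible O f) (hg : Feasible O g) :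
    Feasible O fun a => f a && g a := by
  have : Feasible O fun a => bif f a then g a else false := by fun_prop
  simpa using this

@[fun_prop]
theorem or {f g : α → Bool} (hf : Feasible O f) (hg : Feasible O g) :
    Feasible O fun a => f a || g a := by
  have : Feasible O fun a => bif f a then true else g a := by fun_prop
  simpa using this

theorem all {l : α → List β} {f : α → β → Bool} (hl : Feasible O l)
    (hf : Feasible O fun x : α × β => f x.1 x.2) : Feasible O fun a => (l a).all (f a) := by
  have := foldl_bool (step := fun a s b => s && f a b) hl (const true)
    (and (by fun_prop) (hf.comp (f := fun x : α × Bool × β => (x.1, x.2.2)) (by fun_prop)))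
  refine (congrArg (Feasible O) (funext fun a => ?_)).mp this
  have h : ∀ (l : List β) (s : Bool), l.foldl (fun s b => s && f a b) s = (s && l.all (f a)) := by
    intro l
    induction l with
    | nil => simp
    | cons b l ih => intro s; rw [List.foldl_cons, ih, List.all_cons, Bool.and_assoc]
  rw [h, Bool.true_and]

theorem any {l : α → List β} {f : α → β → Bool} (hl : Feasible O l)
    (hf : Feasible O fun x : α × β => f x.1 x.2) : Feasible O fun a => (l a).any (f a) := by
  have := (all (f := fun a b => !f a b) hl (by fun_prop)).not
  refine (congrArg (Feasible O) (funext fun a => ?_)).mp this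
  rw [List.not_all_eq_any_not]
  simp

/-- The list of the values of finitely many feasible functions. The list `L` of indices does not
depend on the argument, so the program has one part for each of them. -/
theorem listMap {ι : Type} (L : List ι) {f : ι → α → β} (hf : ∀ i ∈ L, Feasible O (f i)) :
    Feasible O fun a => L.map fun i => f i a := by
  induction L with
  | nil => exact const []
  | cons i L ih =>
    exact cons (hf i List.mem_cons_self) (ih fun j hj => hf j (List.mem_cons_of_mem _ hj))

theorem pi {k : ℕ} {f : α → Fin k → β} (hf : ∀ i, Feasible O fun a => f a i) : Feasible O f :=
  of_enc_eq (f := fun a => List.ofFn (f a)) _root_.id (by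
    simp only [List.ofFn_eq_map]
    exact listMap (f := fun i a => f a i) _ fun i _ => hf i) (fun _ => rfl) (fun _ => rfl)

end Feasible

end Lists

/-! ### Deciding equality -/

section Equality

variable {O : Oracles} {α β γ : Type} [Enc α] [Enc β] [Enc γ]

namespace Val

/-- Whether a value counts as true. -/
def nonNil : Val → Bool
  | nil => false
  | pair _ _ => true

theorem nonNil_iff {v : Val} : v.nonNil = true ↔ v ≠ nil := by cases v <;> simp [nonNil]

/-- The elements of a value read as a list; every value is the encoding of a list. -/
def toList : Val → List Val
  | nil => []
  | pair a b => a :: toList b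

theorem enc_toList (v : Val) : enc (toList v) = v := by
  induction v with
  | nil => rfl
  | pair a b _ ih => exact congrArg (pair a) ih

theorem toList_ofList (l : List Val) : toList (ofList l) = l := by
  induction l with
  | nil => rfl
  | cons a l ih => exact congrArg (a :: ·) ih

/-- The test for continuing the comparison of the pairs of values on a stack: the two values on
top are both leaves or both nodes. -/
def compareTest (v : Val) : Bool :=
  bif v.nonNil then (bif v.fst.fst.nonNil then v.fst.snd.nonNil else !v.fst.snd.nonNil) else false

/-- One step in the comparison of the pairs of values on a stack: two leaves are dropped, two nodes
are replaced by their children. -/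
def compareStep (v : Val) : Val :=
  bif v.fst.fst.nonNil then
    pair (pair v.fst.fst.fst v.fst.snd.fst) (pair (pair v.fst.fst.snd v.fst.snd.snd) v.snd)
  else v.snd

/-- The comparison of the pairs on a stack ends after at most as many steps as there are nodes and
leaves on the left-hand sides. The stack never grows, and it gets empty if and only if the two
components of every pair are equal. -/
theorem exists_compare (m : ℕ) (l : List (Val × Val)) (hm : (l.map fun p => p.1.size).sum ≤ m) :
    ∃ N, N ≤ m ∧ (∀ j < N, compareTest (compareStep^[j] (enc l)) = true) ∧
      compareTest (compareStep^[N] (enc l)) = false ∧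
      (∀ j ≤ N, (compareStep^[j] (enc l)).size ≤ (enc l).size) ∧
      ((compareStep^[N] (enc l)).nonNil = false ↔ ∀ p ∈ l, p.1 = p.2) := by
  -- It suffices to make one step.
  have step : ∀ (m : ℕ) (v w : Val) (Q Q' : Prop), compareTest v = true → compareStep v = w →
      w.size ≤ v.size → (Q ↔ Q') →
      (∃ N, N ≤ m ∧ (∀ j < N, compareTest (compareStep^[j] w) = true) ∧
        compareTest (compareStep^[N] w) = false ∧
        (∀ j ≤ N, (compareStep^[j] w).size ≤ w.size) ∧
        ((compareStep^[N] w).nonNil = false ↔ Q)) →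
      ∃ N, N ≤ m + 1 ∧ (∀ j < N, compareTest (compareStep^[j] v) = true) ∧
        compareTest (compareStep^[N] v) = false ∧
        (∀ j ≤ N, (compareStep^[j] v).size ≤ v.size) ∧
        ((compareStep^[N] v).nonNil = false ↔ Q') := by
    rintro m v _ Q Q' hv rfl hle hQ ⟨N, hN, h₁, h₂, h₃, h₄⟩
    refine ⟨N + 1, by omega, fun j hj => ?_, h₂, fun j hj => ?_, h₄.trans hQ⟩
    · cases j with
      | zero => exact hv
      | succ j => exact h₁ j (by omega)
    · cases j with
      | zero => exact le_rfl
      | succ j => exact (h₃ j (by omega)).trans hle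
  induction m generalizing l with
  | zero =>
    cases l with
    | nil => exact ⟨0, by simp [enc, ofList, compareTest, nonNil]⟩
    | cons p l =>
      have := p.1.one_le_size
      simp at hm
      omega
  | succ m ih =>
    rcases l with _ | ⟨⟨_ | ⟨a, b⟩, _ | ⟨c, d⟩⟩, l⟩
    · exact ⟨0, by simp [enc, ofList, compareTest, nonNil]⟩
    · refine step m _ (enc l) _ _ rfl rfl ?_ ?_ (ih l ?_)
      · simp only [enc, List.map_cons, ofList, size]; omega
      · simp
      · simp [size] at hm; omega
    · exact ⟨0, by simp [enc, ofList, compareTest, nonNil, fst, snd]⟩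
    · exact ⟨0, by simp [enc, ofList, compareTest, nonNil, fst, snd]⟩
    · refine step m _ (enc ((a, c) :: (b, d) :: l)) _ _ rfl rfl ?_ ?_ (ih _ ?_)
      · simp only [enc, List.map_cons, ofList, size, _root_.id]; omega
      · simp [and_assoc]
      · simp [size] at hm ⊢; omega

end Val

namespace Feasible

@[fun_prop]
theorem valFst {f : α → Val} (hf : Feasible O f) : Feasible O fun a => (f a).fst :=
  comp (g := Val.fst) ⟨.fst, 1 + .X, fun a => ⟨_, _, by simp [sz], .fst _⟩⟩ hf

@[fun_prop]
theorem valSnd {f : α → Val} (hf : Feasible O f) : Feasible O fun a => (f a).snd :=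
  comp (g := Val.snd) ⟨.snd, 1 + .X, fun a => ⟨_, _, by simp [sz], .snd _⟩⟩ hf

@[fun_prop]
theorem valPair {f g : α → Val} (hf : Feasible O f) (hg : Feasible O g) :
    Feasible O fun a => (f a).pair (g a) :=
  of_enc_eq (f := fun a => (f a, g a)) _root_.id (by fun_prop) (fun _ => rfl) (fun _ => rfl)

@[fun_prop]
theorem toList {f : α → Val} (hf : Feasible O f) : Feasible O fun a => (f a).toList :=
  of_enc_eq (f := f) _root_.id hf (fun _ => rfl) (fun a => Val.enc_toList (f a))

@[fun_prop]
theorem encode {f : α → β} (hf : Feasible O f) : Feasible O fun a => enc (f a) :=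
  of_enc_eq (f := f) _root_.id hf (fun _ => rfl) (fun _ => rfl)

@[fun_prop]
theorem nonNil {f : α → Val} (hf : Feasible O f) : Feasible O fun a => (f a).nonNil := by
  have h := ite_val hf (const (O := O) true) (const false)
  refine (congrArg (Feasible O) (funext fun a => ?_)).mp h
  cases f a <;> simp [Val.nonNil]

/-- Equality of values. Programs have no recursion, so the two trees are traversed in a loop with an
explicit stack. -/
theorem eq_val : Feasible O fun p : Val × Val => open Classical in decide (p.1 = p.2) := by
  obtain ⟨pc, Pc, hc⟩ : Feasible O Val.compareTest := by unfold Val.compareTest; fun_prop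
  obtain ⟨ps, Ps, hs⟩ : Feasible O Val.compareStep := by unfold Val.compareStep; fun_prop
  choose N hN h₁ h₂ h₃ h₄ using fun p : Val × Val => Val.exists_compare p.1.size [p] (by simp)
  have hloop : Feasible O fun p : Val × Val => Val.compareStep^[N p] (enc [p]) := by
    have h : ∃ (p : Prog) (P : Polynomial ℕ), ∀ x : Val × Val, ∃ t k, t ≤ P.eval (sz [x]) ∧
        Eval O p (enc [x]) (Val.compareStep^[N x] (enc [x])) t k := by
      refine ⟨.loop pc ps, (.X + 1) * (2 * (Pc + Ps) + 1), fun x => ?_⟩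
      have key := Eval.loop_of_states (O := O) (c := pc) (f := ps)
        (τ := Pc.eval (sz [x]) + Ps.eval (sz [x])) (N x)
        (fun j => Val.compareStep^[j] (enc [x])) (fun j hj => ?_) ?_ (fun j hj => ?_)
      · obtain ⟨t, k, ht, e⟩ := key
        refine ⟨t, k, ht.trans ?_, e⟩
        simp only [Polynomial.eval_mul, Polynomial.eval_add, Polynomial.eval_one,
          Polynomial.eval_X, Polynomial.eval_ofNat]
        refine Nat.mul_le_mul_right _ (Nat.succ_le_succ ((hN x).trans ?_))
        simp only [sz, enc, List.map_cons, Val.ofList, Val.size, _root_.id]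
        omega
      · obtain ⟨t, k, ht, e⟩ := hc (Val.compareStep^[j] (enc [x]))
        rw [h₁ x j hj] at e
        exact ⟨enc true, t, k, Val.nonNil_iff.1 rfl,
          (ht.trans (Pc.eval_mono_nat (h₃ x j hj.le))).trans (Nat.le_add_right _ _), e⟩
      · obtain ⟨t, k, ht, e⟩ := hc (Val.compareStep^[N x] (enc [x]))
        rw [h₂ x] at e
        exact ⟨t, k, (ht.trans (Pc.eval_mono_nat (h₃ x _ le_rfl))).trans (Nat.le_add_right _ _), e⟩
      · obtain ⟨t, k, ht, e⟩ := hs (Val.compareStep^[j] (enc [x]))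
        rw [← Function.iterate_succ_apply' Val.compareStep] at e
        exact ⟨t, k, (ht.trans (Ps.eval_mono_nat (h₃ x j hj.le))).trans (Nat.le_add_left _ _), e⟩
    obtain ⟨p, P, h⟩ := h
    obtain ⟨q, Q, hq⟩ : Feasible O fun x : Val × Val => [x] := by fun_prop
    refine ⟨.comp p q, P.comp Q + Q + 1, fun x => ?_⟩
    obtain ⟨t, k, ht, e⟩ := hq x
    obtain ⟨t', k', ht', e'⟩ := h x
    refine ⟨_, _, ?_, .comp e e'⟩
    have h₁ : P.eval (sz [x]) ≤ _ := P.eval_mono_nat (e.size_le_time.trans ht)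
    simp only [Polynomial.eval_add, Polynomial.eval_one, Polynomial.eval_comp]
    omega
  classical
  refine (congrArg (Feasible O) (funext fun x => ?_)).mp hloop.nonNil.not
  have := h₄ x
  simp only [List.mem_singleton, forall_eq] at this
  rw [Bool.eq_iff_iff, Bool.not_eq_true', this]
  exact (decide_eq_true_iff (p := x.1 = x.2)).symm

@[fun_prop]
theorem eq [EncInj β] [DecidableEq β] {f g : α → β} (hf : Feasible O f) (hg : Feasible O g) :
    Feasible O fun a => decide (f a = g a) := by
  refine (congrArg (Feasible O) (funext fun a => ?_)).mp
    (eq_val.comp (f := fun a => (enc (f a), enc (g a))) (by fun_prop))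
  exact decide_eq_decide.2 (EncInj.inj (α := β)).eq_iff

/-- Every function on a finite type is feasible, by table look-up. -/
theorem of_finite [Finite β] [EncInj β] (F : β → γ) : Feasible O F := by
  classical
  cases nonempty_fintype β
  rcases isEmpty_or_nonempty β with h | ⟨⟨b₀⟩⟩
  · exact ⟨.id, 0, fun a => (h.false a).elim⟩
  · have key : ∀ L : List β, Feasible O fun b => if b ∈ L then F b else F b₀ := by
      intro L
      induction L with
      | nil => simpa using const (O := O) (α := β) (F b₀)
      | cons c L ih =>
        have := cond (eq (O := O) id (const c)) (const (F c)) ih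
        refine (congrArg (Feasible O) (funext fun b => ?_)).mp this
        by_cases h : b = c <;> simp [h]
    simpa using key Finset.univ.toList

end Feasible

/-! ### Injectivity of the encodings -/

theorem Val.ofList_injective : Function.Injective Val.ofList :=
  Function.LeftInverse.injective Val.toList_ofList

theorem Val.ofBool_injective : Function.Injective Val.ofBool := by
  intro a b; cases a <;> cases b <;> simp [Val.ofBool]

theorem Val.ofNat_injective : Function.Injective Val.ofNat := fun a b h => by
  have h := List.map_injective_iff.2 Val.ofBool_injective (Val.ofList_injective h)
  exact Nat.eq_of_testBit_eq fun i => by rw [Nat.testBit_eq_inth, h, Nat.testBit_eq_inth]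

instance : EncInj Val := ⟨fun _ _ h => h⟩
instance : EncInj Bool := ⟨Val.ofBool_injective⟩
instance : EncInj ℕ := ⟨Val.ofNat_injective⟩
instance : EncInj ℤ := ⟨fun a b h => by
  obtain ⟨h₁, h₂⟩ := Val.pair.inj h
  have h₁ := Val.ofBool_injective h₁
  have h₂ := Val.ofNat_injective h₂
  simp only [decide_eq_decide] at h₁
  omega⟩
instance {k : ℕ} : EncInj (Fin k) := ⟨fun _ _ h => Fin.ext (Val.ofNat_injective h)⟩
instance [EncInj α] : EncInj (List α) :=
  ⟨fun _ _ h => List.map_injective_iff.2 EncInj.inj (Val.ofList_injective h)⟩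
instance [EncInj α] [EncInj β] : EncInj (α × β) := ⟨fun _ _ h => by
  obtain ⟨h₁, h₂⟩ := Val.pair.inj h
  exact Prod.ext (EncInj.inj h₁) (EncInj.inj h₂)⟩
instance [EncInj α] {k : ℕ} : EncInj (Fin k → α) :=
  ⟨fun _ _ h => List.ofFn_injective (EncInj.inj (α := List α) h)⟩

end Equality

/-! ### Binary arithmetic -/

section Arithmetic

theorem Nat.size_le_sz (n : ℕ) : n.size ≤ sz n := by
  rw [← Nat.size_eq_bits_len, ← List.length_map (f := Val.ofBool)]
  exact (length_lt_sz (n.bits.map Val.ofBool)).le.trans (by simp [sz, enc, Val.ofNat, Val.ofBits])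

theorem sz_bool_le (b : Bool) : sz b ≤ 3 := by
  cases b <;> simp [sz, enc, Val.ofBool, Val.size]

theorem sz_bits (n : ℕ) : sz n.bits = sz n := rfl

theorem Nat.sz_le (n : ℕ) : sz n ≤ 1 + n.size * 4 := by
  rw [← sz_bits, ← Nat.size_eq_bits_len]
  exact sz_list_le le_rfl fun b _ => sz_bool_le b

theorem Nat.sz_le_of_lt_two_pow {n k : ℕ} (h : n < 2 ^ k) : sz n ≤ 1 + k * 4 :=
  n.sz_le.trans (Nat.add_le_add_left (Nat.mul_le_mul_right _ (Nat.size_le.2 h)) 1)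

theorem Nat.sz_le_linear (n : ℕ) : sz n ≤ 1 + n * 4 := Nat.sz_le_of_lt_two_pow Nat.lt_two_pow_self

theorem Int.sz_le_of_lt_two_pow {z : ℤ} {k : ℕ} (h : z.natAbs < 2 ^ k) : sz z ≤ 5 + k * 4 := by
  have h₁ := Nat.sz_le_of_lt_two_pow h
  have h₂ := sz_bool_le (decide (z < 0))
  have h₃ : sz z = 1 + sz (decide (z < 0)) + sz z.natAbs := rfl
  omega

theorem Nat.bits_bit (b : Bool) (n : ℕ) :
    (Nat.bit b n).bits = bif b || !decide (n = 0) then b :: n.bits else [] := by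
  by_cases h : n = 0 → b = true
  · rw [Nat.bits_append_bit n b h]
    by_cases hn : n = 0 <;> simp_all
  · rw [Classical.not_imp] at h
    simp [h.1, h.2]

/-- The number with the given binary digits, most significant first. -/
def ofDigits (l : List Bool) : ℕ := l.foldl (fun r b => Nat.bit b r) 0

theorem ofDigits_foldl (l : List Bool) (r : ℕ) :
    l.foldl (fun r b => Nat.bit b r) r = r * 2 ^ l.length + ofDigits l := by
  induction l generalizing r with
  | nil => simp [ofDigits]
  | cons b l ih =>
    rw [ofDigits, List.foldl_cons, ih, List.foldl_cons, ih, List.length_cons, pow_succ,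
      Nat.bit_val, Nat.bit_val]
    ring

theorem ofDigits_cons (b : Bool) (l : List Bool) :
    ofDigits (b :: l) = b.toNat * 2 ^ l.length + ofDigits l := by
  rw [ofDigits, List.foldl_cons, ofDigits_foldl, Nat.bit_val]
  simp

theorem ofDigits_lt (l : List Bool) : ofDigits l < 2 ^ l.length := by
  induction l with
  | nil => simp [ofDigits]
  | cons b l ih =>
    rw [ofDigits_cons, List.length_cons, pow_succ]
    cases b <;> simp <;> omega

/-- One step of a digit-serial computation on two numbers, from the least significant digit
upwards: the state consists of the remaining parts of the numbers, the carry, and the digits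
computed so far, most significant first. -/
def serialStep (digit carry : Bool × Bool × Bool → Bool) (s : ℕ × ℕ × Bool × List Bool) :
    ℕ × ℕ × Bool × List Bool :=
  (s.1.div2, s.2.1.div2, carry (s.1.bodd, s.2.1.bodd, s.2.2.1),
    digit (s.1.bodd, s.2.1.bodd, s.2.2.1) :: s.2.2.2)

/-- As many steps as there are digits in the two numbers, so that both are exhausted at the end. -/
def serial (digit carry : Bool × Bool × Bool → Bool) (x y : ℕ) : ℕ × ℕ × Bool × List Bool :=
  (x.bits ++ y.bits).foldl (fun s _ => serialStep digit carry s) (x, y, false, [])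

theorem serial_exhausts (digit carry : Bool × Bool × Bool → Bool) (x y : ℕ) :
    (serial digit carry x y).1 = 0 ∧ (serial digit carry x y).2.1 = 0 := by
  have key : ∀ (l : List Bool) (s : ℕ × ℕ × Bool × List Bool),
      (l.foldl (fun s _ => serialStep digit carry s) s).1 = s.1 / 2 ^ l.length ∧
      (l.foldl (fun s _ => serialStep digit carry s) s).2.1 = s.2.1 / 2 ^ l.length := by
    intro l
    induction l with
    | nil => simp
    | cons b l ih =>
      intro s
      rw [List.foldl_cons, (ih _).1, (ih _).2, List.length_cons, pow_succ',
        ← Nat.div_div_eq_div_mul,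
        ← Nat.div_div_eq_div_mul, ← Nat.div2_val, ← Nat.div2_val]
      exact ⟨rfl, rfl⟩
  obtain ⟨h₁, h₂⟩ := key (x.bits ++ y.bits) (x, y, false, [])
  rw [serial, h₁, h₂, List.length_append, Nat.size_eq_bits_len, Nat.size_eq_bits_len]
  constructor
  · refine Nat.div_eq_of_lt ((Nat.lt_size_self x).trans_le ?_)
    exact Nat.pow_le_pow_right (by omega) (by omega)
  · refine Nat.div_eq_of_lt ((Nat.lt_size_self y).trans_le ?_)
    exact Nat.pow_le_pow_right (by omega) (by omega)

/-- The quantity preserved by the digit-serial computation, for addition (`ε = 1`) and for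
subtraction (`ε = -1`). -/
theorem serial_invariant {digit carry : Bool × Bool × Bool → Bool} {ε : ℤ}
    (h : ∀ a b c : Bool, ((a.toNat : ℤ) + ε * b.toNat + ε * c.toNat) =
      (digit (a, b, c)).toNat + 2 * (ε * (carry (a, b, c)).toNat)) (x y : ℕ) :
    (x : ℤ) + ε * y = ofDigits (serial digit carry x y).2.2.2 +
      2 ^ (serial digit carry x y).2.2.2.length * (ε * (serial digit carry x y).2.2.1.toNat) := by
  have key : ∀ (l : List Bool) (s : ℕ × ℕ × Bool × List Bool),
      ((ofDigits (l.foldl (fun s _ => serialStep digit carry s) s).2.2.2 : ℤ) +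
        2 ^ (l.foldl (fun s _ => serialStep digit carry s) s).2.2.2.length *
        ((l.foldl (fun s _ => serialStep digit carry s) s).1 +
          ε * (l.foldl (fun s _ => serialStep digit carry s) s).2.1 +
          ε * (l.foldl (fun s _ => serialStep digit carry s) s).2.2.1.toNat)) =
      ofDigits s.2.2.2 + 2 ^ s.2.2.2.length * (s.1 + ε * s.2.1 + ε * s.2.2.1.toNat) := by
    intro l
    induction l with
    | nil => simp
    | cons b l ih =>
      rintro ⟨u, v, c, acc⟩
      rw [List.foldl_cons, ih]
      have h₁ := h u.bodd v.bodd c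
      have h₂ := Nat.bodd_add_div2 u
      have h₃ := Nat.bodd_add_div2 v
      simp only [serialStep, ofDigits_cons, List.length_cons, Nat.cast_add, Nat.cast_mul,
        Nat.cast_pow, Nat.cast_ofNat]
      have h₄ : (u : ℤ) = u.bodd.toNat + 2 * u.div2 := by exact_mod_cast h₂.symm
      have h₅ : (v : ℤ) = v.bodd.toNat + 2 * v.div2 := by exact_mod_cast h₃.symm
      linear_combination (-2 ^ acc.length : ℤ) * h₁ - 2 ^ acc.length * h₄ - ε * 2 ^ acc.length * h₅
  have h₁ := key (x.bits ++ y.bits) (x, y, false, [])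
  have h₂ := serial_exhausts digit carry x y
  unfold serial at h₂ ⊢
  rw [h₂.1, h₂.2] at h₁
  simp only [ofDigits, List.foldl_nil, List.length_nil, Bool.toNat_false, Nat.cast_zero] at h₁ ⊢
  linear_combination -h₁

/-- Sum and carry of a full adder. -/
def adder : (Bool × Bool × Bool → Bool) × (Bool × Bool × Bool → Bool) :=
  (fun x => xor x.1 (xor x.2.1 x.2.2),
    fun x => (x.1 && x.2.1) || (x.1 && x.2.2) || (x.2.1 && x.2.2))

/-- Difference and borrow of a full subtractor. -/
def subtractor : (Bool × Bool × Bool → Bool) × (Bool × Bool × Bool → Bool) :=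
  (fun x => xor x.1 (xor x.2.1 x.2.2),
    fun x => (!x.1 && x.2.1) || (!x.1 && x.2.2) || (x.2.1 && x.2.2))

theorem add_eq_serial (x y : ℕ) : x + y = ofDigits ((serial adder.1 adder.2 x y).2.2.1 ::
    (serial adder.1 adder.2 x y).2.2.2) := by
  have h := serial_invariant (digit := adder.1) (carry := adder.2) (ε := 1)
    (by decide) x y
  rw [ofDigits_cons]
  zify
  linear_combination h

/-- A borrow that is left at the end shows that the truncated difference is zero. -/
theorem sub_eq_serial (x y : ℕ) : x - y = bif (serial subtractor.1 subtractor.2 x y).2.2.1 then 0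
    else ofDigits (serial subtractor.1 subtractor.2 x y).2.2.2 := by
  have h := serial_invariant (digit := subtractor.1) (carry := subtractor.2) (ε := -1)
    (by decide) x y
  have h₁ := ofDigits_lt (serial subtractor.1 subtractor.2 x y).2.2.2
  zify at h₁
  cases hb : (serial subtractor.1 subtractor.2 x y).2.2.1
  · simp only [hb, cond_false, Bool.toNat_false] at h ⊢
    zify
    omega
  · simp only [hb, cond_true, Bool.toNat_true] at h ⊢
    push_cast at h
    omega

end Arithmetic

namespace Feasible

variable {O : Oracles} {α β : Type} [Enc α] [Enc β]

@[fun_prop]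
theorem bits {f : α → ℕ} (hf : Feasible O f) : Feasible O fun a => (f a).bits :=
  of_enc_eq (f := f) _root_.id hf (fun _ => rfl) (fun _ => rfl)

@[fun_prop]
theorem bodd {f : α → ℕ} (hf : Feasible O f) : Feasible O fun a => (f a).bodd := by
  have : Feasible O fun a => (enc (f a).bits).fst.nonNil := by fun_prop
  refine (congrArg (Feasible O) (funext fun a => ?_)).mp this
  rw [Nat.bodd_eq_bits_head]
  rcases (f a).bits with _ | ⟨_ | _, l⟩ <;> rfl

@[fun_prop]
theorem div2 {f : α → ℕ} (hf : Feasible O f) : Feasible O fun a => (f a).div2 :=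
  of_enc_eq (f := fun a => (f a).bits.tail) _root_.id (by fun_prop) (fun _ => rfl)
    (fun a => by rw [_root_.id, ← Nat.div2_bits_eq_tail]; rfl)

@[fun_prop]
theorem bit {b : α → Bool} {f : α → ℕ} (hb : Feasible O b) (hf : Feasible O f) :
    Feasible O fun a => Nat.bit (b a) (f a) :=
  of_enc_eq (f := fun a => bif b a || !decide (f a = 0) then b a :: (f a).bits else [])
    _root_.id (by fun_prop) (fun _ => rfl) (fun a => by rw [_root_.id, ← Nat.bits_bit]; rfl)

@[fun_prop]
theorem ofDigits {l : α → List Bool} (hl : Feasible O l) : Feasible O fun a => ofDigits (l a) :=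
  foldl_of_growth (step := fun (_ : α) r b => Nat.bit b r) hl (const 0) (by fun_prop) (1 + .X)
    fun a r b => by
      rw [← sz_bits, Nat.bits_bit, ← sz_bits r]
      have := one_le_sz r.bits
      cases b || !decide (r = 0)
      · rw [cond_false, sz_nil]; omega
      · simp only [cond_true, sz_cons, Polynomial.eval_add, Polynomial.eval_one, Polynomial.eval_X]
        omega

theorem serial (digit carry : Bool × Bool × Bool → Bool) {f g : α → ℕ} (hf : Feasible O f)
    (hg : Feasible O g) : Feasible O fun a => serial digit carry (f a) (g a) := by
  have hd := of_finite (O := O) digit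
  have hc := of_finite (O := O) carry
  refine foldl_of_growth (step := fun _ s _ => serialStep digit carry s)
    (s := fun a => (f a, g a, false, [])) (by fun_prop) (by fun_prop)
    (by unfold serialStep; fun_prop) 6 ?_
  rintro a ⟨x, y, c, acc⟩ b
  have h₁ : ∀ n : ℕ, sz n.div2 ≤ sz n := fun n => by
    rw [← sz_bits, ← sz_bits, Nat.div2_bits_eq_tail]
    exact sz_le_of_sublist (List.tail_sublist _)
  have h₂ := h₁ x
  have h₃ := h₁ y
  have h₄ := sz_bool_le (carry (x.bodd, y.bodd, c))
  have h₅ := sz_bool_le (digit (x.bodd, y.bodd, c))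
  have h₆ := one_le_sz c
  simp only [serialStep, sz_pair, sz_cons, Polynomial.eval_ofNat]
  omega

@[fun_prop]
theorem natAdd {f g : α → ℕ} (hf : Feasible O f) (hg : Feasible O g) :
    Feasible O fun a => f a + g a := by
  have := serial adder.1 adder.2 hf hg
  simp only [add_eq_serial]
  fun_prop

@[fun_prop]
theorem natSub {f g : α → ℕ} (hf : Feasible O f) (hg : Feasible O g) :
    Feasible O fun a => f a - g a := by
  have := serial subtractor.1 subtractor.2 hf hg
  simp only [sub_eq_serial]
  fun_prop

/-- An integer is encoded by its sign and its absolute value. -/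
@[fun_prop]
theorem intSubNat {f g : α → ℕ} (hf : Feasible O f) (hg : Feasible O g) :
    Feasible O fun a => (f a : ℤ) - g a :=
  of_enc_eq (f := fun a => (!decide (g a - f a = 0), (f a - g a) + (g a - f a))) _root_.id
    (by fun_prop) (fun _ => rfl) fun a => by
      have h₁ : decide ((f a : ℤ) - g a < 0) = !decide (g a - f a = 0) := by
        rw [← decide_not, decide_eq_decide]; omega
      have h₂ : ((f a : ℤ) - g a).natAbs = (f a - g a) + (g a - f a) := by omega
      rw [_root_.id, ← h₁, ← h₂]
      rfl

@[fun_prop]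
theorem intCast {f : α → ℕ} (hf : Feasible O f) : Feasible O fun a => (f a : ℤ) := by
  have := intSubNat hf (const 0)
  simpa using this

@[fun_prop]
theorem natAbs {f : α → ℤ} (hf : Feasible O f) : Feasible O fun a => (f a).natAbs := by
  have : Feasible O fun z : ℤ => z.natAbs :=
    of_enc_eq (f := fun x : Bool × ℕ => x.2) (fun z => (decide (z < 0), z.natAbs)) (by fun_prop)
      (fun _ => rfl) (fun _ => rfl)
  exact this.comp hf

@[fun_prop]
theorem isNeg {f : α → ℤ} (hf : Feasible O f) : Feasible O fun a => decide (f a < 0) := by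
  have : Feasible O fun z : ℤ => decide (z < 0) :=
    of_enc_eq (f := fun x : Bool × ℕ => x.1) (fun z => (decide (z < 0), z.natAbs)) (by fun_prop)
      (fun _ => rfl) (fun _ => rfl)
  exact this.comp hf

@[fun_prop]
theorem intSub {f g : α → ℤ} (hf : Feasible O f) (hg : Feasible O g) :
    Feasible O fun a => f a - g a := by
  -- Collect the two parts of positive sign and the two parts of negative sign.
  have : Feasible O fun a =>
      (((bif decide (f a < 0) then 0 else (f a).natAbs) +
          (bif decide (g a < 0) then (g a).natAbs else 0) : ℕ) : ℤ) -
        ((bif decide (f a < 0) then (f a).natAbs else 0) +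
          (bif decide (g a < 0) then 0 else (g a).natAbs) : ℕ) := by fun_prop
  refine (congrArg (Feasible O) (funext fun a => ?_)).mp this
  by_cases h₁ : f a < 0 <;> by_cases h₂ : g a < 0 <;> simp only [h₁, h₂, decide_true, decide_false,
    cond_true, cond_false] <;> omega

@[fun_prop]
theorem intNeg {f : α → ℤ} (hf : Feasible O f) : Feasible O fun a => -f a := by
  have := intSub (const 0) hf
  simpa using this

@[fun_prop]
theorem intAdd {f g : α → ℤ} (hf : Feasible O f) (hg : Feasible O g) :
    Feasible O fun a => f a + g a := by
  have : Feasible O fun a => f a - -g a := by fun_prop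
  simpa using this

@[fun_prop]
theorem intSum {l : α → List ℤ} (hl : Feasible O l) : Feasible O fun a => (l a).sum := by
  have := foldl_of_potential (step := fun (_ : α) s b => s + b) hl (const 0) (by fun_prop)
    (fun z : ℤ => z.natAbs.size) (5 + 4 * .X) 1 (.X + 1) (fun z => ?_) (by simp) (fun a s b => ?_)
  · simpa [List.sum_eq_foldl] using this
  · have := Int.sz_le_of_lt_two_pow (Nat.lt_size_self z.natAbs)
    simp only [Polynomial.eval_add, Polynomial.eval_mul, Polynomial.eval_ofNat, Polynomial.eval_X]
    omega
  · have h₁ := Nat.lt_size_self s.natAbs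
    have h₂ := Nat.lt_size_self b.natAbs
    have h₃ : b.natAbs.size ≤ sz b :=
      (Nat.size_le_sz _).trans (show _ ≤ 1 + sz (decide (b < 0)) + sz b.natAbs by omega)
    have h₄ : (s + b).natAbs.size ≤ s.natAbs.size + b.natAbs.size + 1 := by
      rw [Nat.size_le]
      refine (Int.natAbs_add_le s b).trans_lt ?_
      have h₅ : 2 ^ s.natAbs.size ≤ 2 ^ (s.natAbs.size + b.natAbs.size) :=
        Nat.pow_le_pow_right (by omega) (by omega)
      have h₆ : 2 ^ b.natAbs.size ≤ 2 ^ (s.natAbs.size + b.natAbs.size) :=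
        Nat.pow_le_pow_right (by omega) (by omega)
      rw [pow_succ]
      omega
    simp only [Polynomial.eval_add, Polynomial.eval_one, Polynomial.eval_X]
    omega

@[fun_prop]
theorem length {l : α → List β} (hl : Feasible O l) : Feasible O fun a => (l a).length := by
  have := foldl_of_potential (step := fun (_ : α) s (_ : β) => s + 1) hl (const 0) (by fun_prop)
    (fun n : ℕ => n) (1 + 4 * .X) 1 1 (fun n => ?_) (by simp) (by simp)
  · refine (congrArg (Feasible O) (funext fun a => ?_)).mp this
    have h : ∀ (l : List β) (s : ℕ), l.foldl (fun s _ => s + 1) s = s + l.length := by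
      intro l
      induction l with
      | nil => simp
      | cons b l ih => intro s; rw [List.foldl_cons, ih, List.length_cons]; omega
    simp [h]
  · have := n.sz_le_linear
    simp only [Polynomial.eval_add, Polynomial.eval_mul, Polynomial.eval_ofNat, Polynomial.eval_X,
      Polynomial.eval_one]
    omega

@[fun_prop]
theorem zipIdx {l : α → List β} (hl : Feasible O l) : Feasible O fun a => (l a).zipIdx := by
  obtain ⟨P, hP⟩ := hl.size_bound
  have key : ∀ (l : List β) (s : List (β × ℕ) × ℕ),
      l.foldl (fun s b => ((b, s.2) :: s.1, s.2 + 1)) s =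
        ((l.zipIdx s.2).reverse ++ s.1, s.2 + l.length) := by
    intro l
    induction l with
    | nil => simp
    | cons b l ih =>
      intro s
      rw [List.foldl_cons, ih]
      simp only [List.zipIdx_cons, List.reverse_cons, List.append_assoc, List.singleton_append,
        List.length_cons, Prod.mk.injEq, true_and]
      omega
  have := foldl (step := fun (_ : α) (s : List (β × ℕ) × ℕ) b => ((b, s.2) :: s.1, s.2 + 1)) hl
    (const ([], 0)) (by fun_prop) (3 + P * (3 + P + 4 * P) + 4 * P) fun a k => ?_
  · simp only [key] at this
    simpa using this.fst.reverse
  · rw [key, sz_pair]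
    have h₁ := List.length_take_le' k (l a)
    have h₂ := length_lt_sz (l a)
    have h₃ := hP a
    have h₄ : sz ((((l a).take k).zipIdx 0).reverse ++ []) ≤
        1 + P.eval (sz a) * (1 + (2 + P.eval (sz a) + 4 * P.eval (sz a))) := by
      refine sz_list_le (by simp; omega) fun x hx => ?_
      simp only [List.append_nil, List.mem_reverse] at hx
      obtain ⟨b, i⟩ := x
      have h₅ := List.mem_zipIdx hx
      have h₆ := sz_le_of_mem
        (List.mem_of_mem_take (h₅.2.2 ▸ List.getElem_mem _ : b ∈ (l a).take k))
      have h₇ := i.sz_le_linear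
      rw [sz_pair]
      omega
    have h₅ := (0 + ((l a).take k).length).sz_le_linear
    simp only [Polynomial.eval_add, Polynomial.eval_mul, Polynomial.eval_ofNat]
    rw [show 3 + P.eval (sz a) + 4 * P.eval (sz a) =
      1 + (2 + P.eval (sz a) + 4 * P.eval (sz a)) by omega]
    omega

end Feasible

/-! ### Colourings of a single tetrahedron -/

/-- Colours of the pairs of vertices of a tetrahedron. -/
abbrev TetColours : Type := Fin 4 → Fin 4 → Fin (4 - 1)

namespace TetColours

/-- The colours of the three edges of the face opposite `i`. -/
def face (c : TetColours) (i : Fin 4) : Fin 3 → Fin (4 - 1) :=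
  ![c (i.succAbove 0) (i.succAbove 1), c (i.succAbove 0) (i.succAbove 2),
    c (i.succAbove 1) (i.succAbove 2)]

/-- Whether the colour `v` occurs on the face opposite `i`. -/
def FaceHas (c : TetColours) (i : Fin 4) (v : Fin (4 - 1)) : Prop :=
  ∃ a b, a ≠ i ∧ b ≠ i ∧ c a b = v

instance (c : TetColours) (i : Fin 4) (v : Fin (4 - 1)) : Decidable (c.FaceHas i v) :=
  inferInstanceAs (Decidable (∃ a b, a ≠ i ∧ b ≠ i ∧ c a b = v))

/-- Whether the surface meets the tetrahedron. -/
def HasHalf (c : TetColours) : Prop := ∃ a b, c a b = 1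

instance (c : TetColours) : Decidable c.HasHalf := inferInstanceAs (Decidable (∃ a b, c a b = 1))

/-- Whether the colours of the edges of each face are admissible. -/
def Admissible (c : TetColours) : Prop :=
  ∀ i, Gluing.AdmissibleTriple 4 (c.face i 0) (c.face i 1) (c.face i 2)

instance (r a b c : ℕ) : Decidable (Gluing.AdmissibleTriple r a b c) :=
  inferInstanceAs (Decidable (_ ∧ _ ∧ _ ∧ _ ∧ _))

instance (c : TetColours) : Decidable c.Admissible :=
  inferInstanceAs (Decidable (∀ _, Gluing.AdmissibleTriple _ _ _ _))

/-- Whether two opposite edges have colour `1` and the other four have colour `1/2`. The colours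
`0, 1/2, 1` are stored as `0, 1, 2`. -/
def Octagon (c : TetColours) : Prop :=
  ∃ σ : Equiv.Perm (Fin 4), c (σ 0) (σ 1) = 2 ∧ c (σ 2) (σ 3) = 2 ∧ c (σ 0) (σ 2) = 1 ∧
    c (σ 0) (σ 3) = 1 ∧ c (σ 1) (σ 2) = 1 ∧ c (σ 1) (σ 3) = 1

instance (c : TetColours) : Decidable c.Octagon :=
  inferInstanceAs (Decidable (∃ _ : Equiv.Perm (Fin 4), _ ∧ _ ∧ _ ∧ _ ∧ _ ∧ _))

/-- The number of faces with colours `1/2, 1/2, 1`. -/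
def mixedFaces (c : TetColours) : ℕ :=
  ∑ i, if c.FaceHas i 1 ∧ c.FaceHas i 2 then 1 else 0

/-- The colours `c₀, …, c₅` of the six edges, as a symmetric function of pairs of vertices. -/
def ofSix (c₀ c₁ c₂ c₃ c₄ c₅ : Fin (4 - 1)) : TetColours :=
  ![![0, c₀, c₁, c₂], ![c₀, 0, c₃, c₄], ![c₁, c₃, 0, c₅], ![c₂, c₄, c₅, 0]]

/-- Twice the contribution of the arcs and discs in the tetrahedron to the Euler characteristic;
an arc is shared by two tetrahedra. -/
def twiceEuler (c : TetColours) : ℤ :=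
  2 * (if c.HasHalf then 1 else 0) - ∑ i, if c.FaceHas i 1 then 1 else 0

end TetColours

/-- The exponent of `[2]` in `[k]!`, for `k ≤ 3`. -/
def qExp (k : ℕ) : ℕ := if k ≤ 1 then 0 else 1

/-- The seven sums that occur in the weight of a tetrahedron. -/
def tetSums (c₀ c₁ c₂ c₃ c₄ c₅ : ℕ) : (ℕ × ℕ × ℕ × ℕ) × (ℕ × ℕ × ℕ) :=
  (((c₀ + c₁ + c₃) / 2, (c₀ + c₂ + c₄) / 2, (c₁ + c₂ + c₅) / 2, (c₃ + c₄ + c₅) / 2),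
    ((c₀ + c₁ + c₄ + c₅) / 2, (c₀ + c₂ + c₃ + c₅) / 2, (c₁ + c₂ + c₃ + c₄) / 2))

/-- The combinatorial content of the weight of a tetrahedron: the sum over `y` has the single term
`y = max s = min p`, no factorial of a number greater than `3` occurs in it, the exponents of
`[2]` in numerator and denominator differ by `1` or `0` according to whether the surface meets the
tetrahedron, the number of faces with colours `1/2, 1/2, 1` is even, and the sign `(-1) ^ y` is the
product of a sign for the disc, a sign for the octagon and a sign for each pair of these faces. -/
def TetIdentity (c₀ c₁ c₂ c₃ c₄ c₅ : Fin (4 - 1)) : Prop :=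
  let c := TetColours.ofSix c₀ c₁ c₂ c₃ c₄ c₅
  let s := (tetSums c₀ c₁ c₂ c₃ c₄ c₅).1
  let p := (tetSums c₀ c₁ c₂ c₃ c₄ c₅).2
  let y := max (max s.1 s.2.1) (max s.2.2.1 s.2.2.2)
  y = min p.1 (min p.2.1 p.2.2) ∧ y + 1 ≤ 3 ∧
    p.1 - y ≤ 3 ∧ p.2.1 - y ≤ 3 ∧ p.2.2 - y ≤ 3 ∧
    qExp (y + 1) = qExp (y - s.1) + qExp (y - s.2.1) + qExp (y - s.2.2.1) + qExp (y - s.2.2.2) +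
      (qExp (p.1 - y) + qExp (p.2.1 - y) + qExp (p.2.2 - y)) + (if c.HasHalf then 1 else 0) ∧
    c.mixedFaces % 2 = 0 ∧
    y % 2 = ((if c.HasHalf then 1 else 0) + (if c.Octagon then 1 else 0) + c.mixedFaces / 2) % 2

instance (c₀ c₁ c₂ c₃ c₄ c₅ : Fin (4 - 1)) : Decidable (TetIdentity c₀ c₁ c₂ c₃ c₄ c₅) :=
  inferInstanceAs (Decidable (_ ∧ _ ∧ _ ∧ _ ∧ _ ∧ _ ∧ _ ∧ _))

/-- Verified for each of the `3 ^ 6` colourings. -/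
theorem tetIdentity : ∀ c₀ c₁ c₂ c₃ c₄ c₅ : Fin (4 - 1),
    (TetColours.ofSix c₀ c₁ c₂ c₃ c₄ c₅).Admissible → TetIdentity c₀ c₁ c₂ c₃ c₄ c₅ := by
  decide +kernel

/-! ### Quantum integers at the eighth root of unity -/

/-- The properties of `q` that the weights depend on: `[1] = [3] = 1`, and `[2] = d` is a square
root of two. -/
structure QuantumTwo (q : ℕ) (d : ℂ) : Prop where
  sq : d ^ 2 = 2
  one : qInt 4 q 1 = 1
  two : qInt 4 q 2 = d
  three : qInt 4 q 3 = 1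

/-- With `d = ζ + ζ⁻¹`, one has `(ζ - ζ⁻¹) ^ 2 = d ^ 2 - 4 ≠ 0` and `[3] = d ^ 2 - 1`. -/
theorem QuantumTwo.of_add_inv {q : ℕ} {d : ℂ} (h : zeta 4 q + (zeta 4 q)⁻¹ = d) (hd : d ^ 2 = 2) :
    QuantumTwo q d := by
  have h0 : zeta 4 q ≠ 0 := Complex.exp_ne_zero _
  set z := zeta 4 q
  have hz : z * z⁻¹ = 1 := mul_inv_cancel₀ h0
  have hne : z - z⁻¹ ≠ 0 := fun h' => by
    have h₁ : (z - z⁻¹) ^ 2 = d ^ 2 - 4 := by rw [← h]; linear_combination -4 * hz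
    rw [h', hd] at h₁
    norm_num at h₁
  refine ⟨hd, ?_, ?_, ?_⟩
  · rw [qInt, if_neg one_ne_zero, div_eq_iff hne]; ring
  · rw [qInt, if_neg two_ne_zero, div_eq_iff hne, ← h]; ring
  · rw [qInt, if_neg three_ne_zero, div_eq_iff hne]
    rw [← h] at hd
    linear_combination (z - z⁻¹) * hd - (z - z⁻¹) * hz

theorem quantumTwo_one : QuantumTwo 1 (Real.sqrt 2 : ℝ) := by
  have hs : ((Real.sqrt 2 : ℝ) : ℂ) ^ 2 = 2 := by
    rw [← Complex.ofReal_pow, Real.sq_sqrt (by norm_num)]; norm_num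
  refine .of_add_inv ?_ hs
  rw [zeta, ← Complex.exp_neg]
  have := Complex.two_cos (Real.pi / 4 : ℝ)
  rw [← Complex.ofReal_cos, Real.cos_pi_div_four] at this
  push_cast at this ⊢
  rw [show Complex.I * Real.pi * 1 / 4 = Real.pi / 4 * Complex.I by ring,
    show -(Real.pi / 4 * Complex.I) = -(Real.pi / 4) * Complex.I by ring, ← this]
  ring

theorem quantumTwo_three : QuantumTwo 3 (-(Real.sqrt 2 : ℝ)) := by
  have hs : ((Real.sqrt 2 : ℝ) : ℂ) ^ 2 = 2 := by
    rw [← Complex.ofReal_pow, Real.sq_sqrt (by norm_num)]; norm_num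
  refine .of_add_inv ?_ (by rw [neg_sq, hs])
  rw [zeta, ← Complex.exp_neg]
  have := Complex.two_cos (Real.pi - Real.pi / 4 : ℝ)
  rw [← Complex.ofReal_cos, Real.cos_pi_sub, Real.cos_pi_div_four] at this
  push_cast at this ⊢
  rw [show Complex.I * Real.pi * 3 / 4 = (Real.pi - Real.pi / 4) * Complex.I by ring,
    show -((Real.pi - Real.pi / 4) * Complex.I) = -(Real.pi - Real.pi / 4) * Complex.I by ring,
    ← this]
  ring

namespace QuantumTwo

variable {q : ℕ} {d : ℂ}

theorem ne_zero (h : QuantumTwo q d) : d ≠ 0 := fun h0 => by simpa [h0] using h.sq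

theorem qFact_eq (h : QuantumTwo q d) {k : ℕ} (hk : k ≤ 3) : qFact 4 q k = d ^ qExp k := by
  have h0 : qInt 4 q 0 = 1 := by simp [qInt]
  interval_cases k <;> simp [qFact, Finset.prod_range_succ, h0, h.one, h.two, h.three, qExp]

theorem edgeWeight_eq (h : QuantumTwo q d) (a : Fin (4 - 1)) :
    edgeWeight 4 q a = (-d) ^ (if (a : ℕ) = 1 then 1 else 0) := by
  fin_cases a <;> simp [edgeWeight, h.one, h.two, h.three]

theorem triangleWeight_eq (h : QuantumTwo q d) {a b c : Fin (4 - 1)}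
    (hT : Gluing.AdmissibleTriple 4 a b c) :
    triangleWeight 4 q a b c =
      (-1) ^ (if (a = 1 ∨ b = 1 ∨ c = 1) ∧ (a = 2 ∨ b = 2 ∨ c = 2) then 1 else 0) *
        ((-d) ^ (if a = 1 ∨ b = 1 ∨ c = 1 then 1 else 0))⁻¹ := by
  have hd := h.ne_zero
  have hdd := h.sq
  have h0 := h.qFact_eq (k := 0) (by norm_num)
  have h1 := h.qFact_eq (k := 1) (by norm_num)
  have h2 := h.qFact_eq (k := 2) (by norm_num)
  have h3 := h.qFact_eq (k := 3) (by norm_num)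
  revert hT
  fin_cases a <;> fin_cases b <;> fin_cases c <;> intro hT <;>
    first
    | exact absurd hT (by decide)
    | (simp [triangleWeight, h0, h1, h2, h3, qExp, hd]; try field_simp)

theorem tetWeight_eq (h : QuantumTwo q d) {c₀ c₁ c₂ c₃ c₄ c₅ : Fin (4 - 1)}
    (hT : (TetColours.ofSix c₀ c₁ c₂ c₃ c₄ c₅).Admissible) :
    tetWeight 4 q ![c₀, c₁, c₂, c₃, c₄, c₅] =
      (-1) ^ ((if (TetColours.ofSix c₀ c₁ c₂ c₃ c₄ c₅).Octagon then 1 else 0) +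
        (TetColours.ofSix c₀ c₁ c₂ c₃ c₄ c₅).mixedFaces / 2) *
      (-d) ^ (if (TetColours.ofSix c₀ c₁ c₂ c₃ c₄ c₅).HasHalf then 1 else 0) := by
  obtain ⟨h₁, h₂, h₃, h₄, h₅, h₆, -, h₇⟩ := tetIdentity _ _ _ _ _ _ hT
  have hd := h.ne_zero
  set c := TetColours.ofSix c₀ c₁ c₂ c₃ c₄ c₅
  set H := if c.HasHalf then 1 else 0
  set o := if c.Octagon then 1 else 0
  simp only [tetWeight]
  simp only [tetSums] at h₁ h₂ h₃ h₄ h₅ h₆ h₇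
  simp only [Matrix.cons_val]
  set s₁ := ((c₀ : ℕ) + c₁ + c₃) / 2
  set s₂ := ((c₀ : ℕ) + c₂ + c₄) / 2
  set s₃ := ((c₁ : ℕ) + c₂ + c₅) / 2
  set s₄ := ((c₃ : ℕ) + c₄ + c₅) / 2
  set q₁ := ((c₀ : ℕ) + c₁ + c₄ + c₅) / 2
  set q₂ := ((c₀ : ℕ) + c₂ + c₃ + c₅) / 2
  set q₃ := ((c₁ : ℕ) + c₂ + c₃ + c₄) / 2
  rw [← h₁]
  set y := max (max s₁ s₂) (max s₃ s₄)
  rw [Finset.Icc_self, Finset.sum_singleton, h.qFact_eq h₂, h.qFact_eq h₃, h.qFact_eq h₄,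
    h.qFact_eq h₅, h.qFact_eq (k := y - s₁) (by omega), h.qFact_eq (k := y - s₂) (by omega),
    h.qFact_eq (k := y - s₃) (by omega), h.qFact_eq (k := y - s₄) (by omega), h₆]
  have hs : (-1 : ℂ) ^ y = (-1) ^ (o + c.mixedFaces / 2 + H) := by
    rw [neg_one_pow_eq_pow_mod_two, h₇, ← neg_one_pow_eq_pow_mod_two]
    congr 1
    omega
  rw [hs, neg_pow d, div_eq_iff (by simp [hd])]
  ring

end QuantumTwo

/-! ### The state sum as a value of the Laurent polynomial -/

namespace Gluing

variable (G : Gluing)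

theorem edge_comm (t : Fin G.n) {a b : Fin 4} (h : a ≠ b) :
    G.edge t a b h = G.edge t b a h.symm := by
  unfold edge
  congr 3
  exact Sym2.eq_swap

theorem edge_adj (t : Fin G.n) {i a b : Fin 4} (h : a ≠ b) (ha : a ≠ i) (hb : b ≠ i) :
    G.edge (G.adj t i) (G.perm t i a) (G.perm t i b) ((G.perm t i).injective.ne h) =
      G.edge t a b h := by
  refine (Quot.sound ⟨i, ?_, rfl, rfl⟩).symm
  simp [ha.symm, hb.symm]

/-- The colours of a tetrahedron; pairs of equal vertices receive the colour `0`. -/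
def tetColours (θ : G.Edge → Fin (4 - 1)) (t : Fin G.n) : TetColours :=
  fun a b => if h : a ≠ b then θ (G.edge t a b h) else 0

variable {G} (θ : G.Edge → Fin (4 - 1))

theorem tetColours_of_ne (t : Fin G.n) {a b : Fin 4} (h : a ≠ b) :
    G.tetColours θ t a b = θ (G.edge t a b h) := dif_pos h

theorem tetColours_eq_ofSix (t : Fin G.n) : G.tetColours θ t = .ofSix (θ (G.tetEdge t 0))
    (θ (G.tetEdge t 1)) (θ (G.tetEdge t 2)) (θ (G.tetEdge t 3)) (θ (G.tetEdge t 4))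
    (θ (G.tetEdge t 5)) := by
  funext a b
  by_cases h : a = b
  · subst h
    rw [tetColours, dif_neg (by simp)]
    fin_cases a <;> rfl
  · rw [tetColours_of_ne _ _ h]
    fin_cases a <;> fin_cases b <;>
      first | exact absurd rfl h | rfl | exact congrArg θ (G.edge_comm t h)

theorem face_tetColours (x : Fin G.n × Fin 4) (k : Fin 3) :
    (G.tetColours θ x.1).face x.2 k = θ (G.triangleEdge x k) := by
  fin_cases k <;> exact tetColours_of_ne θ x.1 (Fin.succAbove_right_injective.ne (by decide))

theorem faceHas_iff (x : Fin G.n × Fin 4) {v : Fin (4 - 1)} (hv : v ≠ 0) :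
    (G.tetColours θ x.1).FaceHas x.2 v ↔ ∃ k, θ (G.triangleEdge x k) = v := by
  have key : ∀ i a b : Fin 4, a ≠ i → b ≠ i → a ≠ b → ∃ k l : Fin 3, k < l ∧
      ((i.succAbove k = a ∧ i.succAbove l = b) ∨ (i.succAbove k = b ∧ i.succAbove l = a)) := by
    decide
  have hface : ∀ k l : Fin 3, k < l → ∃ m, ∀ h, G.triangleEdge x m =
      G.edge x.1 (x.2.succAbove k) (x.2.succAbove l) h := by
    intro k l hkl
    fin_cases k <;> fin_cases l <;> first
      | exact absurd hkl (by decide)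
      | exact ⟨0, fun _ => rfl⟩
      | exact ⟨1, fun _ => rfl⟩
      | exact ⟨2, fun _ => rfl⟩
  constructor
  · rintro ⟨a, b, ha, hb, hab⟩
    have hne : a ≠ b := fun h => hv (by rw [← hab, tetColours, dif_neg (by simpa using h)])
    rw [tetColours_of_ne θ _ hne] at hab
    obtain ⟨k, l, hkl, ⟨rfl, rfl⟩ | ⟨rfl, rfl⟩⟩ := key x.2 a b ha hb hne
    · obtain ⟨m, hm⟩ := hface k l hkl
      exact ⟨m, by rw [hm hne, hab]⟩
    · obtain ⟨m, hm⟩ := hface k l hkl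
      exact ⟨m, by rw [hm hne.symm, ← hab, edge_comm]⟩
  · rintro ⟨k, rfl⟩
    rw [← face_tetColours θ x]
    fin_cases k <;> exact ⟨_, _, Fin.succAbove_ne _ _, Fin.succAbove_ne _ _, rfl⟩

theorem hasHalf_iff (t : Fin G.n) :
    (G.tetColours θ t).HasHalf ↔ ∃ k, θ (G.tetEdge t k) = 1 := by
  rw [tetColours_eq_ofSix]
  generalize hc : (fun k => θ (G.tetEdge t k)) = c
  have hc' : ∀ k, θ (G.tetEdge t k) = c k := fun k => congrFun hc k
  simp only [hc', TetColours.HasHalf, TetColours.ofSix, Fin.exists_fin_succ, Fin.exists_fin_zero]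
  simp
  tauto

theorem isAdmissible_iff : G.IsAdmissible 4 θ ↔ ∀ t, (G.tetColours θ t).Admissible := by
  simp only [IsAdmissible, TetColours.Admissible, Prod.forall]
  refine forall_congr' fun t => forall_congr' fun i => ?_
  rw [face_tetColours θ (t, i), face_tetColours θ (t, i), face_tetColours θ (t, i)]

theorem isOctagon_iff (t : Fin G.n) : G.IsOctagon θ t ↔ (G.tetColours θ t).Octagon := by
  have h : ∀ (e : G.Edge) (v : Fin (4 - 1)), (θ e : ℕ) = v ↔ θ e = v := fun e v => Fin.ext_iff.symm
  have h₁ : ∀ e : G.Edge, (θ e : ℕ) = 1 ↔ θ e = 1 := fun e => h e 1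
  have h₂ : ∀ e : G.Edge, (θ e : ℕ) = 2 ↔ θ e = 2 := fun e => h e 2
  refine exists_congr fun σ => ?_
  have hne : ∀ a b : Fin 4, a ≠ b → σ a ≠ σ b := fun a b hab => σ.injective.ne hab
  rw [tetColours_of_ne θ t (hne 0 1 (by decide)), tetColours_of_ne θ t (hne 2 3 (by decide)),
    tetColours_of_ne θ t (hne 0 2 (by decide)), tetColours_of_ne θ t (hne 0 3 (by decide)),
    tetColours_of_ne θ t (hne 1 2 (by decide)), tetColours_of_ne θ t (hne 1 3 (by decide))]
  simp only [h₁, h₂]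

theorem faceHas_adj (x : Fin G.n × Fin 4) {v : Fin (4 - 1)} (hv : v ≠ 0)
    (h : (G.tetColours θ x.1).FaceHas x.2 v) :
    (G.tetColours θ (G.adj x.1 x.2)).FaceHas (G.perm x.1 x.2 x.2) v := by
  obtain ⟨a, b, ha, hb, hab⟩ := h
  have hne : a ≠ b := fun h => hv (by rw [← hab, tetColours, dif_neg (by simpa using h)])
  refine ⟨G.perm x.1 x.2 a, G.perm x.1 x.2 b, (Equiv.injective _).ne ha, (Equiv.injective _).ne hb,
    ?_⟩
  rw [tetColours_of_ne θ _ ((Equiv.injective _).ne hne), edge_adj _ _ hne ha hb, ← hab,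
    tetColours_of_ne θ _ hne]

/-- The face that is glued to a given face. -/
def partner (x : Fin G.n × Fin 4) : Fin G.n × Fin 4 := (G.adj x.1 x.2, G.perm x.1 x.2 x.2)

theorem partner_partner (x : Fin G.n × Fin 4) : partner (partner x) = x := by
  obtain ⟨t, i⟩ := x
  refine Prod.ext (G.adj_adj t i) ?_
  simp [partner, G.perm_perm]

theorem partner_ne (x : Fin G.n × Fin 4) : partner x ≠ x := fun h =>
  G.no_fixed_face x.1 x.2 (Prod.ext_iff.1 h)

/-- The triangle of the triangulation that a face of a tetrahedron represents. -/
def triangleMk (x : Fin G.n × Fin 4) : G.Triangle := Quot.mk _ x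

theorem triangleMk_surjective : Function.Surjective (triangleMk (G := G)) := Quot.mk_surjective

theorem triangleMk_eq_iff (x y : Fin G.n × Fin 4) :
    triangleMk x = triangleMk y ↔ y = x ∨ y = partner x := by
  constructor
  · intro h
    have := Quot.eqvGen_exact h
    clear h
    induction this with
    | rel x y h => exact .inr h
    | refl x => exact .inl rfl
    | symm x y _ ih =>
      rcases ih with rfl | rfl
      · exact .inl rfl
      · exact .inr (partner_partner _).symm
    | trans x y z _ _ ih ih' =>
      rcases ih with rfl | rfl
      · exact ih'
      · rcases ih' with rfl | rfl
        · exact .inr rfl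
        · exact .inl (partner_partner _)
  · rintro (rfl | rfl)
    · rfl
    · exact Quot.sound rfl

theorem faceHas_congr {x y : Fin G.n × Fin 4} {v : Fin (4 - 1)} (hv : v ≠ 0)
    (h : triangleMk x = triangleMk y) :
    (G.tetColours θ x.1).FaceHas x.2 v ↔ (G.tetColours θ y.1).FaceHas y.2 v := by
  rcases (triangleMk_eq_iff x y).1 h with rfl | rfl
  · rfl
  · refine ⟨faceHas_adj θ x hv, fun h => ?_⟩
    have := faceHas_adj θ (partner x) hv h
    change (G.tetColours θ (partner (partner x)).1).FaceHas (partner (partner x)).2 v at this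
    rwa [partner_partner] at this

/-- Every triangle is the class of exactly two faces. -/
theorem sum_faces (g : G.Triangle → ℕ) :
    ∑ t : Fin G.n, ∑ i : Fin 4, g (triangleMk (t, i)) = 2 * ∑ f, g f := by
  classical
  rw [← Fintype.sum_prod_type' fun t i => g (triangleMk (t, i)),
    ← Finset.sum_fiberwise Finset.univ (triangleMk (G := G)),
    Finset.mul_sum]
  refine Finset.sum_congr rfl fun f _ => ?_
  obtain ⟨x, rfl⟩ := triangleMk_surjective f
  have : (Finset.univ.filter fun y : Fin G.n × Fin 4 => triangleMk y = triangleMk x) =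
      {x, partner x} := by
    ext y
    simp only [Finset.mem_filter, Finset.mem_univ, true_and, Finset.mem_insert,
      Finset.mem_singleton]
    rw [eq_comm, triangleMk_eq_iff]
  rw [this, Finset.sum_pair (partner_ne x).symm, (triangleMk_eq_iff x (partner x)).2 (.inr rfl)]
  exact (two_mul _).symm

/-- Whether the colour `v` occurs on the triangle `f`. For `v ≠ 0` the choice of a face that
represents `f` is immaterial, by `triangleHas_mk`. -/
def TriangleHas (v : Fin (4 - 1)) (f : G.Triangle) : Prop :=
  (G.tetColours θ f.out.1).FaceHas f.out.2 v

theorem triangleHas_mk {v : Fin (4 - 1)} (hv : v ≠ 0) (x : Fin G.n × Fin 4) :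
    TriangleHas θ v (triangleMk x) ↔ (G.tetColours θ x.1).FaceHas x.2 v :=
  faceHas_congr θ hv (Quot.out_eq _)

section

open scoped Classical in
theorem sum_mixedFaces : ∑ t, (G.tetColours θ t).mixedFaces =
    2 * ∑ f, if TriangleHas θ 1 f ∧ TriangleHas θ 2 f then 1 else 0 := by
  rw [← sum_faces]
  simp only [triangleHas_mk θ (v := 1) (by decide), triangleHas_mk θ (v := 2) (by decide),
    TetColours.mixedFaces]

open scoped Classical in
/-- The Euler characteristic of the surface as a sum over edges, triangles and tetrahedra. -/
theorem eulerChar_eq : G.eulerChar (G.reduction θ) =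
    (∑ e, if θ e = 1 then 1 else 0 : ℕ) - (∑ f, if TriangleHas θ 1 f then 1 else 0 : ℕ) +
      (∑ t, if (G.tetColours θ t).HasHalf then 1 else 0 : ℕ) := by
  have h : ∀ e, (G.reduction θ e : ℕ) = 1 ↔ θ e = 1 := by
    intro e
    simp only [reduction]
    generalize θ e = v
    revert v
    decide
  have h' : ∀ f : G.Triangle, (∃ x, Quot.mk _ x = f ∧ ∃ k, θ (G.triangleEdge x k) = 1) ↔
      TriangleHas θ 1 f := by
    intro f
    constructor
    · rintro ⟨x, rfl, hx⟩
      exact (triangleHas_mk θ (by decide) x).2 ((faceHas_iff θ x (by decide)).2 hx)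
    · intro hf
      exact ⟨f.out, Quot.out_eq f, (faceHas_iff θ _ (by decide)).1 hf⟩
  simp only [eulerChar, h, h', ← hasHalf_iff]
  rw [Nat.card_eq_fintype_card, Nat.card_eq_fintype_card, Nat.card_eq_fintype_card,
    Fintype.card_subtype, Fintype.card_subtype, Fintype.card_subtype, Finset.card_filter,
    Finset.card_filter, Finset.card_filter]

/-- Twice the Euler characteristic as a sum of contributions of edges and of tetrahedra. -/
theorem two_mul_eulerChar : 2 * G.eulerChar (G.reduction θ) =
    2 * (∑ e, if θ e = 1 then 1 else 0 : ℕ) + ∑ t, (G.tetColours θ t).twiceEuler := by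
  classical
  have h := sum_faces fun f : G.Triangle => if TriangleHas θ 1 f then 1 else 0
  simp only [triangleHas_mk θ (v := 1) (by decide)] at h
  zify at h
  rw [eulerChar_eq]
  simp only [TetColours.twiceEuler, Finset.sum_sub_distrib, ← Finset.mul_sum]
  push_cast
  linear_combination h

theorem octagons_eq : G.octagons θ = ∑ t, if (G.tetColours θ t).Octagon then 1 else 0 := by
  classical
  simp only [octagons, isOctagon_iff]
  rw [Nat.card_eq_fintype_card, Fintype.card_subtype, Finset.card_filter]

/-- The weight of an admissible colouring. The triangles with colours `1/2, 1/2, 1` contribute the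
sign `(-1) ^ N`, where `2 N` is the number of faces of tetrahedra with these colours; this cancels
against the signs of the tetrahedra, except for those of the octagons. -/
theorem weight_eq {q : ℕ} {d : ℂ} (h : QuantumTwo q d) (hθ : G.IsAdmissible 4 θ) :
    G.weight 4 q θ = (-1) ^ G.octagons θ * (-d) ^ G.eulerChar (G.reduction θ) := by
  classical
  have hd := neg_ne_zero.2 h.ne_zero
  have hadm := (isAdmissible_iff θ).1 hθ
  have he : ∏ e, edgeWeight 4 q (θ e) = (-d) ^ (∑ e, if θ e = 1 then 1 else 0 : ℕ) := by
    rw [← Finset.prod_pow_eq_pow_sum]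
    refine Finset.prod_congr rfl fun e _ => ?_
    rw [h.edgeWeight_eq]
    exact congrArg _ (if_congr (Fin.ext_iff (b := 1)).symm rfl rfl)
  have hf : (∏ f : G.Triangle, triangleWeight 4 q (θ (G.triangleEdge f.out 0))
      (θ (G.triangleEdge f.out 1)) (θ (G.triangleEdge f.out 2))) =
      (-1) ^ (∑ f, if TriangleHas θ 1 f ∧ TriangleHas θ 2 f then 1 else 0) *
        ((-d) ^ (∑ f, if TriangleHas θ 1 f then 1 else 0 : ℕ))⁻¹ := by
    rw [← Finset.prod_pow_eq_pow_sum, ← Finset.prod_pow_eq_pow_sum, ← Finset.prod_inv_distrib,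
      ← Finset.prod_mul_distrib]
    refine Finset.prod_congr rfl fun f _ => ?_
    have hv : ∀ v : Fin (4 - 1), v ≠ 0 → (TriangleHas θ v f ↔ θ (G.triangleEdge f.out 0) = v ∨
        θ (G.triangleEdge f.out 1) = v ∨ θ (G.triangleEdge f.out 2) = v) := by
      intro v hv
      rw [TriangleHas, faceHas_iff θ _ hv]
      simp [Fin.exists_fin_succ]
    rw [h.triangleWeight_eq (hθ f.out)]
    simp only [hv 1 (by decide), hv 2 (by decide)]
  have ht : (∏ t, tetWeight 4 q fun k => θ (G.tetEdge t k)) =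
      (-1) ^ (G.octagons θ + ∑ f, if TriangleHas θ 1 f ∧ TriangleHas θ 2 f then 1 else 0) *
        (-d) ^ (∑ t, if (G.tetColours θ t).HasHalf then 1 else 0 : ℕ) := by
    have hN : ∑ t, (G.tetColours θ t).mixedFaces / 2 =
        ∑ f, if TriangleHas θ 1 f ∧ TriangleHas θ 2 f then 1 else 0 := by
      refine Nat.eq_of_mul_eq_mul_left two_pos ?_
      rw [← sum_mixedFaces, Finset.mul_sum]
      refine Finset.sum_congr rfl fun t _ => ?_
      have := hadm t
      rw [tetColours_eq_ofSix] at this ⊢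
      have := (tetIdentity _ _ _ _ _ _ this).2.2.2.2.2.2.1
      omega
    rw [octagons_eq, ← hN, ← Finset.sum_add_distrib, ← Finset.prod_pow_eq_pow_sum,
      ← Finset.prod_pow_eq_pow_sum, ← Finset.prod_mul_distrib]
    refine Finset.prod_congr rfl fun t _ => ?_
    have := hadm t
    rw [tetColours_eq_ofSix] at this ⊢
    rw [← h.tetWeight_eq this]
    congr 1
    funext k
    fin_cases k <;> rfl
  rw [weight, he, hf, ht, eulerChar_eq, zpow_add₀ hd, zpow_sub₀ hd, zpow_natCast, zpow_natCast,
    zpow_natCast, pow_add (-1 : ℂ), div_eq_mul_inv]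
  set s := ∑ f : G.Triangle, if TriangleHas θ 1 f ∧ TriangleHas θ 2 f then 1 else 0
  have hs : ((-1 : ℂ) ^ s) * (-1) ^ s = 1 := by rw [← pow_add, ← two_mul, pow_mul]; simp
  linear_combination ((-d) ^ (∑ e, if θ e = 1 then 1 else 0 : ℕ) *
    ((-d) ^ (∑ f, if TriangleHas θ 1 f then 1 else 0 : ℕ))⁻¹ * (-1) ^ G.octagons θ *
    (-d) ^ (∑ t, if (G.tetColours θ t).HasHalf then 1 else 0 : ℕ)) * hs

end

end Gluing

/-! ### Evaluation and coefficients of the Laurent polynomial -/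

open LaurentPolynomial in
theorem coeff_C_mul_T (a : ℤ) (n m : ℤ) : (C a * T n : LaurentPolynomial ℤ).coeff m =
    if n = m then a else 0 := by
  rw [← single_eq_C_mul_T, AddMonoidAlgebra.coeff_single, Finsupp.single_apply]

theorem laurentEval_eq_sum {p : LaurentPolynomial ℤ} {s : Finset ℤ} (hs : p.coeff.support ⊆ s)
    (z : ℂ) : laurentEval p z = ∑ m ∈ s, (p.coeff m : ℂ) * z ^ m :=
  Finset.sum_subset hs fun m _ hm => by simp [Finsupp.notMem_support_iff.1 hm]

theorem laurentEval_add (p p' : LaurentPolynomial ℤ) (z : ℂ) :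
    laurentEval (p + p') z = laurentEval p z + laurentEval p' z := by
  classical
  rw [laurentEval_eq_sum (s := p.coeff.support ∪ p'.coeff.support)
      (by rw [AddMonoidAlgebra.coeff_add]; exact Finsupp.support_add),
    laurentEval_eq_sum Finset.subset_union_left, laurentEval_eq_sum Finset.subset_union_right,
    ← Finset.sum_add_distrib]
  refine Finset.sum_congr rfl fun m _ => ?_
  rw [AddMonoidAlgebra.coeff_add, Finsupp.add_apply]
  push_cast
  ring

theorem laurentEval_sum {ι : Type} (s : Finset ι) (p : ι → LaurentPolynomial ℤ) (z : ℂ) :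
    laurentEval (∑ i ∈ s, p i) z = ∑ i ∈ s, laurentEval (p i) z :=
  map_sum (AddMonoidHom.mk' (laurentEval · z) (laurentEval_add · · z)) p s

open LaurentPolynomial in
theorem laurentEval_C_mul_T (a m : ℤ) (z : ℂ) : laurentEval (C a * T m) z = a * z ^ m := by
  rw [laurentEval_eq_sum (support_C_mul_T a m), Finset.sum_singleton, coeff_C_mul_T, if_pos rfl]

namespace Gluing

variable (G : Gluing)

theorem TV_eq {q : ℕ} {d : ℂ} (h : QuantumTwo q d) : G.TV 4 q = laurentEval G.laurentP (-d) := by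
  rw [TV, laurentP, laurentEval_sum]
  refine Finset.sum_congr rfl fun θ _ => ?_
  rw [weight_eq _ h θ.2, laurentEval_C_mul_T]
  push_cast
  rfl

theorem coeff_laurentP (m : ℤ) : G.laurentP.coeff m = (G.evenCount m : ℤ) - G.oddCount m := by
  classical
  rw [laurentP, AddMonoidAlgebra.coeff_sum, Finsupp.finsetSum_apply, evenCount, oddCount,
    Nat.card_eq_fintype_card, Nat.card_eq_fintype_card, Fintype.card_subtype, Fintype.card_subtype,
    Finset.card_filter, Finset.card_filter]
  push_cast
  rw [← Finset.sum_sub_distrib]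
  refine Finset.sum_congr rfl fun θ _ => ?_
  rw [coeff_C_mul_T]
  rcases Nat.even_or_odd (G.octagons θ.1) with h | h
  · simp [h, Nat.not_odd_iff_even.2 h]
  · simp only [h, Nat.not_even_iff_odd.2 h, h.neg_one_pow, false_and, true_and, if_false]
    split_ifs <;> rfl

theorem card_edge_le : Fintype.card G.Edge ≤ 6 * G.n := by
  refine (Fintype.card_le_of_surjective (β := G.Edge) (Quot.mk _) Quot.mk_surjective).trans ?_
  rw [Fintype.card_prod, Fintype.card_fin, Sym2.card_subtype_not_diag, Fintype.card_fin, mul_comm]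
  rfl

theorem abs_eulerChar_le (θ : G.Edge → Fin (4 - 1)) :
    |G.eulerChar (G.reduction θ)| ≤ 8 * G.n := by
  classical
  have h₀ : ∀ (ι : Type) [Fintype ι] (p : ι → Prop) [DecidablePred p],
      (∑ i, if p i then 1 else 0) ≤ Fintype.card ι := fun ι _ p _ => by
    rw [← Finset.card_filter]; exact Finset.card_filter_le _ _
  have h₁ := (h₀ _ fun e => θ e = 1).trans G.card_edge_le
  have h₂ := h₀ _ fun f : G.Triangle => TriangleHas θ 1 f
  have h₃ := h₀ _ fun t => (G.tetColours θ t).HasHalf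
  have h₄ : Fintype.card G.Triangle ≤ G.n * 4 := by
    refine (Fintype.card_le_of_surjective _ (triangleMk_surjective (G := G))).trans ?_
    simp
  rw [Fintype.card_fin] at h₃
  rw [eulerChar_eq, abs_le]
  omega

theorem abs_le_of_coeff_ne_zero {m : ℤ} (h : G.laurentP.coeff m ≠ 0) : |m| ≤ 8 * G.n := by
  classical
  rw [laurentP, AddMonoidAlgebra.coeff_sum, Finsupp.finsetSum_apply] at h
  obtain ⟨θ, -, hθ⟩ := Finset.exists_ne_zero_of_sum_ne_zero h
  rw [coeff_C_mul_T] at hθ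
  rw [← (ite_ne_right_iff.1 hθ).1]
  exact G.abs_eulerChar_le θ.1

end Gluing

/-! ### Merging classes -/

/-- Unite the classes that contain one of the two given elements. -/
def mergeClasses {α : Type} [DecidableEq α] (P : List (List α)) (r : α × α) : List (List α) :=
  (P.filter fun C =>
    C.any (fun x => decide (x = r.1)) || C.any fun x => decide (x = r.2)).flatten ::
    P.filter fun C => !(C.any (fun x => decide (x = r.1)) || C.any fun x => decide (x = r.2))

/-- The classes of the equivalence relation on the list `N` generated by the pairs `rs`. -/
def classesOf {α : Type} [DecidableEq α] (N : List α) (rs : List (α × α)) : List (List α) :=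
  rs.foldl mergeClasses (N.map fun x => [x])

section Classes

variable {α ε : Type}

/-- `P` is a partition of `N` into non-empty classes, each of which consists of elements that
represent the same object. -/
structure IsClassification (Rep : α → ε → Prop) (N : List α) (P : List (List α)) : Prop where
  ne_nil : ∀ C ∈ P, C ≠ []
  perm : P.flatten.Perm N
  rep : ∀ C ∈ P, ∃ e, ∀ x ∈ C, Rep x e

variable {Rep : α → ε → Prop} {N : List α}

/-- A classification that separates different objects is a list of these objects. -/
theorem IsClassification.exists_list {P : List (List α)} (h : IsClassification Rep N P)
    (hnd : N.Nodup) (hRep : ∀ x e e', Rep x e → Rep x e' → e = e')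
    (hsurj : ∀ e, ∃ x ∈ N, Rep x e)
    (hsep : ∀ x ∈ N, ∀ y ∈ N, ∀ e, Rep x e → Rep y e → ∀ C ∈ P, x ∈ C → y ∈ C) :
    ∃ (es : List ε) (Cl : ε → List α), P = es.map Cl ∧ es.Nodup ∧ (∀ e, e ∈ es) ∧
      ∀ e, ∀ x ∈ N, x ∈ Cl e ↔ Rep x e := by
  rcases isEmpty_or_nonempty ε with hε | hε
  · refine ⟨[], fun _ => [], ?_, List.nodup_nil, fun e => hε.elim e, fun e => hε.elim e⟩
    rcases P with _ | ⟨C, P⟩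
    · rfl
    · exact hε.elim (h.rep C List.mem_cons_self).choose
  · have hmemN : ∀ C ∈ P, ∀ x ∈ C, x ∈ N := fun C hC x hx =>
      h.perm.mem_iff.1 (List.mem_flatten.2 ⟨C, hC, hx⟩)
    choose! E hE using h.rep
    have hex : ∀ e, ∃ C ∈ P, E C = e := by
      intro e
      obtain ⟨x, hxN, hx⟩ := hsurj e
      obtain ⟨C, hC, hxC⟩ := List.mem_flatten.1 (h.perm.mem_iff.2 hxN)
      exact ⟨C, hC, hRep _ _ _ (hE C hC x hxC) hx⟩
    choose Cl hCl hECl using hex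
    have hpw : P.Pairwise fun C C' => E C ≠ E C' := by
      have hd := (List.nodup_flatten.1 (h.perm.nodup_iff.2 hnd)).2
      refine List.Pairwise.imp_of_mem (fun {C C'} hC hC' hdis he => ?_) hd
      obtain ⟨x, hx⟩ := List.exists_mem_of_ne_nil C (h.ne_nil C hC)
      obtain ⟨y, hy⟩ := List.exists_mem_of_ne_nil C' (h.ne_nil C' hC')
      exact hdis (hsep x (hmemN C hC x hx) y (hmemN C' hC' y hy) (E C) (hE C hC x hx)
        (he ▸ hE C' hC' y hy) C hC hx) hy
    have hinj : ∀ C ∈ P, ∀ C' ∈ P, E C = E C' → C = C' := fun C hC C' hC' he =>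
      List.inj_on_of_nodup_map (List.pairwise_map.2 hpw) hC hC' he
    refine ⟨P.map E, Cl, ?_, List.pairwise_map.2 hpw, fun e => ?_,
      fun e x hx => ⟨fun hxC => ?_, fun hxe => ?_⟩⟩
    · rw [List.map_map]
      conv_lhs => rw [← List.map_id P]
      exact List.map_congr_left fun C hC => hinj C hC _ (hCl _) (hECl _).symm
    · exact List.mem_map.2 ⟨Cl e, hCl e, hECl e⟩
    · exact hECl e ▸ hE (Cl e) (hCl e) x hxC
    · obtain ⟨y, hy⟩ := List.exists_mem_of_ne_nil _ (h.ne_nil _ (hCl e))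
      exact hsep y (hmemN _ (hCl e) y hy) x hx e (hECl e ▸ hE (Cl e) (hCl e) y hy) hxe _ (hCl e) hy

variable [DecidableEq α]

theorem mem_mergeClasses_left {P : List (List α)} {u v x : α} :
    x ∈ (P.filter fun C => C.any (fun x => decide (x = u)) ||
      C.any fun x => decide (x = v)).flatten ↔ ∃ C ∈ P, (u ∈ C ∨ v ∈ C) ∧ x ∈ C := by
  simp [and_assoc]

theorem mem_mergeClasses {P : List (List α)} {u v : α} {C : List α} :
    C ∈ mergeClasses P (u, v) ↔ C = (P.filter fun C => C.any (fun x => decide (x = u)) ||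
      C.any fun x => decide (x = v)).flatten ∨ C ∈ P ∧ ¬ (u ∈ C ∨ v ∈ C) := by
  simp only [mergeClasses, List.mem_cons, List.mem_filter, Bool.not_eq_true', Bool.or_eq_false_iff,
    List.any_eq_false, decide_eq_true_eq, not_or]
  simp only [← List.forall_mem_ne']

theorem IsClassification.merge (hRep : ∀ x e e', Rep x e → Rep x e' → e = e')
    {P : List (List α)} (h : IsClassification Rep N P) {u v : α}
    (hu : u ∈ N) (huv : ∃ e, Rep u e ∧ Rep v e) :
    IsClassification Rep N (mergeClasses P (u, v)) := by
  obtain ⟨e, hue, hve⟩ := huv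
  refine ⟨fun C hC => ?_, ?_, fun C hC => ?_⟩
  · rcases mem_mergeClasses.1 hC with rfl | ⟨hC, -⟩
    · obtain ⟨C, hC, huC⟩ := List.mem_flatten.1 (h.perm.mem_iff.2 hu)
      exact List.ne_nil_of_mem (mem_mergeClasses_left.2 ⟨C, hC, .inl huC, huC⟩)
    · exact h.ne_nil C hC
  · refine List.Perm.trans ?_ h.perm
    rw [mergeClasses, List.flatten_cons, ← List.flatten_append]
    exact (List.filter_append_perm _ P).flatten
  · rcases mem_mergeClasses.1 hC with rfl | ⟨hC, -⟩
    · refine ⟨e, fun x hx => ?_⟩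
      obtain ⟨C, hC, huvC, hx⟩ := mem_mergeClasses_left.1 hx
      obtain ⟨e', he'⟩ := h.rep C hC
      have : e = e' := by
        rcases huvC with huC | hvC
        · exact hRep _ _ _ hue (he' u huC)
        · exact hRep _ _ _ hve (he' v hvC)
      exact this ▸ he' x hx
    · exact h.rep C hC

theorem exists_mem_mergeClasses {P : List (List α)} {u v x y : α}
    (h : ∃ C ∈ P, x ∈ C ∧ y ∈ C) : ∃ C ∈ mergeClasses P (u, v), x ∈ C ∧ y ∈ C := by
  obtain ⟨C, hC, hx, hy⟩ := h
  by_cases huv : u ∈ C ∨ v ∈ C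
  · exact ⟨_, mem_mergeClasses.2 (.inl rfl), mem_mergeClasses_left.2 ⟨C, hC, huv, hx⟩,
      mem_mergeClasses_left.2 ⟨C, hC, huv, hy⟩⟩
  · exact ⟨C, mem_mergeClasses.2 (.inr ⟨hC, huv⟩), hx, hy⟩

/-- If related elements represent the same object, so do the elements of each class; and related
elements end up in the same class. -/
theorem isClassification_classesOf (hRep : ∀ x e e', Rep x e → Rep x e' → e = e')
    (hN : ∀ x ∈ N, ∃ e, Rep x e) {rs : List (α × α)}
    (hrs : ∀ r ∈ rs, r.1 ∈ N ∧ r.2 ∈ N ∧ ∃ e, Rep r.1 e ∧ Rep r.2 e) :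
    IsClassification Rep N (classesOf N rs) ∧
      ∀ r ∈ rs, ∃ C ∈ classesOf N rs, r.1 ∈ C ∧ r.2 ∈ C := by
  have key : ∀ (rs : List (α × α)) (P : List (List α)), IsClassification Rep N P →
      (∀ r ∈ rs, r.1 ∈ N ∧ r.2 ∈ N ∧ ∃ e, Rep r.1 e ∧ Rep r.2 e) →
      IsClassification Rep N (rs.foldl mergeClasses P) ∧
      (∀ r ∈ rs, ∃ C ∈ rs.foldl mergeClasses P, r.1 ∈ C ∧ r.2 ∈ C) ∧
      ∀ x y, (∃ C ∈ P, x ∈ C ∧ y ∈ C) → ∃ C ∈ rs.foldl mergeClasses P, x ∈ C ∧ y ∈ C := by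
    intro rs
    induction rs with
    | nil => exact fun P hP _ => ⟨hP, by simp, fun x y h => h⟩
    | cons r rs ih =>
      intro P hP hrs
      obtain ⟨hu, hv, huv⟩ := hrs r List.mem_cons_self
      obtain ⟨h₁, h₂, h₃⟩ := ih _ (hP.merge hRep hu huv) fun r hr =>
        hrs r (List.mem_cons_of_mem _ hr)
      refine ⟨h₁, fun r' hr' => ?_, fun x y h => h₃ x y (exists_mem_mergeClasses h)⟩
      rcases List.mem_cons.1 hr' with rfl | hr'
      · refine h₃ _ _ ⟨_, mem_mergeClasses.2 (.inl rfl), ?_, ?_⟩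
        · obtain ⟨C, hC, hx⟩ := List.mem_flatten.1 (hP.perm.mem_iff.2 hu)
          exact mem_mergeClasses_left.2 ⟨C, hC, .inl hx, hx⟩
        · obtain ⟨C, hC, hx⟩ := List.mem_flatten.1 (hP.perm.mem_iff.2 hv)
          exact mem_mergeClasses_left.2 ⟨C, hC, .inr hx, hx⟩
      · exact h₂ r' hr'
  have h := key rs (N.map fun x => [x]) ⟨by simp, by simp [← List.flatMap_def], ?_⟩ hrs
  · exact ⟨h.1, h.2.1⟩
  · simpa using hN

end Classes

theorem sz_flatten_le {α : Type} [Enc α] (P : List (List α)) : sz P.flatten ≤ sz P := by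
  induction P with
  | nil => exact le_rfl
  | cons C P ih =>
    have := sz_append C P.flatten
    rw [List.flatten_cons, sz_cons]
    omega

theorem sz_filter_add {α : Type} [Enc α] (P : List α) (p : α → Bool) :
    sz (P.filter p) + sz (P.filter fun a => !p a) = sz P + 1 := by
  induction P with
  | nil => rfl
  | cons C P ih => cases h : p C <;> simp [h, sz_cons] <;> omega

namespace Feasible

variable {O : Oracles} {α κ : Type} [Enc α] [Enc κ] [EncInj κ] [DecidableEq κ]

theorem contains {l : α → List κ} {x : α → κ} (hl : Feasible O l) (hx : Feasible O x) :
    Feasible O fun a => (l a).any fun y => decide (y = x a) :=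
  any hl (by fun_prop)

@[fun_prop]
theorem classesOf {N : α → List κ} {rs : α → List (κ × κ)} (hN : Feasible O N)
    (hrs : Feasible O rs) : Feasible O fun a => classesOf (N a) (rs a) := by
  have htouch : Feasible O fun x : (α × List (List κ) × (κ × κ)) × List κ =>
      x.2.any (fun y => decide (y = x.1.2.2.1)) || x.2.any fun y => decide (y = x.1.2.2.2) :=
    or (contains (by fun_prop) (by fun_prop)) (contains (by fun_prop) (by fun_prop))
  refine foldl_of_growth (step := fun _ => mergeClasses) hrs (map hN (by fun_prop))
    (cons (flatten (filter (by fun_prop) htouch)) (filter (by fun_prop) (not htouch))) 2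
    fun a P r => ?_
  have h₁ := sz_flatten_le (P.filter fun C => C.any (fun x => decide (x = r.1)) ||
    C.any fun x => decide (x = r.2))
  have h₂ := sz_filter_add P fun C => C.any (fun x => decide (x = r.1)) ||
    C.any fun x => decide (x = r.2)
  rw [mergeClasses, sz_cons, Polynomial.eval_ofNat]
  omega

end Feasible

/-! ### The verifier -/

noncomputable instance : DecidableEq Val := Classical.decEq _

namespace Verifier

/-- The ordered pairs of different vertices of a tetrahedron. -/
def vertexPairs : List (Fin 4 × Fin 4) :=
  (List.finRange 4 ×ˢ List.finRange 4).filter fun p => p.1 ≠ p.2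

/-- A face, given by its opposite vertex, with an ordered pair of different vertices on it. -/
def facePairs : List (Fin 4 × Fin 4 × Fin 4) :=
  (List.finRange 4 ×ˢ (List.finRange 4 ×ˢ List.finRange 4)).filter fun p =>
    p.2.1 ≠ p.2.2 ∧ p.2.1 ≠ p.1 ∧ p.2.2 ≠ p.1

theorem mem_vertexPairs {a b : Fin 4} : (a, b) ∈ vertexPairs ↔ a ≠ b := by
  simp [vertexPairs]

theorem mem_facePairs {i a b : Fin 4} : (i, a, b) ∈ facePairs ↔ a ≠ b ∧ a ≠ i ∧ b ≠ i := by
  simp [facePairs]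

/-- The name of the oriented edge from the vertex `a` to the vertex `b` of the tetrahedron `t`. -/
def edgeName (t a b : Val) : Val := .pair t (.pair a b)

/-- The `i`-th element of a value read as a list. -/
def nth (i : ℕ) (v : Val) : Val := (Val.snd^[i] v).fst

/-- The names of the oriented edges of the tetrahedra in the table `G`. -/
def edgeNames (G : Val) : List Val :=
  G.toList.zipIdx.flatMap fun r => vertexPairs.map fun p => edgeName (enc r.2) (enc p.1) (enc p.2)

/-- The pairs of oriented edges that are identified by the table `G`, up to orientation. -/
def edgeRelations (G : Val) : List (Val × Val) :=
  G.toList.zipIdx.flatMap fun r =>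
    (facePairs.map fun p => (edgeName (enc r.2) (enc p.2.1) (enc p.2.2),
      edgeName (nth p.1 r.1).fst (nth p.2.1 (nth p.1 r.1).snd) (nth p.2.2 (nth p.1 r.1).snd))) ++
    vertexPairs.map fun p => (edgeName (enc r.2) (enc p.1) (enc p.2),
      edgeName (enc r.2) (enc p.2) (enc p.1))

/-- The edges of the triangulation given by the table `G`, as classes of oriented edges. -/
noncomputable def edgeClasses (G : Val) : List (List Val) :=
  classesOf (edgeNames G) (edgeRelations G)

/-- The two bits that encode a colour: whether it is `1/2`, and whether it is `1`. -/
def colourBits (v : Fin (4 - 1)) : List Bool := [decide (v = 1), decide (v = 2)]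

/-- The colour encoded by two bits; the first one takes precedence. -/
def colourOfBits (b : Bool × Bool) : Fin (4 - 1) := bif b.1 then 1 else bif b.2 then 2 else 0

/-- Assign to each class the colour given by the next two bits. Missing bits count as false, and
superfluous bits are ignored. -/
def decodeColours : List (List Val) → Val → List (List Val × Fin (4 - 1))
  | [], _ => []
  | C :: P, w => (C, colourOfBits (w.fst.nonNil, w.snd.fst.nonNil)) :: decodeColours P w.snd.snd

/-- The colour of an oriented edge according to a table of colours of classes; it is `0` if the
edge belongs to no class. -/
noncomputable def lookup (T : List (List Val × Fin (4 - 1))) (e : Val) : Fin (4 - 1) :=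
  T.foldl (fun v r => bif r.1.any (fun x => decide (x = e)) then r.2 else v) 0

/-- The colours of the tetrahedron with number `t`; pairs of equal vertices receive the colour
`0`. -/
noncomputable def tetColoursOf (T : List (List Val × Fin (4 - 1))) (t : ℕ) : TetColours :=
  fun a b => if a ≠ b then lookup T (edgeName (enc t) (enc a) (enc b)) else 0

/-- The colours of all tetrahedra. -/
noncomputable def allTetColours (G : Val) (T : List (List Val × Fin (4 - 1))) : List TetColours :=
  G.toList.zipIdx.map fun r => tetColoursOf T r.2

/-- The number of octagons among the tetrahedra with colours `cs`. -/
noncomputable def octagonCount (cs : List TetColours) : ℤ :=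
  (cs.map fun c => if c.Octagon then 1 else 0).sum

/-- Twice the Euler characteristic of the surface, from the table of the colours of the edges and
the list of the colours of the tetrahedra. -/
noncomputable def twiceEulerChar (T : List (List Val × Fin (4 - 1))) (cs : List TetColours) : ℤ :=
  (T.map fun r => if r.2 = 1 then 2 else 0).sum + (cs.map TetColours.twiceEuler).sum

/-- Half of an integer, rounded towards zero. -/
def half (z : ℤ) : ℤ := bif decide (z < 0) then -(z.natAbs.div2 : ℤ) else z.natAbs.div2

/-- Whether the bits `w` encode an admissible colouring with an even or odd number of octagons,
as `odd` prescribes, and with the Euler characteristic encoded by `m`. The first test compares `w`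
with the encoding of the colouring that it describes, so that each colouring is accepted in one
encoding only. -/
noncomputable def accepts (odd : Bool) (G m w : Val) : Bool :=
  let T := decodeColours (edgeClasses G) w
  let cs := allTetColours G T
  decide (enc (T.flatMap fun r => colourBits r.2) = w) &&
    (cs.all (fun c => decide c.Admissible) &&
      (decide ((octagonCount cs).natAbs.bodd = odd) &&
        decide (enc (half (twiceEulerChar T cs)) = m)))

variable {α : Type} [Enc α] {O : Oracles}

theorem feasible_nth (i : ℕ) {f : α → Val} (hf : Feasible O f) :
    Feasible O fun a => nth i (f a) := by
  have : Feasible O fun a => Val.snd^[i] (f a) := by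
    induction i with
    | zero => exact hf
    | succ i ih => simp only [Function.iterate_succ_apply']; exact ih.valSnd
  exact this.valFst

@[fun_prop]
theorem feasible_edgeName {f g h : α → Val} (hf : Feasible O f) (hg : Feasible O g)
    (hh : Feasible O h) : Feasible O fun a => edgeName (f a) (g a) (h a) := by
  unfold edgeName; fun_prop

@[fun_prop]
theorem feasible_edgeNames {f : α → Val} (hf : Feasible O f) :
    Feasible O fun a => edgeNames (f a) :=
  .flatMap (by fun_prop) (.listMap _ fun p _ => by fun_prop)

@[fun_prop]
theorem feasible_edgeRelations {f : α → Val} (hf : Feasible O f) :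
    Feasible O fun a => edgeRelations (f a) := by
  have h : ∀ i j : ℕ, Feasible O fun x : α × Val × ℕ => nth i (nth j x.2.1).snd := fun i j =>
    feasible_nth i (Feasible.valSnd (feasible_nth j (by fun_prop)))
  have h' : ∀ j : ℕ, Feasible O fun x : α × Val × ℕ => (nth j x.2.1).fst := fun j =>
    Feasible.valFst (feasible_nth j (by fun_prop))
  refine .flatMap (by fun_prop) (.append (.listMap _ fun p _ => ?_) (.listMap _ fun p _ => ?_))
  · have h₁ := h p.2.1 p.1
    have h₂ := h p.2.2 p.1
    have h₃ := h' p.1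
    exact .prodMk (by fun_prop) (feasible_edgeName h₃ h₁ h₂)
  · fun_prop

@[fun_prop]
theorem feasible_edgeClasses {f : α → Val} (hf : Feasible O f) :
    Feasible O fun a => edgeClasses (f a) := by
  unfold edgeClasses; fun_prop

theorem decodeColours_eq_foldl (P : List (List Val)) (w : Val) : decodeColours P w =
    (P.foldl (fun s C => ((C, colourOfBits (s.2.fst.nonNil, s.2.snd.fst.nonNil)) :: s.1,
      s.2.snd.snd)) (([] : List (List Val × Fin (4 - 1))), w)).1.reverse := by
  have : ∀ (P : List (List Val)) (w : Val) (acc : List (List Val × Fin (4 - 1))),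
      (P.foldl (fun s C => ((C, colourOfBits (s.2.fst.nonNil, s.2.snd.fst.nonNil)) :: s.1,
        s.2.snd.snd)) (acc, w)).1.reverse = acc.reverse ++ decodeColours P w := by
    intro P
    induction P with
    | nil => simp [decodeColours]
    | cons C P ih => intro w acc; rw [List.foldl_cons, ih]; simp [decodeColours]
  simp [this]

theorem sz_colour_le (v : Fin (4 - 1)) : sz v ≤ 13 :=
  (show sz v = sz (v : ℕ) from rfl) ▸ (Nat.sz_le_linear v).trans (by omega)

theorem sz_snd_le (v : Val) : sz v.snd ≤ sz v := by
  cases v with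
  | nil => rfl
  | pair a b => exact Nat.le_add_left _ _

@[fun_prop]
theorem feasible_decodeColours {P : α → List (List Val)} {w : α → Val} (hP : Feasible O P)
    (hw : Feasible O w) : Feasible O fun a => decodeColours (P a) (w a) := by
  have hc := Feasible.of_finite (O := O) colourOfBits
  simp only [decodeColours_eq_foldl]
  refine Feasible.reverse (Feasible.fst (Feasible.foldl_of_growth (step := fun _ s C =>
    ((C, colourOfBits (s.2.fst.nonNil, s.2.snd.fst.nonNil)) :: s.1, s.2.snd.snd)) hP
    (s := fun a => (([] : List (List Val × Fin (4 - 1))), w a)) (by fun_prop) (by fun_prop)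
    (15 + .X) ?_))
  rintro a ⟨acc, w⟩ C
  have h₁ := sz_colour_le (colourOfBits (w.fst.nonNil, w.snd.fst.nonNil))
  have h₂ := (sz_snd_le w.snd).trans (sz_snd_le w)
  simp only [sz_pair, sz_cons, Polynomial.eval_add, Polynomial.eval_ofNat, Polynomial.eval_X]
  omega

@[fun_prop]
theorem feasible_lookup {T : α → List (List Val × Fin (4 - 1))} {e : α → Val} (hT : Feasible O T)
    (he : Feasible O e) : Feasible O fun a => lookup (T a) (e a) := by
  refine Feasible.foldl_of_growth (step := fun a v r =>
    bif r.1.any (fun x => decide (x = e a)) then r.2 else v) hT (.const 0)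
    (.cond (Feasible.contains (by fun_prop) (by fun_prop)) (by fun_prop) (by fun_prop)) 13 ?_
  intro a v r
  have h := sz_colour_le (bif r.1.any (fun x => decide (x = e a)) then r.2 else v)
  rw [Polynomial.eval_ofNat]
  omega

@[fun_prop]
theorem feasible_tetColoursOf {T : α → List (List Val × Fin (4 - 1))} {t : α → ℕ}
    (hT : Feasible O T) (ht : Feasible O t) : Feasible O fun a => tetColoursOf (T a) (t a) := by
  refine .pi fun i => .pi fun j => ?_
  by_cases h : i ≠ j
  · simp only [tetColoursOf, if_pos h]; fun_prop
  · simp only [tetColoursOf, if_neg h]; fun_prop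

theorem feasible_accepts (odd : Bool) {G m w : α → Val} (hG : Feasible O G) (hm : Feasible O m)
    (hw : Feasible O w) : Feasible O fun a => accepts odd (G a) (m a) (w a) := by
  have h₁ := Feasible.of_finite (O := O) colourBits
  have h₂ := Feasible.of_finite (O := O) fun c : TetColours => decide c.Admissible
  have h₃ := Feasible.of_finite (O := O) fun c : TetColours => if c.Octagon then (1 : ℤ) else 0
  have h₄ := Feasible.of_finite (O := O) TetColours.twiceEuler
  have h₅ := Feasible.of_finite (O := O) fun v : Fin (4 - 1) => if v = 1 then (2 : ℤ) else 0
  have hT : Feasible O fun a => decodeColours (edgeClasses (G a)) (w a) := by fun_prop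
  have hcs : Feasible O fun a =>
      allTetColours (G a) (decodeColours (edgeClasses (G a)) (w a)) :=
    .map (by fun_prop) (by fun_prop)
  have hw' : Feasible O fun a =>
      (decodeColours (edgeClasses (G a)) (w a)).flatMap fun r => colourBits r.2 :=
    .flatMap hT (h₁.comp (by fun_prop))
  have hadm := Feasible.all (f := fun _ c => decide c.Admissible) hcs (h₂.comp (by fun_prop))
  have hoct : Feasible O fun a =>
      octagonCount (allTetColours (G a) (decodeColours (edgeClasses (G a)) (w a))) :=
    .intSum (.map (f := fun _ (c : TetColours) => if c.Octagon then (1 : ℤ) else 0) hcs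
      (h₃.comp (f := fun x : α × TetColours => x.2) (by fun_prop)))
  have hχ : Feasible O fun a => twiceEulerChar (decodeColours (edgeClasses (G a)) (w a))
      (allTetColours (G a) (decodeColours (edgeClasses (G a)) (w a))) :=
    .intAdd (.intSum (.map
      (f := fun _ (r : List Val × Fin (4 - 1)) => if r.2 = 1 then (2 : ℤ) else 0)
      hT (h₅.comp (f := fun x : α × List Val × Fin (4 - 1) => x.2.2) (by fun_prop))))
      (.intSum (.map hcs (h₄.comp (by fun_prop))))
  dsimp only [accepts, half]
  fun_prop

end Verifier

/-! ### Correctness of the verifier -/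

namespace Verifier

theorem nth_ofList_ofFn {k : ℕ} (f : Fin k → Val) (i : Fin k) :
    nth i (Val.ofList (List.ofFn f)) = f i := by
  induction k with
  | zero => exact i.elim0
  | succ k ih =>
    rw [List.ofFn_succ]
    cases i using Fin.cases with
    | zero => rfl
    | succ i => exact ih (fun i => f i.succ) i

variable (G : Gluing)

/-- The row of the gluing table for the tetrahedron `t`. -/
def tetRow (t : Fin G.n) : Val :=
  Val.ofList (List.ofFn fun i : Fin 4 =>
    .pair (Val.ofNat (G.adj t i))
      (Val.ofList (List.ofFn fun j : Fin 4 => Val.ofNat (G.perm t i j))))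

theorem zipIdx_ofGluing : (Val.ofGluing G).toList.zipIdx =
    (List.finRange G.n).map fun t => (tetRow G t, (t : ℕ)) := by
  have h : (Val.ofGluing G).toList = List.ofFn (tetRow G) := Val.toList_ofList _
  rw [h]
  apply List.ext_getElem <;> simp

/-- The name of an oriented edge of a tetrahedron of `G`. -/
def name (t : Fin G.n) (a b : Fin 4) : Val := edgeName (enc (t : ℕ)) (enc a) (enc b)

variable {G}

theorem name_inj {t t' : Fin G.n} {a a' b b' : Fin 4} :
    name G t a b = name G t' a' b' ↔ t = t' ∧ a = a' ∧ b = b' := by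
  constructor
  · intro h
    obtain ⟨h₁, h₂⟩ := Val.pair.inj h
    obtain ⟨h₂, h₃⟩ := Val.pair.inj h₂
    exact ⟨Fin.ext (EncInj.inj h₁), EncInj.inj h₂, EncInj.inj h₃⟩
  · rintro ⟨rfl, rfl, rfl⟩; rfl

theorem edgeNames_eq : edgeNames (Val.ofGluing G) =
    (List.finRange G.n).flatMap fun t => vertexPairs.map fun p => name G t p.1 p.2 := by
  rw [edgeNames, zipIdx_ofGluing, List.flatMap_map]
  rfl

theorem mem_edgeNames {v : Val} :
    v ∈ edgeNames (Val.ofGluing G) ↔ ∃ t a b, a ≠ b ∧ name G t a b = v := by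
  simp [edgeNames_eq, mem_vertexPairs]

theorem nodup_edgeNames : (edgeNames (Val.ofGluing G)).Nodup := by
  rw [edgeNames_eq, List.nodup_flatMap]
  refine ⟨fun t _ => List.Nodup.map (fun p p' h => ?_) (by decide),
    List.Pairwise.imp (fun {t t'} hne => ?_) (List.nodup_finRange G.n)⟩
  · obtain ⟨-, h₁, h₂⟩ := name_inj.1 h
    exact Prod.ext h₁ h₂
  · intro v hv hv'
    obtain ⟨p, -, rfl⟩ := List.mem_map.1 hv
    obtain ⟨p', -, h⟩ := List.mem_map.1 hv'
    exact hne (name_inj.1 h).1.symm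

theorem mem_edgeRelations {r : Val × Val} : r ∈ edgeRelations (Val.ofGluing G) ↔
    (∃ t i a b, (a ≠ b ∧ a ≠ i ∧ b ≠ i) ∧
      (name G t a b, name G (G.adj t i) (G.perm t i a) (G.perm t i b)) = r) ∨
    ∃ t a b, a ≠ b ∧ (name G t a b, name G t b a) = r := by
  have h₁ : ∀ t i, nth (i : Fin 4) (tetRow G t) = .pair (Val.ofNat (G.adj t i))
      (Val.ofList (List.ofFn fun j : Fin 4 => Val.ofNat (G.perm t i j))) := fun t i =>
    nth_ofList_ofFn _ i
  have h₂ : ∀ t i (j : Fin 4), nth j (nth (i : Fin 4) (tetRow G t)).snd =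
      Val.ofNat (G.perm t i j) := fun t i j => by
    rw [h₁]; exact nth_ofList_ofFn (fun j : Fin 4 => Val.ofNat (G.perm t i j)) j
  have h₃ : ∀ t i, (nth (i : Fin 4) (tetRow G t)).fst = Val.ofNat (G.adj t i) := fun t i => by
    rw [h₁]; rfl
  rw [edgeRelations, zipIdx_ofGluing, List.flatMap_map]
  simp only [List.mem_flatMap, List.mem_finRange, true_and, List.mem_append, List.mem_map,
    Prod.exists, mem_facePairs, mem_vertexPairs, h₂, h₃, exists_or]
  exact Iff.rfl

/-- The value `v` is the name of an orientation of the edge `e`. -/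
def Names (v : Val) (e : G.Edge) : Prop :=
  ∃ t a b, ∃ h : a ≠ b, name G t a b = v ∧ G.edge t a b h = e

theorem Names.unique {v : Val} {e e' : G.Edge} (h : Names v e) (h' : Names v e') : e = e' := by
  obtain ⟨t, a, b, hab, rfl, rfl⟩ := h
  obtain ⟨t', a', b', hab', h, rfl⟩ := h'
  obtain ⟨rfl, rfl, rfl⟩ := name_inj.1 h
  rfl

theorem names_name {t : Fin G.n} {a b : Fin 4} (h : a ≠ b) {e : G.Edge} :
    Names (name G t a b) e ↔ G.edge t a b h = e :=
  ⟨fun h' => Names.unique ⟨t, a, b, h, rfl, rfl⟩ h', fun he => ⟨t, a, b, h, rfl, he⟩⟩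

/-- A relation between names that contains the relations of the gluing table relates all names of
an edge. -/
theorem rel_of_names {S : Val → Val → Prop} (hS : Equivalence S)
    (h : ∀ r ∈ edgeRelations (Val.ofGluing G), S r.1 r.2) {v w : Val} {e : G.Edge}
    (hv : Names v e) (hw : Names w e) : S v w := by
  have hswap : ∀ t a b, a ≠ b → S (name G t a b) (name G t b a) := fun t a b hab =>
    h (_, _) (mem_edgeRelations.2 (.inr ⟨t, a, b, hab, rfl⟩))
  have hpair : ∀ (t : Fin G.n) {a b a' b' : Fin 4}, a ≠ b → s(a, b) = s(a', b') →
      S (name G t a b) (name G t a' b') := by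
    intro t a b a' b' hab hs
    rcases Sym2.eq_iff.1 hs with ⟨rfl, rfl⟩ | ⟨rfl, rfl⟩
    · exact hS.refl _
    · exact hswap t _ _ hab
  obtain ⟨t, a, b, hab, rfl, rfl⟩ := hv
  obtain ⟨t', a', b', hab', rfl, he⟩ := hw
  have key : ∀ x y : G.LocalEdge, Relation.EqvGen (fun x y : G.LocalEdge =>
      ∃ i : Fin 4, i ∉ x.2.1 ∧ y.1 = G.adj x.1 i ∧ y.2.1 = x.2.1.map (G.perm x.1 i)) x y →
      ∀ a b a' b', s(a, b) = x.2.1 → s(a', b') = y.2.1 → S (name G x.1 a b) (name G y.1 a' b') := by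
    intro x y hxy
    induction hxy with
    | rel x y hxy =>
      intro a b a' b' hx hy
      obtain ⟨i, hi, h₁, h₂⟩ := hxy
      rw [← hx] at hi h₂
      have hab : a ≠ b := by
        have := x.2.2
        rw [← hx] at this
        simpa using this
      simp only [Sym2.mem_iff, not_or] at hi
      rw [h₁]
      exact hS.trans (h (_, _) (mem_edgeRelations.2
        (.inl ⟨x.1, i, a, b, ⟨hab, Ne.symm hi.1, Ne.symm hi.2⟩, rfl⟩)))
        (hpair _ ((Equiv.injective _).ne hab) (by rw [hy, h₂, Sym2.map_mk]))
    | refl x =>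
      intro a b a' b' hx hy
      refine hpair _ ?_ (hx.trans hy.symm)
      have := x.2.2
      rw [← hx] at this
      simpa using this
    | symm x y _ ih => exact fun a b a' b' hx hy => hS.symm (ih a' b' a b hy hx)
    | trans x y z _ _ ih ih' =>
      intro a b a' b' hx hz
      induction hy : y.2.1 using Sym2.ind with
      | h c d => exact hS.trans (ih a b c d hx hy.symm) (ih' c d a' b' hy.symm hz)
  exact key _ _ (Quot.eqvGen_exact he.symm) a b a' b' rfl rfl

/-- The classes computed from the gluing table are the edges of the triangulation. -/
theorem exists_edgeClasses : ∃ (es : List G.Edge) (Cl : G.Edge → List Val),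
    edgeClasses (Val.ofGluing G) = es.map Cl ∧ es.Nodup ∧ (∀ e, e ∈ es) ∧
    ∀ e t a b, ∀ h : a ≠ b, name G t a b ∈ Cl e ↔ G.edge t a b h = e := by
  have hR : ∀ (v : Val) (e e' : G.Edge), Names v e → Names v e' → e = e' :=
    fun _ _ _ => Names.unique
  have hN : ∀ v ∈ edgeNames (Val.ofGluing G), ∃ e : G.Edge, Names v e := by
    intro v hv
    obtain ⟨t, a, b, hab, rfl⟩ := mem_edgeNames.1 hv
    exact ⟨_, t, a, b, hab, rfl, rfl⟩
  obtain ⟨hP, hrel⟩ := isClassification_classesOf hR hN (rs := edgeRelations (Val.ofGluing G))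
    fun r hr => by
      rcases mem_edgeRelations.1 hr with ⟨t, i, a, b, ⟨hab, ha, hb⟩, rfl⟩ | ⟨t, a, b, hab, rfl⟩
      · have hab' := (G.perm t i).injective.ne hab
        exact ⟨mem_edgeNames.2 ⟨t, a, b, hab, rfl⟩, mem_edgeNames.2 ⟨_, _, _, hab', rfl⟩,
          _, (names_name hab).2 rfl, (names_name hab').2 (G.edge_adj t hab ha hb)⟩
      · exact ⟨mem_edgeNames.2 ⟨t, a, b, hab, rfl⟩, mem_edgeNames.2 ⟨t, b, a, hab.symm, rfl⟩,
          _, (names_name hab).2 rfl, (names_name hab.symm).2 (G.edge_comm t hab).symm⟩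
  have hsurj : ∀ e : G.Edge, ∃ v ∈ edgeNames (Val.ofGluing G), Names v e := by
    intro e
    obtain ⟨⟨t, s, hs⟩, rfl⟩ := Quot.exists_rep e
    induction s using Sym2.ind with
    | h a b =>
      have hab : a ≠ b := by simpa using hs
      exact ⟨_, mem_edgeNames.2 ⟨t, a, b, hab, rfl⟩, t, a, b, hab, rfl, rfl⟩
  -- Names of one edge lie in the same classes, since the classes are disjoint.
  have hdis := (List.nodup_flatten.1 (hP.perm.nodup_iff.2 nodup_edgeNames)).2
  have huniq : ∀ C ∈ edgeClasses (Val.ofGluing G), ∀ C' ∈ edgeClasses (Val.ofGluing G),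
      ∀ u ∈ C, u ∈ C' → C = C' := fun C hC C' hC' u hu hu' => by
    by_contra hne
    have : Std.Symm (List.Disjoint (α := Val)) := ⟨fun _ _ h => h.symm⟩
    exact hdis.forall hC hC' hne hu hu'
  obtain ⟨es, Cl, h₁, h₂, h₃, h₄⟩ := hP.exists_list nodup_edgeNames hR hsurj
    fun v _ w _ e hv hw C hC => (rel_of_names
      (S := fun v w => ∀ C ∈ edgeClasses (Val.ofGluing G), v ∈ C ↔ w ∈ C)
      ⟨fun v C _ => Iff.rfl, fun h C hC => (h C hC).symm,
        fun h h' C hC => (h C hC).trans (h' C hC)⟩ (fun r hr C hC => by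
          obtain ⟨C', hC', h₁, h₂⟩ := hrel r hr
          exact ⟨fun hu => huniq C hC C' hC' _ hu h₁ ▸ h₂,
            fun hu => huniq C hC C' hC' _ hu h₂ ▸ h₁⟩) hv hw C hC).1
  exact ⟨es, Cl, h₁, h₂, h₃, fun e t a b hab =>
    (h₄ e _ (mem_edgeNames.2 ⟨t, a, b, hab, rfl⟩)).trans (names_name hab)⟩

end Verifier

namespace Verifier

variable {G : Gluing}

theorem decodeColours_word (es : List G.Edge) (Cl : G.Edge → List Val) (θ : G.Edge → Fin (4 - 1)) :
    decodeColours (es.map Cl) (enc (es.flatMap fun e => colourBits (θ e))) =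
      es.map fun e => (Cl e, θ e) := by
  induction es with
  | nil => rfl
  | cons e es ih =>
    rw [List.map_cons, List.map_cons, List.flatMap_cons, ← ih, decodeColours]
    have h : ∀ v : Fin (4 - 1), colourOfBits (decide (v = 1), decide (v = 2)) = v := by decide
    have h' : ∀ b : Bool, (Val.ofBool b).nonNil = b := by intro b; cases b <;> rfl
    congr 1
    refine congrArg (Cl e, ·) (Eq.trans ?_ (h (θ e)))
    rw [← h' (decide (θ e = 1)), ← h' (decide (θ e = 2))]
    rfl

/-- Every value is read as a colouring of the edges. -/
theorem exists_decodeColours_eq {es : List G.Edge} (hes : es.Nodup) (Cl : G.Edge → List Val)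
    (w : Val) : ∃ θ : G.Edge → Fin (4 - 1),
      decodeColours (es.map Cl) w = es.map fun e => (Cl e, θ e) := by
  classical
  induction es generalizing w with
  | nil => exact ⟨fun _ => 0, rfl⟩
  | cons e es ih =>
    obtain ⟨he, hes⟩ := List.nodup_cons.1 hes
    obtain ⟨θ, hθ⟩ := ih hes w.snd.snd
    refine ⟨Function.update θ e (colourOfBits (w.fst.nonNil, w.snd.fst.nonNil)), ?_⟩
    rw [List.map_cons, List.map_cons, decodeColours, hθ, Function.update_self]
    refine congrArg (_ :: ·) (List.map_congr_left fun e' he' => ?_)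
    rw [Function.update_of_ne (fun h : e' = e => he (h ▸ he'))]

theorem flatMap_colourBits_injective {es : List G.Edge} {θ θ' : G.Edge → Fin (4 - 1)}
    (h : (es.flatMap fun e => colourBits (θ e)) = es.flatMap fun e => colourBits (θ' e)) :
    ∀ e ∈ es, θ e = θ' e := by
  have := congrArg (fun w => decodeColours (es.map fun _ => []) (enc w)) h
  simp only [decodeColours_word] at this
  exact fun e he => congrArg Prod.snd (List.map_inj_left.1 this e he)

section

variable {es : List G.Edge} {Cl : G.Edge → List Val}

theorem sum_map_edges (hes : es.Nodup) (hall : ∀ e, e ∈ es) (f : G.Edge → ℤ) :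
    (es.map f).sum = ∑ e, f e := by
  classical
  rw [← List.sum_toFinset f hes]
  exact Finset.sum_congr (by ext e; simp [hall]) fun _ _ => rfl

theorem lookup_table (hall : ∀ e, e ∈ es)
    (hCl : ∀ e t a b, ∀ h : a ≠ b, name G t a b ∈ Cl e ↔ G.edge t a b h = e)
    (θ : G.Edge → Fin (4 - 1)) {t : Fin G.n} {a b : Fin 4} (h : a ≠ b) :
    lookup (es.map fun e => (Cl e, θ e)) (name G t a b) = θ (G.edge t a b h) := by
  classical
  have key : ∀ (L : List G.Edge) (v : Fin (4 - 1)),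
      (L.map fun e => (Cl e, θ e)).foldl (fun v r =>
        bif r.1.any (fun x => decide (x = name G t a b)) then r.2 else v) v =
      if G.edge t a b h ∈ L then θ (G.edge t a b h) else v := by
    intro L
    induction L with
    | nil => simp
    | cons e L ih =>
      intro v
      rw [List.map_cons, List.foldl_cons, ih]
      have h₁ : (Cl e).any (fun x => decide (x = name G t a b)) = decide (G.edge t a b h = e) := by
        rw [Bool.eq_iff_iff, decide_eq_true_iff, ← hCl e t a b h]
        simp
      by_cases he : G.edge t a b h = e
      · simp [he, h₁]
      · simp [he, h₁]
  exact (key es 0).trans (if_pos (hall _))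

theorem allTetColours_table (hall : ∀ e, e ∈ es)
    (hCl : ∀ e t a b, ∀ h : a ≠ b, name G t a b ∈ Cl e ↔ G.edge t a b h = e)
    (θ : G.Edge → Fin (4 - 1)) : allTetColours (Val.ofGluing G) (es.map fun e => (Cl e, θ e)) =
      (List.finRange G.n).map (G.tetColours θ) := by
  rw [allTetColours, zipIdx_ofGluing, List.map_map]
  refine List.map_congr_left fun t _ => ?_
  funext a b
  by_cases h : a ≠ b
  · rw [Function.comp_apply, tetColoursOf, if_pos h, Gluing.tetColours_of_ne θ t h,
      ← lookup_table hall hCl θ h]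
    rfl
  · rw [Function.comp_apply, tetColoursOf, if_neg h, Gluing.tetColours, dif_neg h]

theorem octagonCount_table (θ : G.Edge → Fin (4 - 1)) :
    octagonCount ((List.finRange G.n).map (G.tetColours θ)) = G.octagons θ := by
  rw [octagonCount, List.map_map, Gluing.octagons_eq, ← List.ofFn_eq_map, List.sum_ofFn]
  push_cast
  rfl

theorem twiceEulerChar_table (hes : es.Nodup) (hall : ∀ e, e ∈ es) (θ : G.Edge → Fin (4 - 1)) :
    twiceEulerChar (es.map fun e => (Cl e, θ e)) ((List.finRange G.n).map (G.tetColours θ)) =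
      2 * G.eulerChar (G.reduction θ) := by
  rw [twiceEulerChar, List.map_map, List.map_map, sum_map_edges hes hall, ← List.ofFn_eq_map,
    List.sum_ofFn, Gluing.two_mul_eulerChar]
  push_cast
  rw [Finset.mul_sum]
  congr 1
  exact Finset.sum_congr rfl fun e _ => by simp

theorem half_two_mul (z : ℤ) : half (2 * z) = z := by
  simp only [half, Nat.div2_val]
  by_cases h : 2 * z < 0 <;> simp only [h, decide_true, decide_false, cond_true, cond_false] <;>
    omega

end

theorem accepts_iff {es : List G.Edge} {Cl : G.Edge → List Val}
    (hP : edgeClasses (Val.ofGluing G) = es.map Cl) (hes : es.Nodup) (hall : ∀ e, e ∈ es)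
    (hCl : ∀ e t a b, ∀ h : a ≠ b, name G t a b ∈ Cl e ↔ G.edge t a b h = e) (odd : Bool) (m : ℤ)
    (w : List Bool) : accepts odd (Val.ofGluing G) (enc m) (enc w) = true ↔
      ∃ θ : G.Adm 4, ((G.octagons θ.1).bodd = odd ∧ G.eulerChar (G.reduction θ.1) = m) ∧
        (es.flatMap fun e => colourBits (θ.1 e)) = w := by
  have key : ∀ θ : G.Edge → Fin (4 - 1),
      decodeColours (es.map Cl) (enc w) = (es.map fun e => (Cl e, θ e)) →
      (accepts odd (Val.ofGluing G) (enc m) (enc w) = true ↔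
        (es.flatMap fun e => colourBits (θ e)) = w ∧ G.IsAdmissible 4 θ ∧
        (G.octagons θ).bodd = odd ∧ G.eulerChar (G.reduction θ) = m) := by
    intro θ hθ
    have h₁ : (∀ t, (G.tetColours θ t).Admissible) ↔ G.IsAdmissible 4 θ :=
      (Gluing.isAdmissible_iff θ).symm
    simp only [accepts, hP, hθ, allTetColours_table hall hCl, octagonCount_table,
      twiceEulerChar_table hes hall, half_two_mul, Bool.and_eq_true, decide_eq_true_eq,
      List.all_eq_true, List.mem_map, List.mem_finRange, true_and, forall_exists_index,
      forall_apply_eq_imp_iff, Int.natAbs_natCast, h₁, List.flatMap_map,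
      (EncInj.inj (α := List Bool)).eq_iff, (EncInj.inj (α := ℤ)).eq_iff]
  constructor
  · intro h
    obtain ⟨θ, hθ⟩ := exists_decodeColours_eq hes Cl (enc w)
    obtain ⟨h₁, h₂, h₃⟩ := (key θ hθ).1 h
    exact ⟨⟨θ, h₂⟩, h₃, h₁⟩
  · rintro ⟨θ, h, rfl⟩
    exact (key θ.1 (decodeColours_word es Cl θ.1)).2 ⟨rfl, θ.2, h⟩

theorem length_word (es : List G.Edge) (θ : G.Edge → Fin (4 - 1)) :
    (es.flatMap fun e => colourBits (θ e)).length = 2 * es.length := by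
  induction es with
  | nil => rfl
  | cons e es ih =>
    rw [List.flatMap_cons, List.length_append, ih, List.length_cons, colourBits]
    simp only [List.length_cons, List.length_nil]
    omega

theorem lt_size_ofGluing (G : Gluing) : G.n < (Val.ofGluing G).size := by
  have := length_lt_sz (List.ofFn (tetRow G))
  rw [List.length_ofFn] at this
  have h : G.n < (Val.ofList (List.ofFn (tetRow G))).size := by simpa [sz, enc] using this
  exact h

/-- The colourings are in bijection with the bit strings that the verifier accepts. -/
theorem card_accepted (odd : Bool) (a : Triangulation × ℤ) :
    {w : List Bool | w.length ≤ 12 * (Val.ofInstance a).size ∧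
      accepts odd (Val.ofInstance a).fst (Val.ofInstance a).snd (Val.ofBits w) = true}.ncard =
    Nat.card {θ : a.1.Adm 4 // (a.1.octagons θ.1).bodd = odd ∧
      a.1.eulerChar (a.1.reduction θ.1) = a.2} := by
  obtain ⟨𝔗, m⟩ := a
  obtain ⟨es, Cl, hP, hes, hall, hCl⟩ := exists_edgeClasses (G := 𝔗.toGluing)
  let word : 𝔗.Adm 4 → List Bool := fun θ => es.flatMap fun e => colourBits (θ.1 e)
  have hword : Function.Injective word := fun θ θ' h =>
    Subtype.ext (funext fun e => flatMap_colourBits_injective h e (hall e))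
  have hlen : es.length ≤ 6 * 𝔗.n := by
    classical
    rw [← List.toFinset_card_of_nodup hes]
    exact (Finset.card_le_univ _).trans 𝔗.card_edge_le
  have hset : {w : List Bool | w.length ≤ 12 * (Val.ofInstance (𝔗, m)).size ∧
      accepts odd (Val.ofInstance (𝔗, m)).fst (Val.ofInstance (𝔗, m)).snd (Val.ofBits w) = true} =
      word '' {θ | (𝔗.octagons θ.1).bodd = odd ∧ 𝔗.eulerChar (𝔗.reduction θ.1) = m} := by
    ext w
    refine ⟨fun h => (accepts_iff hP hes hall hCl odd m w).1 h.2, fun h => ⟨?_,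
      (accepts_iff hP hes hall hCl odd m w).2 h⟩⟩
    obtain ⟨θ, -, rfl⟩ := h
    have h₁ := lt_size_ofGluing 𝔗.toGluing
    have h₂ : (Val.ofGluing 𝔗.toGluing).size ≤ (Val.ofInstance (𝔗, m)).size := by
      simp only [Val.ofInstance, Val.size]; omega
    simp only [word, length_word]
    omega
  rw [hset, Set.ncard_image_of_injective _ hword]
  rfl

/-- The colourings counted are those that the verifier `accepts`. -/
theorem inSharpP_of_parity (odd : Bool) : InSharpP fun a => Nat.card {θ : a.1.Adm 4 //
    (a.1.octagons θ.1).bodd = odd ∧ a.1.eulerChar (a.1.reduction θ.1) = a.2} := by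
  have hF : Feasible noOracles fun v : Val =>
      (enc (accepts odd v.fst.fst v.fst.snd v.snd) : Val) :=
    (feasible_accepts odd (by fun_prop) (by fun_prop) (by fun_prop)).encode
  refine ⟨fun x => Set.ncard {w : List Bool |
      w.length ≤ (12 * Polynomial.X : Polynomial ℕ).eval x.size ∧
      (enc (accepts odd x.fst x.snd (Val.ofBits w)) : Val) ≠ .nil},
    ⟨fun v => enc (accepts odd v.fst.fst v.fst.snd v.snd), 12 * .X, ?_, fun x => rfl⟩, fun a => ?_⟩
  · obtain ⟨p, P, h⟩ := hF
    refine ⟨p, P, fun x => ?_⟩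
    obtain ⟨t, k, ht, e⟩ := h x
    obtain rfl := e.no_calls
    exact ⟨t, ht, e⟩
  · refine Eq.trans ?_ (card_accepted odd a)
    have hb : ∀ b : Bool, (enc b : Val) ≠ .nil ↔ b = true := by
      intro b; cases b <;> simp [enc, Val.ofBool]
    simp only [hb, Polynomial.eval_mul, Polynomial.eval_ofNat, Polynomial.eval_X]

end Verifier

theorem inSharpP_countEven : InSharpP countEven := by
  have := Verifier.inSharpP_of_parity false
  have h : ∀ k : ℕ, k.bodd = false ↔ Even k := fun k => by
    rw [Nat.even_iff, Nat.mod_two_of_bodd]; cases k.bodd <;> simp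
  simp only [h] at this
  exact this

theorem inSharpP_countOdd : InSharpP countOdd := by
  have := Verifier.inSharpP_of_parity true
  have h : ∀ k : ℕ, k.bodd = true ↔ Odd k := fun k => by
    rw [Nat.odd_iff, Nat.mod_two_of_bodd]; cases k.bodd <;> simp
  simp only [h] at this
  exact this

/-! ### Computing with the counting oracles -/

instance : Enc Triangulation := ⟨fun 𝔗 => Val.ofGluing 𝔗.toGluing⟩
instance : Enc SqrtTwoNumber := ⟨SqrtTwoNumber.enc⟩

/-- The size of the gluing table is polynomial in the number of tetrahedra. -/
theorem sz_triangulation_le (𝔗 : Triangulation) : sz 𝔗 ≤ 1 + 𝔗.n * (242 + 16 * 𝔗.n) := by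
  have h₁ : ∀ t i, sz (List.ofFn fun j : Fin 4 => enc (𝔗.perm t i j : Fin 4)) ≤ 57 := by
    intro t i
    refine (sz_list_le (B := 13) (List.length_ofFn).le fun a ha => ?_).trans le_rfl
    obtain ⟨j, rfl⟩ := (List.mem_ofFn' _ _).1 ha
    exact (Nat.sz_le_linear (𝔗.perm t i j : Fin 4)).trans (by omega)
  have h₂ : ∀ t, sz (List.ofFn fun i : Fin 4 => (enc (𝔗.adj t i : ℕ),
      List.ofFn fun j : Fin 4 => enc (𝔗.perm t i j : Fin 4))) ≤ 1 + 4 * (1 + (59 + 4 * 𝔗.n)) := by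
    intro t
    refine sz_list_le (List.length_ofFn).le fun a ha => ?_
    obtain ⟨i, rfl⟩ := (List.mem_ofFn' _ _).1 ha
    have h₃ : sz (enc (𝔗.adj t i : ℕ)) ≤ 1 + (𝔗.adj t i : ℕ) * 4 := Nat.sz_le_linear _
    have h₄ := h₁ t i
    have h₅ := (𝔗.adj t i).2
    rw [sz_pair]
    omega
  have h₃ : sz 𝔗 = sz (List.ofFn fun t => List.ofFn fun i : Fin 4 => (enc (𝔗.adj t i : ℕ),
      List.ofFn fun j : Fin 4 => enc (𝔗.perm t i j : Fin 4))) := by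
    simp only [sz, enc, Val.ofGluing, List.map_ofFn, Function.comp_def, id]
  rw [h₃]
  refine (sz_list_le (B := 1 + 4 * (1 + (59 + 4 * 𝔗.n))) (List.length_ofFn).le
    fun a ha => ?_).trans ?_
  · obtain ⟨t, rfl⟩ := (List.mem_ofFn' _ _).1 ha
    exact h₂ t
  · exact Nat.add_le_add_left (Nat.mul_le_mul_left _ (by omega)) _

theorem lt_sz_triangulation (𝔗 : Triangulation) : 𝔗.n < sz 𝔗 :=
  Verifier.lt_size_ofGluing 𝔗.toGluing

theorem length_toList_triangulation (𝔗 : Triangulation) : (enc 𝔗).toList.length = 𝔗.n := by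
  have h := congrArg List.length (Verifier.zipIdx_ofGluing 𝔗.toGluing)
  rw [List.length_zipIdx, List.length_map, List.length_finRange] at h
  exact h

theorem ReducesToCounting.of_feasible {f g : Triangulation × ℤ → ℕ} {β : Type} [Enc β]
    {R : Triangulation → β → Prop} {F : Triangulation → β}
    (hF : Feasible (countingOracles f g) F) (hR : ∀ 𝔗, R 𝔗 (F 𝔗)) :
    ReducesToCounting f g enc R := by
  obtain ⟨p, P, h⟩ := hF
  let B : Polynomial ℕ := 1 + .X * (242 + 16 * .X)
  refine ⟨p, P.comp B, P.comp B, fun 𝔗 => ?_⟩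
  obtain ⟨t, k, ht, e⟩ := h 𝔗
  have hB : sz 𝔗 ≤ B.eval 𝔗.n := by simpa [B] using sz_triangulation_le 𝔗
  have ht' : t ≤ (P.comp B).eval 𝔗.n := by
    rw [Polynomial.eval_comp]
    exact ht.trans (P.eval_mono_nat hB)
  exact ⟨F 𝔗, t, k, e, hR 𝔗, ht', e.calls_le_time.trans ht'⟩

theorem card_adm_lt (G : Gluing) : Fintype.card (G.Adm 4) < 2 ^ (12 * G.n + 1) := by
  classical
  have h₁ : Fintype.card (G.Adm 4) ≤ Fintype.card (G.Edge → Fin (4 - 1)) :=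
    Fintype.card_le_of_injective _ Subtype.val_injective
  have h₂ : Fintype.card (G.Edge → Fin (4 - 1)) = 3 ^ Fintype.card G.Edge := by simp
  calc Fintype.card (G.Adm 4) ≤ 3 ^ Fintype.card G.Edge := h₂ ▸ h₁
    _ ≤ 3 ^ (6 * G.n) := Nat.pow_le_pow_right (by norm_num) G.card_edge_le
    _ ≤ 4 ^ (6 * G.n) := Nat.pow_le_pow_left (by norm_num) _
    _ = 2 ^ (12 * G.n) := by rw [show 4 = 2 ^ 2 from rfl, ← pow_mul]; congr 1; omega
    _ < 2 ^ (12 * G.n + 1) := Nat.pow_lt_pow_right (by norm_num) (by omega)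

theorem sz_card_subtype_le (𝔗 : Triangulation) (p : 𝔗.Adm 4 → Prop) :
    sz (Nat.card {θ // p θ}) ≤ 5 + 48 * sz 𝔗 := by
  classical
  have h₁ : Nat.card {θ // p θ} < 2 ^ (12 * 𝔗.n + 1) := by
    rw [Nat.card_eq_fintype_card]
    exact (Fintype.card_subtype_le p).trans_lt (card_adm_lt 𝔗.toGluing)
  have h₂ := Nat.sz_le_of_lt_two_pow h₁
  have h₃ := lt_sz_triangulation 𝔗
  omega

section

variable {α : Type} [Enc α] {O : Oracles}

@[fun_prop]
theorem feasible_countEven {f : α → Triangulation × ℤ}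
    (hf : Feasible (countingOracles countEven countOdd) f) :
    Feasible (countingOracles countEven countOdd) fun a => countEven (f a) := by
  refine Feasible.comp (g := countEven)
    ⟨.call true, 6 + 49 * .X, fun a => ⟨_, _, ?_, .call ⟨a, rfl, rfl⟩⟩⟩ hf
  have h₁ : sz (countEven a) ≤ 5 + 48 * sz a.1 := sz_card_subtype_le a.1 _
  have h₂ : sz a = 1 + sz a.1 + sz a.2 := rfl
  simp only [Polynomial.eval_add, Polynomial.eval_mul, Polynomial.eval_ofNat, Polynomial.eval_X]
  change 1 + sz a + sz (countEven a) ≤ _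
  omega

@[fun_prop]
theorem feasible_countOdd {f : α → Triangulation × ℤ}
    (hf : Feasible (countingOracles countEven countOdd) f) :
    Feasible (countingOracles countEven countOdd) fun a => countOdd (f a) := by
  refine Feasible.comp (g := countOdd)
    ⟨.call false, 6 + 49 * .X, fun a => ⟨_, _, ?_, .call ⟨a, rfl, rfl⟩⟩⟩ hf
  have h₁ : sz (countOdd a) ≤ 5 + 48 * sz a.1 := sz_card_subtype_le a.1 _
  have h₂ : sz a = 1 + sz a.1 + sz a.2 := rfl
  simp only [Polynomial.eval_add, Polynomial.eval_mul, Polynomial.eval_ofNat, Polynomial.eval_X]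
  change 1 + sz a + sz (countOdd a) ≤ _
  omega

namespace Feasible

@[fun_prop]
theorem numTetrahedra {f : α → Triangulation} (hf : Feasible O f) :
    Feasible O fun a => (f a).n := by
  have : Feasible O fun a => (enc (f a)).toList.length := by fun_prop
  refine (congrArg (Feasible O) (funext fun a => ?_)).mp this
  exact length_toList_triangulation (f a)

/-- The list `0, …, 16 n`, where `n` is the number of tetrahedra. -/
theorem range_numTetrahedra {f : α → Triangulation} (hf : Feasible O f) :
    Feasible O fun a => List.range (16 * (f a).n + 1) := by
  have h₁ : Feasible O fun a => ((enc (f a)).toList.flatMap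
      fun _ => List.replicate 16 Val.nil) ++ [Val.nil] :=
    append (flatMap (f := fun _ _ => List.replicate 16 Val.nil) (by fun_prop) (const _)) (const _)
  have h₂ : Feasible O fun a => (((enc (f a)).toList.flatMap
      fun _ => List.replicate 16 Val.nil) ++ [Val.nil]).zipIdx.map fun x => x.2 :=
    map h₁.zipIdx (by fun_prop)
  refine (congrArg (Feasible O) (funext fun a => ?_)).mp h₂
  have h₃ := length_toList_triangulation (f a)
  rw [show (fun x : Val × ℕ => x.2) = Prod.snd from rfl, List.zipIdx_map_snd, List.range_eq_range']
  simp [h₃, mul_comm]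

@[fun_prop]
theorem mulFour {f : α → ℕ} (hf : Feasible O f) : Feasible O fun a => 4 * f a := by
  refine (congrArg (Feasible O) (funext fun a => ?_)).mp
    (show Feasible O fun a => f a + f a + (f a + f a) by fun_prop)
  omega

@[fun_prop]
theorem mulEight {f : α → ℕ} (hf : Feasible O f) : Feasible O fun a => 8 * f a := by
  refine (congrArg (Feasible O) (funext fun a => ?_)).mp
    (show Feasible O fun a => 4 * f a + 4 * f a by fun_prop)
  omega

end Feasible

end

/-- The coefficient of degree `k - 8 n` of the Laurent polynomial; every exponent that occurs is of
this form with `0 ≤ k ≤ 16 n`. -/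
noncomputable def shiftedCoeff (𝔗 : Triangulation) (k : ℕ) : ℤ :=
  (countEven (𝔗, (k : ℤ) - (8 * 𝔗.n : ℕ)) : ℤ) - countOdd (𝔗, (k : ℤ) - (8 * 𝔗.n : ℕ))

theorem feasible_shiftedCoeff : Feasible (countingOracles countEven countOdd)
    fun x : Triangulation × ℕ => shiftedCoeff x.1 x.2 := by
  unfold shiftedCoeff
  fun_prop

theorem coeff_eq_shiftedCoeff (𝔗 : Triangulation) (k : ℕ) :
    𝔗.laurentP.coeff ((k : ℤ) - (8 * 𝔗.n : ℕ)) = shiftedCoeff 𝔗 k :=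
  𝔗.coeff_laurentP _

theorem support_laurentP_subset (𝔗 : Triangulation) : 𝔗.laurentP.coeff.support ⊆
    (Finset.range (16 * 𝔗.n + 1)).image fun k : ℕ => (k : ℤ) - (8 * 𝔗.n : ℕ) := by
  intro m hm
  have h := abs_le.1 (𝔗.abs_le_of_coeff_ne_zero (Finsupp.mem_support_iff.1 hm))
  simp only [Finset.mem_image, Finset.mem_range]
  exact ⟨(m + 8 * 𝔗.n).toNat, by omega, by omega⟩

theorem laurentEval_eq_sum_shifted (𝔗 : Triangulation) (z : ℂ) : laurentEval 𝔗.laurentP z =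
    ∑ k ∈ Finset.range (16 * 𝔗.n + 1), (shiftedCoeff 𝔗 k : ℂ) * z ^ ((k : ℤ) - (8 * 𝔗.n : ℕ)) := by
  rw [laurentEval_eq_sum (support_laurentP_subset 𝔗),
    Finset.sum_image (by intro a _ b _ h; simpa using h)]
  simp only [coeff_eq_shiftedCoeff]

/-- The terms of the Laurent polynomial of degrees `-8 n, …, 8 n`. -/
noncomputable def laurentTerms (𝔗 : Triangulation) : List (ℤ × ℤ) :=
  (List.range (16 * 𝔗.n + 1)).map fun k : ℕ => ((k : ℤ) - (8 * 𝔗.n : ℕ), shiftedCoeff 𝔗 k)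

theorem ofTerms_laurentTerms (𝔗 : Triangulation) : ofTerms (laurentTerms 𝔗) = 𝔗.laurentP := by
  rw [ofTerms, laurentTerms, List.map_map, ← List.sum_toFinset _ List.nodup_range,
    List.toFinset_range]
  refine LaurentPolynomial.ext fun m => ?_
  rw [AddMonoidAlgebra.coeff_sum, Finsupp.finsetSum_apply]
  simp only [Function.comp_apply, coeff_C_mul_T, ← coeff_eq_shiftedCoeff]
  by_cases hm : 𝔗.laurentP.coeff m = 0
  · rw [hm]
    refine Finset.sum_eq_zero fun k _ => ?_
    split_ifs with h
    · rw [h, hm]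
    · rfl
  · obtain ⟨k, hk, rfl⟩ := Finset.mem_image.1
      (support_laurentP_subset 𝔗 (Finsupp.mem_support_iff.2 hm))
    rw [Finset.sum_eq_single_of_mem k hk, if_pos rfl]
    intro k' _ hne
    exact if_neg (by omega)

theorem feasible_laurentTerms :
    Feasible (countingOracles countEven countOdd) laurentTerms := by
  have := feasible_shiftedCoeff
  exact .map (f := fun (𝔗 : Triangulation) (k : ℕ) => ((k : ℤ) - (8 * 𝔗.n : ℕ), shiftedCoeff 𝔗 k))
    (.range_numTetrahedra .id) (by fun_prop)

/-! ### Evaluation at the square roots of two -/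

/-- Horner's scheme at a number `z` with `z ^ 2 = 2`: the pair `(a, b)` stands for `a + b z`. -/
def horner (l : List ℤ) : ℤ × ℤ := l.foldr (fun c s => (s.2 + s.2 + c, s.1)) (0, 0)

theorem horner_value {z : ℂ} (hz : z ^ 2 = 2) (f : ℕ → ℤ) (N s : ℕ) :
    ((horner ((List.range' s N).map f)).1 : ℂ) + (horner ((List.range' s N).map f)).2 * z =
      ∑ i ∈ Finset.range N, (f (s + i) : ℂ) * z ^ i := by
  induction N generalizing s with
  | zero => simp [horner]
  | succ N ih =>
    have h := ih (s + 1)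
    rw [List.range'_succ, List.map_cons, horner, List.foldr_cons, Finset.sum_range_succ']
    rw [horner] at h
    have h' : ∑ i ∈ Finset.range N, (f (s + (i + 1)) : ℂ) * z ^ (i + 1) =
        (∑ i ∈ Finset.range N, (f (s + 1 + i) : ℂ) * z ^ i) * z := by
      rw [Finset.sum_mul]
      exact Finset.sum_congr rfl fun i _ => by rw [pow_succ, mul_assoc, add_right_comm, add_assoc]
    rw [h', ← h]
    push_cast
    simp only [add_zero, pow_zero, mul_one]
    linear_combination (-((List.foldr (fun c s => (s.2 + s.2 + c, s.1)) ((0 : ℤ), (0 : ℤ))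
      (List.map f (List.range' (s + 1) N))).2 : ℂ)) * hz

theorem Feasible.horner {O : Oracles} {α : Type} [Enc α] {l : α → List ℤ} (hl : Feasible O l) :
    Feasible O fun a => horner (l a) := by
  have := Feasible.foldl_of_potential (step := fun (_ : α) (s : ℤ × ℤ) c => (s.2 + s.2 + c, s.1))
    hl.reverse (.const (0, 0)) (by fun_prop) (fun s => s.1.natAbs.size + s.2.natAbs.size)
    (11 + 4 * .X) 0 (.X + 2) (fun s => ?_) (by simp) (fun a s c => ?_)
  · simp only [List.foldl_reverse] at this
    exact this
  · have h₁ := Int.sz_le_of_lt_two_pow (Nat.lt_size_self s.1.natAbs)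
    have h₂ := Int.sz_le_of_lt_two_pow (Nat.lt_size_self s.2.natAbs)
    have h₃ : sz s = 1 + sz s.1 + sz s.2 := rfl
    simp only [Polynomial.eval_add, Polynomial.eval_mul, Polynomial.eval_ofNat, Polynomial.eval_X]
    omega
  · have h₁ := Nat.lt_size_self s.2.natAbs
    have h₂ := Nat.lt_size_self c.natAbs
    have h₃ : c.natAbs.size ≤ sz c :=
      (Nat.size_le_sz _).trans (show _ ≤ 1 + sz (decide (c < 0)) + sz c.natAbs by omega)
    have h₄ : (s.2 + s.2 + c).natAbs.size ≤ s.2.natAbs.size + c.natAbs.size + 2 := by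
      rw [Nat.size_le]
      have h₅ : 2 ^ s.2.natAbs.size ≤ 2 ^ (s.2.natAbs.size + c.natAbs.size) :=
        Nat.pow_le_pow_right (by omega) (by omega)
      have h₆ : 2 ^ c.natAbs.size ≤ 2 ^ (s.2.natAbs.size + c.natAbs.size) :=
        Nat.pow_le_pow_right (by omega) (by omega)
      rw [pow_add _ _ 2]
      omega
    simp only [Polynomial.eval_add, Polynomial.eval_ofNat, Polynomial.eval_X]
    omega

/-- The value of the Laurent polynomial at `z = √2`, or at `z = -√2` if `negative` holds. Horner's
scheme, applied to the coefficients of degrees `-8 n, …, 8 n`, yields the value times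
`z ^ (8 n) = 2 ^ (4 n)`. -/
noncomputable def valueAtSqrtTwo (negative : Bool) (𝔗 : Triangulation) : SqrtTwoNumber :=
  let h := horner ((List.range (16 * 𝔗.n + 1)).map (shiftedCoeff 𝔗))
  ⟨h.1, bif negative then -h.2 else h.2, 4 * 𝔗.n⟩

theorem value_valueAtSqrtTwo (negative : Bool) (𝔗 : Triangulation) :
    (valueAtSqrtTwo negative 𝔗).value =
      laurentEval 𝔗.laurentP (bif negative then -(Real.sqrt 2 : ℝ) else (Real.sqrt 2 : ℝ)) := by
  have hs : ((Real.sqrt 2 : ℝ) : ℂ) ^ 2 = 2 := by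
    rw [← Complex.ofReal_pow, Real.sq_sqrt (by norm_num)]; norm_num
  set z : ℂ := bif negative then -(Real.sqrt 2 : ℝ) else (Real.sqrt 2 : ℝ) with hz
  have hz2 : z ^ 2 = 2 := by rw [hz]; cases negative <;> simp [hs]
  have hz0 : z ≠ 0 := fun h => by simp [h] at hz2
  have hpow : z ^ ((8 * 𝔗.n : ℕ) : ℤ) = 2 ^ (4 * 𝔗.n) := by
    rw [zpow_natCast, ← hz2, ← pow_mul]; congr 1; omega
  have h := horner_value hz2 (shiftedCoeff 𝔗) (16 * 𝔗.n + 1) 0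
  rw [← List.range_eq_range'] at h
  have hval : (valueAtSqrtTwo negative 𝔗).value = (∑ i ∈ Finset.range (16 * 𝔗.n + 1),
      (shiftedCoeff 𝔗 (0 + i) : ℂ) * z ^ i) / 2 ^ (4 * 𝔗.n) := by
    rw [← h, hz]
    simp only [SqrtTwoNumber.value, valueAtSqrtTwo]
    cases negative <;> simp
  rw [hval, laurentEval_eq_sum_shifted, ← hpow, Finset.sum_div]
  refine Finset.sum_congr rfl fun k _ => ?_
  rw [zpow_sub₀ hz0, zpow_natCast, zpow_natCast, zero_add, mul_div_assoc]

theorem feasible_valueAtSqrtTwo (negative : Bool) :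
    Feasible (countingOracles countEven countOdd) (valueAtSqrtTwo negative) := by
  have h₁ : Feasible (countingOracles countEven countOdd) fun 𝔗 : Triangulation =>
      horner ((List.range (16 * 𝔗.n + 1)).map (shiftedCoeff 𝔗)) :=
    .horner (.map (.range_numTetrahedra .id) feasible_shiftedCoeff)
  refine .of_enc_eq (f := fun 𝔗 : Triangulation =>
    ((horner ((List.range (16 * 𝔗.n + 1)).map (shiftedCoeff 𝔗))).1,
      (bif negative then -(horner ((List.range (16 * 𝔗.n + 1)).map (shiftedCoeff 𝔗))).2
        else (horner ((List.range (16 * 𝔗.n + 1)).map (shiftedCoeff 𝔗))).2),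
      4 * 𝔗.n)) id (by fun_prop) (fun _ => rfl) fun 𝔗 => rfl

theorem mainTheorem4 :
    -- The state sums are the values of the Laurent polynomial at the two square roots of two.
    (∀ 𝔗 : Triangulation,
      𝔗.TV 4 1 = laurentEval 𝔗.laurentP (-(Real.sqrt 2 : ℝ)) ∧
      𝔗.TV 4 3 = laurentEval 𝔗.laurentP (Real.sqrt 2 : ℝ)) ∧
    -- Its coefficients are differences of the two counts.
    (∀ (𝔗 : Triangulation) (m : ℤ),
      𝔗.laurentP.coeff m = (countEven (𝔗, m) : ℤ) - (countOdd (𝔗, m) : ℤ)) ∧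
    -- Its degree is linear in the number of tetrahedra.
    (∃ C : ℕ, ∀ (𝔗 : Triangulation) (m : ℤ), 𝔗.laurentP.coeff m ≠ 0 → |m| ≤ C * 𝔗.n) ∧
    -- The two counting problems belong to #P.
    InSharpP countEven ∧ InSharpP countOdd ∧
    -- Polynomially many calls suffice to compute the Laurent polynomial in polynomial time ...
    ReducesToCounting countEven countOdd encTerms (fun 𝔗 l => ofTerms l = 𝔗.laurentP) ∧
    -- ... and to compute the state sums in polynomial time.
    (∀ q : ℕ, q = 1 ∨ q = 3 →
      ReducesToCounting countEven countOdd SqrtTwoNumber.enc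
        (fun 𝔗 x => x.value = 𝔗.TV 4 q)) := by
  have h₁ : ∀ 𝔗 : Triangulation, 𝔗.TV 4 1 = laurentEval 𝔗.laurentP (-(Real.sqrt 2 : ℝ)) :=
    fun 𝔗 => 𝔗.TV_eq quantumTwo_one
  have h₃ : ∀ 𝔗 : Triangulation, 𝔗.TV 4 3 = laurentEval 𝔗.laurentP (Real.sqrt 2 : ℝ) :=
    fun 𝔗 => by rw [𝔗.TV_eq quantumTwo_three, neg_neg]
  refine ⟨fun 𝔗 => ⟨h₁ 𝔗, h₃ 𝔗⟩, fun 𝔗 m => 𝔗.coeff_laurentP m,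
    ⟨8, fun 𝔗 m h => 𝔗.abs_le_of_coeff_ne_zero h⟩, inSharpP_countEven, inSharpP_countOdd,
    .of_feasible feasible_laurentTerms ofTerms_laurentTerms, ?_⟩
  rintro q (rfl | rfl)
  · exact .of_feasible (feasible_valueAtSqrtTwo true) fun 𝔗 => by
      rw [value_valueAtSqrtTwo, h₁]; rfl
  · exact .of_feasible (feasible_valueAtSqrtTwo false) fun 𝔗 => by
      rw [value_valueAtSqrtTwo, h₃]; rfl
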